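/- Consider the incompressible Navier–Stokes system with viscosity $1$ on $\mathbb R^3$, $$(NS)\qquad \partial_t u-\Delta u+u\cdot\nabla u=-\nabla p,\qquad \operatorname{div}u=0,\qquad u(0)=u^0 ,$$ for real-valued velocity fields. Write $\hat f(\xi)=\int_{\mathbb R^3}e^{-ix\cdot\xi}f(x)\,dx$ for the Fourier transform in the space variable, and $$\|f\|_{\dot H^{s}}^2=\int|\xi|^{2s}|\hat f(\xi)|^2d\xi,\qquad \|u\|_{\widetilde L^\infty(\dot H^{s})}^2=\int|\xi|^{2s}\Big[\sup_{0\le t<\infty}|\hat u(t,\xi)|\Big]^2d\xi,\qquad \|u\|_{L^2(\dot H^{s})}^2=\int\int_0^\infty|\xi|^{2s}|\hat u(t,\xi)|^2\,dt\,d\xi,$$ where the spaces consist of tempered distributions (depending on $t\ge 0$ in the last two cases) whose Fourier transform in space is a locally integrable function and whose norm is finite. A (global, mild) solution of $(NS)$ is a real-valued, divergence-free $u$ with $$u(t)=e^{t\Delta}u^0-\int_0^te^{(t-s)\Delta}\,\mathbb P\operatorname{div}(u\otimes u)(s)\,ds\qquad\text{for all }t\ge0,$$ $\mathbb P$ being the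 Leray projection onto divergence-free fields; the identity is understood on the Fourier side, with $\widehat{u_ju_k}=(2\pi)^{-3}\hat u_j*\hat u_k$ and all integrals absolutely convergent for almost every $\xi$. There exist universal constants $\epsilon_0>0$ and $c_0>0$ such that for every real-valued divergence-free $u^0\in\dot H^{1/2}(\mathbb R^3)$ with $\|u^0\|_{\dot H^{1/2}}<\epsilon_0$ the system $(NS)$ has a unique global solution $$u\in\widetilde L^\infty(\dot H^{1/2})\cap L^2(\dot H^{3/2}).$$ This solution is analytic in the sense that $$\|e^{\sqrt t|D|}u\|^2_{\widetilde L^\infty(\dot H^{1/2})}+\|e^{\sqrt t|D|}u\|^2_{L^2(\dot H^{3/2})}\le c_0\,\|u^0\|^2_{\dot H^{1/2}},$$ where $e^{\sqrt t|D|}$ is the Fourier multiplier with symbol $e^{\sqrt t|\xi|}$. -/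

import Mathlib

open MeasureTheory
open scoped ENNReal SchwartzMap FourierTransform LineDeriv

noncomputable section

namespace NavierStokes

/-- The physical (and the frequency) space `ℝ³`. -/
abbrev Space := EuclideanSpace ℝ (Fin 3)

/-- Values of vector fields and of their Fourier transforms. -/
abbrev Vec := EuclideanSpace ℂ (Fin 3)

/-- Vector-valued tempered distributions on `ℝ³`; real fields are singled out by `IsReal`. -/
abbrev Field := 𝓢'(Space, Vec)

/-- The distribution takes real values on real test functions. -/
def IsReal (f : Field) : Prop :=
  ∀ φ : 𝓢(Space, ℂ), (∀ x, (φ x).im = 0) → ∀ j, (f φ j).im = 0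

/-- `div f = ∑ⱼ ∂ⱼ fⱼ = 0` in the sense of distributions. -/
def IsDivFree (f : Field) : Prop :=
  ∀ φ : 𝓢(Space, ℂ),
    ∑ j : Fin 3, (∂_{(EuclideanSpace.single j (1 : ℝ) : Space)} f : Field) φ j = 0

/-- The Fourier transform of `f`, normalized as `f̂(ξ) = ∫ exp(-i x·ξ) f(x) dx`, is the locally
integrable function `g`. Mathlib's transform `𝓕` has the kernel `exp(-2πi x·ξ)`, so that
`𝓕 f` is the function `ξ ↦ f̂(2πξ)`. -/
def HasFourier (f : Field) (g : Space → Vec) : Prop :=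
  LocallyIntegrable g ∧
    ∀ φ : 𝓢(Space, ℂ),
      Integrable (fun ξ : Space => φ ξ • g ((2 * Real.pi) • ξ)) ∧
        (𝓕 f : Field) φ = ∫ ξ : Space, φ ξ • g ((2 * Real.pi) • ξ)

/-- The norm of `Ḣˢ(ℝ³)`: `(∫ |ξ|²ˢ |f̂(ξ)|² dξ)^{1/2}`. The function `f̂` is unique up to null
sets, so that the infimum has at most one value; it is `∞` if `f̂` is not a locally integrable
function. Thus `f ∈ Ḣˢ` if and only if the norm is finite. -/
def hdotNorm (s : ℝ) (f : Field) : ℝ≥0∞ :=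
  ⨅ (g : Space → Vec) (_ : HasFourier f g),
    (∫⁻ ξ : Space, ENNReal.ofReal (‖ξ‖ ^ (2 * s)) * ‖g ξ‖ₑ ^ 2) ^ (1 / 2 : ℝ)

/-- `g (t, ξ)` is a jointly measurable version of the Fourier transform in space `û(t, ξ)` of the
time-dependent field `u`, for times `t ≥ 0`. -/
def HasSpectrum (u : ℝ → Field) (g : ℝ → Space → Vec) : Prop :=
  Measurable (Function.uncurry g) ∧ ∀ t, 0 ≤ t → HasFourier (u t) (g t)

/-- The norm of `L̃^∞(Ḣˢ)`: `(∫ |ξ|²ˢ [sup_{0 ≤ t < ∞} |û(t, ξ)|]² dξ)^{1/2}`, for the best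
measurable version of `û` (versions may differ on a null set of `ξ` that depends on `t`);
it is `∞` if there is none. -/
def supNorm (s : ℝ) (u : ℝ → Field) : ℝ≥0∞ :=
  ⨅ (g : ℝ → Space → Vec) (_ : HasSpectrum u g),
    (∫⁻ ξ : Space, ENNReal.ofReal (‖ξ‖ ^ (2 * s)) *
      (⨆ (t : ℝ) (_ : 0 ≤ t), ‖g t ξ‖ₑ) ^ 2) ^ (1 / 2 : ℝ)

/-- The norm of `L²(Ḣˢ)`: `(∫ ∫₀^∞ |ξ|²ˢ |û(t, ξ)|² dt dξ)^{1/2}`. All versions of `û` give the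
same value; it is `∞` if there is none. -/
def l2Norm (s : ℝ) (u : ℝ → Field) : ℝ≥0∞ :=
  ⨅ (g : ℝ → Space → Vec) (_ : HasSpectrum u g),
    (∫⁻ ξ : Space, ∫⁻ t in Set.Ici (0 : ℝ),
      ENNReal.ofReal (‖ξ‖ ^ (2 * s)) * ‖g t ξ‖ₑ ^ 2) ^ (1 / 2 : ℝ)

/-- `h = m(D) f`, the Fourier multiplier with symbol `m`: `ĥ(ξ) = m(ξ) f̂(ξ)`. -/
def IsFourierMultiplier (m : Space → ℝ) (f h : Field) : Prop :=
  ∃ g : Space → Vec, HasFourier f g ∧ HasFourier h (fun ξ => (m ξ : ℂ) • g ξ)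

/-- The Fourier transform `(2π)⁻³ (f̂ⱼ ∗ f̂ₖ)(ξ)` of the product `fⱼ fₖ`, where `g = f̂`. -/
def tensorHat (g : Space → Vec) (j k : Fin 3) (ξ : Space) : ℂ :=
  ((2 * Real.pi) ^ 3 : ℝ)⁻¹ * ∫ η : Space, g (ξ - η) j * g η k

/-- The Fourier transform of `div (f ⊗ f)`, with components `∑ₖ i ξₖ (fₖ fⱼ)^(ξ)`, where `g = f̂`. -/
def divTensorHat (g : Space → Vec) (ξ : Space) : Vec :=
  WithLp.toLp 2 fun j => ∑ k : Fin 3, Complex.I * (ξ k : ℂ) * tensorHat g k j ξ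

/-- The symbol of the Leray projection `ℙ` onto divergence-free fields:
`a ↦ a - ξ (ξ · a) / |ξ|²`. -/
def leraySymbol (ξ : Space) (a : Vec) : Vec :=
  WithLp.toLp 2 fun j =>
    a j - (ξ j : ℂ) * (∑ k : Fin 3, (ξ k : ℂ) * a k) / ((‖ξ‖ ^ 2 : ℝ) : ℂ)

/-- The Fourier transform of `e^{(t-s)Δ} ℙ div (u ⊗ u)(s)`, where `g = û`. -/
def duhamelIntegrand (g : ℝ → Space → Vec) (t : ℝ) (ξ : Space) (s : ℝ) : Vec :=
  (Real.exp (-(t - s) * ‖ξ‖ ^ 2) : ℂ) • leraySymbol ξ (divTensorHat (g s) ξ)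

/-- `u` is a global mild solution of the incompressible Navier-Stokes system with viscosity `1`
and initial velocity `u₀`: a real, divergence-free field with
`u(t) = e^{tΔ} u₀ - ∫₀ᵗ e^{(t-s)Δ} ℙ div (u ⊗ u)(s) ds` for all `t ≥ 0`, the identity being read on
the Fourier side, with all integrals in it absolutely convergent. -/
def IsMildSolution (u₀ : Field) (u : ℝ → Field) : Prop :=
  (∀ t, 0 ≤ t → IsReal (u t) ∧ IsDivFree (u t)) ∧
  ∃ (g₀ : Space → Vec) (g : ℝ → Space → Vec), HasFourier u₀ g₀ ∧ HasSpectrum u g ∧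
    ∀ t, 0 ≤ t → ∀ᵐ ξ : Space,
      (∀ᵐ s : ℝ, s ∈ Set.Icc 0 t →
        ∀ j k, Integrable (fun η : Space => g s (ξ - η) j * g s η k)) ∧
      IntervalIntegrable (duhamelIntegrand g t ξ) volume 0 t ∧
      g t ξ = (Real.exp (-t * ‖ξ‖ ^ 2) : ℂ) • g₀ ξ - ∫ s in (0 : ℝ)..t, duhamelIntegrand g t ξ s

/-- Global mild solutions in the class `L̃^∞(Ḣ^{1/2}) ∩ L²(Ḣ^{3/2})`. -/
def IsGlobalSolution (u₀ : Field) (u : ℝ → Field) : Prop :=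
  IsMildSolution u₀ u ∧ supNorm (1 / 2) u < ∞ ∧ l2Norm (3 / 2) u < ∞

end NavierStokes

end

noncomputable section

namespace NavierStokes

/-! ### Integrals over space -/

/-! Everything happens on the Fourier side and rests on one scale-invariant estimate in `L̃⁴(Ḣ¹)`, a
space which contains `L̃^∞(Ḣ^{1/2}) ∩ L²(Ḣ^{3/2})` by interpolation in time at each frequency
(`l4Sq_le`). The convolution bound `∫ |ξ - η|⁻² |η|⁻² dη ≤ C / |ξ|` gives the product law `L̃⁴(Ḣ¹) ·
L̃⁴(Ḣ¹) ⊆ L²(Ḣ^{1/2})` (`exists_prodSq_le`). The heat kernel then absorbs the derivative in the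
Duhamel term: Cauchy-Schwarz in time gives the supremum bound, Young's inequality the dissipation
bound, and their product the return to `L̃⁴(Ḣ¹)` (`l4Sq_duhamelMajorant_le`).

Instead of a contraction argument, the solution is written as the series of all iterated Duhamel
terms. Replacing each factor by its absolute value yields a scalar series with values in `[0, ∞]`,
where Tonelli justifies every rearrangement. For small data this majorant is bounded in `L̃⁴(Ḣ¹)`,
hence finite almost everywhere (`exists_majorant_bound`, `ae_solMajorant_lt_top`). By domination the
vector series converges and solves the equation (`mildSeries_eq`). Each term is Hermitian and
orthogonal to `ξ`, so the solution is real and divergence-free.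

Analyticity costs nothing extra. The weight `e^{√t|ξ|}` is submultiplicative under convolution, and
since `√t ≤ √s + √(t - s)`, half of the heat decay pays for carrying it from time `s` to time `t`
(`weight_mul_heat_le`). So the one majorant, built with viscosity `1/2`, dominates the solution with
its weight.

For uniqueness, let `Φ(T)` be the squared `L̃⁴(Ḣ¹)` size, before time `T`, of the difference between
an arbitrary solution and the small one. The linear terms are absorbed by smallness, which leaves `Φ
≤ c Φ²`. So `Φ` either vanishes or stays above a positive constant; being continuous with `Φ(0) =
0`, it vanishes identically (`exists_uniqueness_threshold`). -/

theorem enorm_ne_zero_ae : ∀ᵐ ξ : Space, ‖ξ‖ₑ ≠ 0 := by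
  have : ∀ᵐ ξ : Space, ξ ≠ 0 := by simp [ae_iff]
  filter_upwards [this] with ξ h
  simpa using h

theorem lintegral_comp_smul (f : Space → ℝ≥0∞) {R : ℝ} (hR : 0 < R) :
    ∫⁻ x : Space, f (R • x) = ENNReal.ofReal (R ^ 3)⁻¹ * ∫⁻ x : Space, f x := by
  have h := (Homeomorph.smulOfNeZero R hR.ne' : Space ≃ₜ Space).measurableEmbedding.lintegral_map
    (μ := (volume : Measure Space)) f
  have h2 : Measure.map (Homeomorph.smulOfNeZero R hR.ne' : Space ≃ₜ Space)
      (volume : Measure Space) = ENNReal.ofReal (R ^ 3)⁻¹ • volume := by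
    have := Measure.map_addHaar_smul (volume : Measure Space) hR.ne'
    rw [finrank_euclideanSpace_fin, abs_of_pos (by positivity)] at this
    exact this
  rw [h2, lintegral_smul_measure] at h
  exact h.symm

/-- Radial majorant of the kernel `|ξ - η|⁻² |η|⁻²`. -/
def radialKernel (R : ℝ≥0∞) (η : Space) : ℝ≥0∞ := (‖η‖ₑ ^ 2)⁻¹ * ((max ‖η‖ₑ R) ^ 2)⁻¹

theorem measurable_radialKernel (R : ℝ≥0∞) : Measurable (radialKernel R) := by
  unfold radialKernel; fun_prop

/-- In polar coordinates the Jacobian `r²` cancels the singular factor, which leaves `max(r, 1)⁻² ≤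
2 / (1 + r²)`. -/
theorem lintegral_radialKernel_one_lt_top : ∫⁻ η, radialKernel 1 η < ∞ := by
  have h : Integrable (fun η : Space => (fun y : ℝ => (y ^ 2)⁻¹ * ((max y 1) ^ 2)⁻¹) ‖η‖) := by
    rw [integrable_fun_norm_addHaar volume (f := fun y : ℝ => (y ^ 2)⁻¹ * ((max y 1) ^ 2)⁻¹)]
    have h1 : IntegrableOn (fun y : ℝ => 2 * (1 + y ^ 2)⁻¹) (Set.Ioi 0) :=
      (integrable_inv_one_add_sq.const_mul 2).integrableOn
    refine h1.mono' (by fun_prop) ?_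
    filter_upwards [ae_restrict_mem measurableSet_Ioi] with y hy
    have hy : 0 < y := hy
    simp only [finrank_euclideanSpace_fin, smul_eq_mul]
    have hm : 0 < max y 1 := by positivity
    have : y ^ (3 - 1) * ((y ^ 2)⁻¹ * (max y 1 ^ 2)⁻¹) = (max y 1 ^ 2)⁻¹ := by
      field_simp
    rw [this, Real.norm_of_nonneg (by positivity), ← div_eq_mul_inv, inv_eq_one_div,
      div_le_div_iff₀ (by positivity) (by positivity)]
    nlinarith [le_max_left y 1, le_max_right y 1]
  have h2 := h.hasFiniteIntegral
  rw [hasFiniteIntegral_iff_enorm] at h2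
  refine lt_of_eq_of_lt (lintegral_congr_ae ?_) h2
  filter_upwards [enorm_ne_zero_ae] with η hη
  have hη' : 0 < ‖η‖ := by simpa using hη
  have hm : 0 < max ‖η‖ 1 := by positivity
  rw [Real.enorm_eq_ofReal (by positivity), ENNReal.ofReal_mul (by positivity),
    ENNReal.ofReal_inv_of_pos (by positivity), ENNReal.ofReal_inv_of_pos (by positivity),
    ENNReal.ofReal_pow (by positivity), ENNReal.ofReal_pow (by positivity), ENNReal.ofReal_max,
    ofReal_norm, ENNReal.ofReal_one, radialKernel]

/-- Scaling: the kernel is homogeneous of degree `-4` in `(η, R)`, and integration over three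
dimensions gives back `R³`. -/
theorem lintegral_radialKernel {R : ℝ} (hR : 0 < R) :
    ∫⁻ η, radialKernel (ENNReal.ofReal R) η =
      (ENNReal.ofReal R)⁻¹ * ∫⁻ η, radialKernel 1 η := by
  have h := lintegral_comp_smul (radialKernel (ENNReal.ofReal R)) hR
  have hR0 : ENNReal.ofReal R ≠ 0 := by simpa using hR
  have h2 : ∀ x : Space, radialKernel (ENNReal.ofReal R) (R • x) =
      ((ENNReal.ofReal R) ^ 4)⁻¹ * radialKernel 1 x := by
    intro x
    have : max (ENNReal.ofReal R * ‖x‖ₑ) (ENNReal.ofReal R) = ENNReal.ofReal R * max ‖x‖ₑ 1 := by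
      rw [mul_max, mul_one]
    simp only [radialKernel, enorm_smul, Real.enorm_eq_ofReal hR.le, this, mul_pow]
    rw [ENNReal.mul_inv (by simp [hR0]) (by simp), ENNReal.mul_inv (by simp [hR0]) (by simp),
      show 4 = 2 + 2 from rfl, pow_add, ENNReal.mul_inv (by simp [hR0]) (by simp)]
    ring
  simp_rw [h2] at h
  rw [lintegral_const_mul _ (measurable_radialKernel 1), ENNReal.ofReal_inv_of_pos (by positivity),
    ENNReal.ofReal_pow hR.le] at h
  set ρ := ENNReal.ofReal R
  have ht : ρ ≠ ∞ := ENNReal.ofReal_ne_top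
  have h3 : ρ ^ 3 * ((ρ ^ 4)⁻¹ * ∫⁻ η, radialKernel 1 η) =
      ∫⁻ η, radialKernel ρ η := by
    rw [h, ← mul_assoc, ENNReal.mul_inv_cancel (by simp [hR0]) (by finiteness), one_mul]
  rw [← h3, ← mul_assoc]
  congr 1
  rw [show 4 = 3 + 1 from rfl, pow_add, ENNReal.mul_inv (by simp [hR0]) (by simp [ht]), ← mul_assoc,
    ENNReal.mul_inv_cancel (by simp [hR0]) (by finiteness), one_mul, pow_one]

/-- The longer of `ξ - η` and `η` has length at least `|ξ| / 2` by the triangle inequality, so the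
kernel is at most the radial majorant evaluated at the shorter one. -/
theorem kernel_le (ξ η : Space) : (‖ξ - η‖ₑ ^ 2)⁻¹ * (‖η‖ₑ ^ 2)⁻¹ ≤
    radialKernel (ENNReal.ofReal (‖ξ‖ / 2)) η + radialKernel (ENNReal.ofReal (‖ξ‖ / 2)) (ξ - η) := by
  have key : ∀ a b : Space, ‖ξ‖ ≤ ‖a‖ + ‖b‖ → ‖b‖ ≤ ‖a‖ →
      (‖a‖ₑ ^ 2)⁻¹ * (‖b‖ₑ ^ 2)⁻¹ ≤ radialKernel (ENNReal.ofReal (‖ξ‖ / 2)) b := by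
    intro a b h1 h2
    rw [radialKernel, mul_comm]
    gcongr
    rw [max_le_iff]
    rw [← ofReal_norm a, ← ofReal_norm b]
    exact ⟨ENNReal.ofReal_le_ofReal h2, ENNReal.ofReal_le_ofReal (by linarith)⟩
  have htri : ‖ξ‖ ≤ ‖ξ - η‖ + ‖η‖ := by simpa using norm_add_le (ξ - η) η
  rcases le_total ‖η‖ ‖ξ - η‖ with h | h
  · exact (key _ _ htri h).trans le_self_add
  · rw [mul_comm]
    exact (key _ _ (by linarith) h).trans le_add_self

theorem exists_kernel_bound : ∃ C : ℝ≥0∞, C ≠ ∞ ∧ ∀ ξ : Space, ‖ξ‖ₑ ≠ 0 →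
    ∫⁻ η : Space, (‖ξ - η‖ₑ ^ 2)⁻¹ * (‖η‖ₑ ^ 2)⁻¹ ≤ C * ‖ξ‖ₑ⁻¹ := by
  -- One factor `2` counts the two regions of `kernel_le`, the other comes from `(|ξ| / 2)⁻¹`.
  refine ⟨4 * ∫⁻ η, radialKernel 1 η,
    ENNReal.mul_ne_top (by simp) lintegral_radialKernel_one_lt_top.ne, fun ξ hξ => ?_⟩
  have hξ' : 0 < ‖ξ‖ := by simpa using hξ
  calc _ ≤ ∫⁻ η, (radialKernel (ENNReal.ofReal (‖ξ‖ / 2)) η +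
        radialKernel (ENNReal.ofReal (‖ξ‖ / 2)) (ξ - η)) := lintegral_mono (kernel_le ξ)
    _ = 2 * ((ENNReal.ofReal (‖ξ‖ / 2))⁻¹ * ∫⁻ η, radialKernel 1 η) := by
      rw [lintegral_add_left (measurable_radialKernel _),
        lintegral_sub_left_eq_self (radialKernel (ENNReal.ofReal (‖ξ‖ / 2))) ξ,
        lintegral_radialKernel (by positivity), two_mul]
    _ = _ := by
      rw [ENNReal.ofReal_div_of_pos (by norm_num), ofReal_norm,
        ENNReal.inv_div (by simp) (by simp), div_eq_mul_inv]
      simp only [ENNReal.ofReal_ofNat]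
      ring

/-! ### Cauchy-Schwarz inequalities -/

section CauchySchwarz

variable {α : Type*} [MeasurableSpace α] {μ : Measure α} {f g : α → ℝ≥0∞}

theorem lintegral_mul_le_sqrt (hf : AEMeasurable f μ) (hg : AEMeasurable g μ) :
    ∫⁻ a, f a * g a ∂μ ≤ (∫⁻ a, f a ^ 2 ∂μ) ^ (1 / 2 : ℝ) * (∫⁻ a, g a ^ 2 ∂μ) ^ (1 / 2 : ℝ) := by
  simpa using ENNReal.lintegral_mul_le_Lp_mul_Lq μ Real.HolderConjugate.two_two hf hg

theorem sq_lintegral_mul_le (hf : AEMeasurable f μ) (hg : AEMeasurable g μ) :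
    (∫⁻ a, f a * g a ∂μ) ^ 2 ≤ (∫⁻ a, f a ^ 2 ∂μ) * ∫⁻ a, g a ^ 2 ∂μ := by
  calc _ ≤ ((∫⁻ a, f a ^ 2 ∂μ) ^ (1 / 2 : ℝ) * (∫⁻ a, g a ^ 2 ∂μ) ^ (1 / 2 : ℝ)) ^ 2 := by
        gcongr; exact lintegral_mul_le_sqrt hf hg
    _ = _ := by
      rw [mul_pow, ← ENNReal.rpow_mul_natCast, ← ENNReal.rpow_mul_natCast]
      norm_num

/-- Cauchy-Schwarz for `√f · (√f g)`. With `f` the heat kernel this is the inner step of Young's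
inequality `L¹ * L² ⊆ L²` in time. -/
theorem sq_lintegral_mul_le_weight (hf : AEMeasurable f μ) (hg : AEMeasurable g μ) :
    (∫⁻ a, f a * g a ∂μ) ^ 2 ≤ (∫⁻ a, f a ∂μ) * ∫⁻ a, f a * g a ^ 2 ∂μ := by
  have h : ∀ x : ℝ≥0∞, (x ^ (1 / 2 : ℝ)) ^ 2 = x := fun x => by
    rw [← ENNReal.rpow_mul_natCast]; norm_num
  have := sq_lintegral_mul_le (f := fun a => f a ^ (1 / 2 : ℝ))
    (g := fun a => f a ^ (1 / 2 : ℝ) * g a) (hf.pow_const _) ((hf.pow_const _).mul hg)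
  simpa only [← mul_assoc, mul_pow, ← sq, h] using this

end CauchySchwarz

/-! ### The scalar bilinear operator and its norms -/

/-- Convolution of nonnegative functions. -/
def conv (f h : Space → ℝ≥0∞) (ξ : Space) : ℝ≥0∞ := ∫⁻ η, f (ξ - η) * h η

/-- The symbol of the heat flow with viscosity `1 / 2`. -/
def heat (t : ℝ) (ξ : Space) : ℝ≥0∞ := ENNReal.ofReal (Real.exp (-t * (‖ξ‖ ^ 2 / 2)))

/-- Positive majorant of the Duhamel term. -/
def duhamelMajorant (κ : ℝ≥0∞) (f h : ℝ → Space → ℝ≥0∞) (t : ℝ) (ξ : Space) : ℝ≥0∞ :=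
  ∫⁻ s in Set.Ioo 0 t, heat (t - s) ξ * (κ * ‖ξ‖ₑ * conv (f s) (h s) ξ)

/-- `∫₀^∞ f(t, ξ)² dt`. -/
def timeSq (f : ℝ → Space → ℝ≥0∞) (ξ : Space) : ℝ≥0∞ := ∫⁻ t in Set.Ioi 0, f t ξ ^ 2

/-- `∫₀^∞ f(t, ξ)⁴ dt`. -/
def timeFourth (f : ℝ → Space → ℝ≥0∞) (ξ : Space) : ℝ≥0∞ := ∫⁻ t in Set.Ioi 0, f t ξ ^ 4

/-- The square of the norm of `L̃⁴(Ḣ¹)`. -/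
def l4Sq (f : ℝ → Space → ℝ≥0∞) : ℝ≥0∞ := ∫⁻ ξ, ‖ξ‖ₑ ^ 2 * timeFourth f ξ ^ (1 / 2 : ℝ)

/-- The square of the norm in `L²(Ḣ^{1/2})` of a product. -/
def prodSq (f h : ℝ → Space → ℝ≥0∞) : ℝ≥0∞ :=
  ∫⁻ ξ, ‖ξ‖ₑ * timeSq (fun s => conv (f s) (h s)) ξ

theorem measurable_heat : Measurable (Function.uncurry heat) := by
  unfold heat Function.uncurry
  fun_prop

theorem measurable_conv {f h : ℝ → Space → ℝ≥0∞} (hf : Measurable (Function.uncurry f))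
    (hh : Measurable (Function.uncurry h)) :
    Measurable (Function.uncurry fun s => conv (f s) (h s)) := by
  have : Measurable (Function.uncurry fun (p : ℝ × Space) (η : Space) =>
      f p.1 (p.2 - η) * h p.1 η) :=
    (hf.comp (f := fun q : (ℝ × Space) × Space => (q.1.1, q.1.2 - q.2)) (by fun_prop)).mul
      (hh.comp (f := fun q : (ℝ × Space) × Space => (q.1.1, q.2)) (by fun_prop))
  exact this.lintegral_prod_right'

theorem measurable_duhamelMajorant (κ : ℝ≥0∞) {f h : ℝ → Space → ℝ≥0∞}
    (hf : Measurable (Function.uncurry f)) (hh : Measurable (Function.uncurry h)) :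
    Measurable (Function.uncurry (duhamelMajorant κ f h)) := by
  have h1 : ∀ t ξ, duhamelMajorant κ f h t ξ = ∫⁻ s, (Set.Ioo 0 t).indicator
      (fun s => heat (t - s) ξ * (κ * ‖ξ‖ₑ * conv (f s) (h s) ξ)) s := by
    intro t ξ
    rw [lintegral_indicator measurableSet_Ioo, duhamelMajorant]
  have h2 : Measurable fun q : (ℝ × Space) × ℝ =>
      {q : (ℝ × Space) × ℝ | 0 < q.2 ∧ q.2 < q.1.1}.indicator
      (fun q => heat (q.1.1 - q.2) q.1.2 * (κ * ‖q.1.2‖ₑ * conv (f q.2) (h q.2) q.1.2)) q := by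
    refine Measurable.indicator ?_ ?_
    · refine (measurable_heat.comp (f := fun q : (ℝ × Space) × ℝ => (q.1.1 - q.2, q.1.2))
        (by fun_prop)).mul (Measurable.mul (by fun_prop) ?_)
      exact (measurable_conv hf hh).comp (f := fun q : (ℝ × Space) × ℝ => (q.2, q.1.2))
        (by fun_prop)
    · exact (measurableSet_lt measurable_const measurable_snd).inter
        (measurableSet_lt measurable_snd (measurable_fst.comp measurable_fst))
  have h3 := h2.lintegral_prod_right' (ν := volume)
  convert h3 using 1
  ext ⟨t, ξ⟩
  exact h1 t ξ

theorem measurable_timeSq {f : ℝ → Space → ℝ≥0∞} (hf : Measurable (Function.uncurry f)) :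
    Measurable (timeSq f) := by
  have : Measurable (Function.uncurry fun (ξ : Space) (t : ℝ) => f t ξ ^ 2) :=
    (hf.comp measurable_swap).pow_const 2
  exact this.lintegral_prod_right'

theorem measurable_timeFourth {f : ℝ → Space → ℝ≥0∞} (hf : Measurable (Function.uncurry f)) :
    Measurable (timeFourth f) := by
  have : Measurable (Function.uncurry fun (ξ : Space) (t : ℝ) => f t ξ ^ 4) :=
    (hf.comp measurable_swap).pow_const 4
  exact this.lintegral_prod_right'

theorem lintegral_conv {f h : Space → ℝ≥0∞} (hf : Measurable f) (hh : Measurable h) :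
    ∫⁻ ξ, conv f h ξ = (∫⁻ ξ, f ξ) * ∫⁻ ξ, h ξ := by
  unfold conv
  rw [lintegral_lintegral_swap (by fun_prop)]
  have : ∀ η : Space, ∫⁻ ξ : Space, f (ξ - η) * h η = (∫⁻ ξ, f ξ) * h η := by
    intro η
    rw [lintegral_mul_const _ (by fun_prop), lintegral_sub_right_eq_self f η]
  simp_rw [this]
  rw [lintegral_const_mul _ hh]

/-- Inserting `|ξ - η|⁻¹ |η|⁻¹` and its inverse, then applying Cauchy-Schwarz in `η`, turns the
kernel bound into a frequency-wise form of `Ḣ¹ · Ḣ¹ ⊆ Ḣ^{1/2}`. -/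
theorem sq_conv_le {C : ℝ≥0∞} (hC : ∀ ξ : Space, ‖ξ‖ₑ ≠ 0 →
      ∫⁻ η : Space, (‖ξ - η‖ₑ ^ 2)⁻¹ * (‖η‖ₑ ^ 2)⁻¹ ≤ C * ‖ξ‖ₑ⁻¹)
    {f h : Space → ℝ≥0∞} (hf : Measurable f) (hh : Measurable h) (ξ : Space) :
    ‖ξ‖ₑ * conv f h ξ ^ 2 ≤
      C * conv (fun η => ‖η‖ₑ ^ 2 * f η ^ 2) (fun η => ‖η‖ₑ ^ 2 * h η ^ 2) ξ := by
  by_cases hξ : ‖ξ‖ₑ = 0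
  · simp [hξ]
  have h1 : conv f h ξ = ∫⁻ η, (‖ξ - η‖ₑ⁻¹ * ‖η‖ₑ⁻¹) *
      (‖ξ - η‖ₑ * f (ξ - η) * (‖η‖ₑ * h η)) := by
    refine lintegral_congr_ae ?_
    have hne : ∀ᵐ η : Space, ξ - η ≠ 0 := by
      have : ∀ᵐ η : Space, η ≠ ξ := by simp [ae_iff]
      filter_upwards [this] with η h h'
      exact h (sub_eq_zero.1 h').symm
    filter_upwards [enorm_ne_zero_ae, hne] with η h1 h2
    have h2 : ‖ξ - η‖ₑ ≠ 0 := by simpa using h2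
    calc f (ξ - η) * h η = (‖ξ - η‖ₑ⁻¹ * ‖ξ - η‖ₑ) * (‖η‖ₑ⁻¹ * ‖η‖ₑ) * (f (ξ - η) * h η) := by
          rw [ENNReal.inv_mul_cancel h1 (by simp), ENNReal.inv_mul_cancel h2 (by simp)]; simp
      _ = _ := by ring
  calc ‖ξ‖ₑ * conv f h ξ ^ 2
      ≤ ‖ξ‖ₑ * ((∫⁻ η, (‖ξ - η‖ₑ⁻¹ * ‖η‖ₑ⁻¹) ^ 2) *
          ∫⁻ η, (‖ξ - η‖ₑ * f (ξ - η) * (‖η‖ₑ * h η)) ^ 2) := by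
        rw [h1]
        gcongr
        exact sq_lintegral_mul_le (by fun_prop) (by fun_prop)
    _ ≤ ‖ξ‖ₑ * ((C * ‖ξ‖ₑ⁻¹) *
          conv (fun η => ‖η‖ₑ ^ 2 * f η ^ 2) (fun η => ‖η‖ₑ ^ 2 * h η ^ 2) ξ) := by
        gcongr
        · refine le_trans (le_of_eq ?_) (hC ξ hξ)
          simp only [mul_pow, ENNReal.inv_pow]
        · simp only [conv, mul_pow, le_refl]
    _ = _ := by
        rw [mul_comm C, ← mul_assoc, ← mul_assoc, ENNReal.mul_inv_cancel hξ (by simp), one_mul]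

/-- The product law `L̃⁴(Ḣ¹) · L̃⁴(Ḣ¹) ⊆ L²(Ḣ^{1/2})`. -/
theorem exists_prodSq_le : ∃ C : ℝ≥0∞, C ≠ ∞ ∧ ∀ f h : ℝ → Space → ℝ≥0∞,
    Measurable (Function.uncurry f) → Measurable (Function.uncurry h) →
    prodSq f h ≤ C * (l4Sq f * l4Sq h) := by
  obtain ⟨C, hCt, hC⟩ := exists_kernel_bound
  refine ⟨C, hCt, fun f h hf hh => ?_⟩
  have hfs : ∀ s, Measurable (f s) := fun s => hf.comp measurable_prodMk_left
  have hhs : ∀ s, Measurable (h s) := fun s => hh.comp measurable_prodMk_left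
  have hξ : ∀ ξ : Space, ‖ξ‖ₑ * timeSq (fun s => conv (f s) (h s)) ξ ≤
      C * conv (fun η => ‖η‖ₑ ^ 2 * timeFourth f η ^ (1 / 2 : ℝ))
        (fun η => ‖η‖ₑ ^ 2 * timeFourth h η ^ (1 / 2 : ℝ)) ξ := by
    intro ξ
    have hm : Measurable fun q : ℝ × Space => f q.1 (ξ - q.2) :=
      hf.comp (f := fun q : ℝ × Space => (q.1, ξ - q.2)) (by fun_prop)
    have hm' : Measurable fun q : ℝ × Space => h q.1 q.2 := hh
    calc ‖ξ‖ₑ * timeSq (fun s => conv (f s) (h s)) ξ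
        = ∫⁻ s in Set.Ioi (0 : ℝ), ‖ξ‖ₑ * conv (f s) (h s) ξ ^ 2 := by
          rw [timeSq, lintegral_const_mul]
          exact (((measurable_conv hf hh).comp measurable_prodMk_right)).pow_const 2
      _ ≤ ∫⁻ s in Set.Ioi (0 : ℝ), C * conv (fun η => ‖η‖ₑ ^ 2 * f s η ^ 2)
            (fun η => ‖η‖ₑ ^ 2 * h s η ^ 2) ξ :=
          lintegral_mono fun s => sq_conv_le hC (hfs s) (hhs s) ξ
      _ = C * ∫⁻ s in Set.Ioi (0 : ℝ), ∫⁻ η, ‖ξ - η‖ₑ ^ 2 * f s (ξ - η) ^ 2 *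
            (‖η‖ₑ ^ 2 * h s η ^ 2) := by
          rw [lintegral_const_mul' _ _ hCt]; rfl
      _ = C * ∫⁻ η, ∫⁻ s in Set.Ioi (0 : ℝ), ‖ξ - η‖ₑ ^ 2 * f s (ξ - η) ^ 2 *
            (‖η‖ₑ ^ 2 * h s η ^ 2) := by
          rw [lintegral_lintegral_swap]
          refine Measurable.aemeasurable ?_
          unfold Function.uncurry
          fun_prop
      _ ≤ _ := by
          unfold conv
          gcongr with η
          have e : ∀ s, ‖ξ - η‖ₑ ^ 2 * f s (ξ - η) ^ 2 * (‖η‖ₑ ^ 2 * h s η ^ 2) =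
              (‖ξ - η‖ₑ ^ 2 * ‖η‖ₑ ^ 2) * (f s (ξ - η) ^ 2 * h s η ^ 2) := fun s => by ring
          have hf1 : Measurable fun s => f s (ξ - η) := hf.comp measurable_prodMk_right
          have hh1 : Measurable fun s => h s η := hh.comp measurable_prodMk_right
          simp_rw [e]
          rw [lintegral_const_mul _ (by fun_prop)]
          -- For a fixed pair of frequencies, Cauchy-Schwarz in time splits the product into two
          -- `L⁴` norms. The time norms sit inside the frequency integral, which is why the tilde
          -- spaces suit this argument.
          have := lintegral_mul_le_sqrt (μ := volume.restrict (Set.Ioi (0 : ℝ)))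
            (f := fun s => f s (ξ - η) ^ 2) (g := fun s => h s η ^ 2) (by fun_prop) (by fun_prop)
          simp only [← pow_mul] at this
          calc _ ≤ ‖ξ - η‖ₑ ^ 2 * ‖η‖ₑ ^ 2 * (timeFourth f (ξ - η) ^ (1 / 2 : ℝ) *
                timeFourth h η ^ (1 / 2 : ℝ)) := by gcongr; exact this
            _ = _ := by ring
  calc prodSq f h ≤ _ := lintegral_mono hξ
    _ = _ := by
      have h1 := measurable_timeFourth hf
      have h2 := measurable_timeFourth hh
      rw [lintegral_const_mul' _ _ hCt, lintegral_conv (by fun_prop) (by fun_prop)]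
      rfl

/-! ### Smoothing by the heat flow -/

theorem lintegral_exp_neg {a : ℝ} (ha : 0 < a) :
    ∫⁻ t in Set.Ioi (0 : ℝ), ENNReal.ofReal (Real.exp (-t * a)) = (ENNReal.ofReal a)⁻¹ := by
  have h := integrableOn_exp_mul_Ioi (a := -a) (by linarith) 0
  have h2 := integral_exp_mul_Ioi (a := -a) (by linarith) 0
  have e : ∀ t, Real.exp (-t * a) = Real.exp (-a * t) := fun t => by ring_nf
  simp_rw [e]
  rw [← ofReal_integral_eq_lintegral_ofReal h (ae_of_all _ fun _ => (Real.exp_pos _).le), h2,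
    ← ENNReal.ofReal_inv_of_pos ha]
  congr 1
  rw [mul_zero, Real.exp_zero, neg_div_neg_eq, one_div]

theorem heat_sq (t : ℝ) (ξ : Space) :
    heat t ξ ^ 2 = ENNReal.ofReal (Real.exp (-t * ‖ξ‖ ^ 2)) := by
  rw [heat, ← ENNReal.ofReal_pow (Real.exp_pos _).le, ← Real.exp_nat_mul]
  congr 2
  push_cast
  ring

theorem lintegral_heat_sq {ξ : Space} (hξ : ‖ξ‖ₑ ≠ 0) :
    ∫⁻ t in Set.Ioi (0 : ℝ), heat t ξ ^ 2 = (‖ξ‖ₑ ^ 2)⁻¹ := by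
  have hξ' : 0 < ‖ξ‖ := by simpa using hξ
  simp_rw [heat_sq]
  rw [lintegral_exp_neg (by positivity), ENNReal.ofReal_pow hξ'.le, ofReal_norm]

theorem lintegral_heat {ξ : Space} (hξ : ‖ξ‖ₑ ≠ 0) :
    ∫⁻ t in Set.Ioi (0 : ℝ), heat t ξ = 2 * (‖ξ‖ₑ ^ 2)⁻¹ := by
  have hξ' : 0 < ‖ξ‖ := by simpa using hξ
  simp_rw [heat]
  rw [lintegral_exp_neg (by positivity), ENNReal.ofReal_div_of_pos (by norm_num),
    ENNReal.ofReal_pow hξ'.le, ofReal_norm, ENNReal.inv_div (by simp) (by simp), div_eq_mul_inv]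
  simp

theorem lintegral_Ioo_comp_sub_le (φ : ℝ → ℝ≥0∞) (t : ℝ) :
    ∫⁻ s in Set.Ioo 0 t, φ (t - s) ≤ ∫⁻ s in Set.Ioi 0, φ s := by
  rw [← lintegral_indicator measurableSet_Ioo, ← lintegral_indicator measurableSet_Ioi,
    ← lintegral_sub_left_eq_self ((Set.Ioi 0).indicator φ) t]
  refine lintegral_mono fun s => ?_
  by_cases h : s ∈ Set.Ioo 0 t
  · have h' : t - s ∈ Set.Ioi 0 := by simpa using h.2
    simp [h, h']
  · simp [h]

section Duhamel

variable {κ : ℝ≥0∞} {f h : ℝ → Space → ℝ≥0∞}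

/-- Cauchy-Schwarz in `s`: the squared `L²` norm in time of the heat kernel is `|ξ|⁻²` and cancels
the square of the derivative factor, uniformly in `t`. -/
theorem sq_duhamelMajorant_le (hf : Measurable (Function.uncurry f))
    (hh : Measurable (Function.uncurry h)) (t : ℝ) (ξ : Space) :
    duhamelMajorant κ f h t ξ ^ 2 ≤ κ ^ 2 * timeSq (fun s => conv (f s) (h s)) ξ := by
  by_cases hξ : ‖ξ‖ₑ = 0
  · simp [duhamelMajorant, hξ]
  have hc : Measurable fun s => conv (f s) (h s) ξ :=
    (measurable_conv hf hh).comp measurable_prodMk_right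
  have hheat : Measurable fun s => heat (t - s) ξ :=
    measurable_heat.comp (f := fun s : ℝ => (t - s, ξ)) (by fun_prop)
  calc duhamelMajorant κ f h t ξ ^ 2
      ≤ (∫⁻ s in Set.Ioo 0 t, heat (t - s) ξ ^ 2) *
          ∫⁻ s in Set.Ioo 0 t, (κ * ‖ξ‖ₑ * conv (f s) (h s) ξ) ^ 2 :=
        sq_lintegral_mul_le hheat.aemeasurable (hc.const_mul _).aemeasurable
    _ ≤ (‖ξ‖ₑ ^ 2)⁻¹ * (κ ^ 2 * ‖ξ‖ₑ ^ 2 * timeSq (fun s => conv (f s) (h s)) ξ) := by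
        gcongr
        · rw [← lintegral_heat_sq hξ]
          exact lintegral_Ioo_comp_sub_le (fun s => heat s ξ ^ 2) t
        · simp_rw [mul_pow]
          rw [lintegral_const_mul _ (by fun_prop)]
          gcongr
          exact lintegral_mono_set Set.Ioo_subset_Ioi_self
    _ = ((‖ξ‖ₑ ^ 2)⁻¹ * ‖ξ‖ₑ ^ 2) * (κ ^ 2 * timeSq (fun s => conv (f s) (h s)) ξ) := by ring
    _ = _ := by rw [ENNReal.inv_mul_cancel (by simpa using hξ) (by simp), one_mul]

/-- Young's inequality in time: the `L¹` norm of the heat kernel is `2 |ξ|⁻²`. Its square is the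
source of the factor `4` and gains two powers of `|ξ|` beyond the derivative. -/
theorem timeSq_duhamelMajorant_le (hf : Measurable (Function.uncurry f))
    (hh : Measurable (Function.uncurry h)) (ξ : Space) :
    ‖ξ‖ₑ ^ 2 * timeSq (duhamelMajorant κ f h) ξ ≤
      4 * κ ^ 2 * timeSq (fun s => conv (f s) (h s)) ξ := by
  by_cases hξ : ‖ξ‖ₑ = 0
  · simp [hξ]
  set F : ℝ → ℝ≥0∞ := fun s => κ * ‖ξ‖ₑ * conv (f s) (h s) ξ with hF
  have hFm : Measurable F :=
    ((measurable_conv hf hh).comp measurable_prodMk_right).const_mul _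
  have hheat : Measurable fun s => heat s ξ :=
    measurable_heat.comp measurable_prodMk_right
  have h1 : ∀ t, duhamelMajorant κ f h t ξ ^ 2 ≤
      2 * (‖ξ‖ₑ ^ 2)⁻¹ * ∫⁻ s in Set.Ioo 0 t, heat (t - s) ξ * F s ^ 2 := by
    intro t
    calc _ ≤ (∫⁻ s in Set.Ioo 0 t, heat (t - s) ξ) *
          ∫⁻ s in Set.Ioo 0 t, heat (t - s) ξ * F s ^ 2 :=
        sq_lintegral_mul_le_weight (by fun_prop) hFm.aemeasurable
      _ ≤ _ := by
        gcongr
        rw [← lintegral_heat hξ]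
        exact lintegral_Ioo_comp_sub_le (fun s => heat s ξ) t
  have h2 : ∫⁻ t in Set.Ioi 0, ∫⁻ s in Set.Ioo 0 t, heat (t - s) ξ * F s ^ 2 ≤
      2 * (‖ξ‖ₑ ^ 2)⁻¹ * ∫⁻ s in Set.Ioi 0, F s ^ 2 := by
    calc _ = ∫⁻ t in Set.Ioi 0, ∫⁻ s in Set.Ioi 0,
          (Set.Ioi 0).indicator (fun x => heat x ξ) (t - s) * F s ^ 2 := by
          refine lintegral_congr fun t => ?_
          rw [← lintegral_indicator measurableSet_Ioo, ← lintegral_indicator measurableSet_Ioi]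
          refine lintegral_congr fun s => ?_
          by_cases hs : 0 < s <;> by_cases hst : s < t <;> simp [Set.indicator, hs, hst]
      _ = ∫⁻ s in Set.Ioi 0, ∫⁻ t in Set.Ioi 0,
          (Set.Ioi 0).indicator (fun x => heat x ξ) (t - s) * F s ^ 2 := by
          rw [lintegral_lintegral_swap]
          have := hheat.indicator (measurableSet_Ioi (a := (0 : ℝ)))
          refine Measurable.aemeasurable ?_
          unfold Function.uncurry
          fun_prop
      _ ≤ ∫⁻ s in Set.Ioi 0, 2 * (‖ξ‖ₑ ^ 2)⁻¹ * F s ^ 2 := by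
          refine lintegral_mono fun s => ?_
          have := hheat.indicator (measurableSet_Ioi (a := (0 : ℝ)))
          dsimp only
          rw [lintegral_mul_const _ (by fun_prop)]
          gcongr
          calc _ ≤ ∫⁻ t, (Set.Ioi 0).indicator (fun x => heat x ξ) (t - s) :=
                setLIntegral_le_lintegral _ _
            _ = _ := by
              rw [lintegral_sub_right_eq_self ((Set.Ioi 0).indicator (fun x => heat x ξ)),
                lintegral_indicator measurableSet_Ioi, lintegral_heat hξ]
      _ = _ := lintegral_const_mul _ (by fun_prop)
  have h3 : ∫⁻ s in Set.Ioi 0, F s ^ 2 =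
      κ ^ 2 * ‖ξ‖ₑ ^ 2 * timeSq (fun s => conv (f s) (h s)) ξ := by
    have hc : Measurable fun s => conv (f s) (h s) ξ :=
      (measurable_conv hf hh).comp measurable_prodMk_right
    simp_rw [hF, mul_pow]
    rw [lintegral_const_mul _ (by fun_prop), timeSq]
  have ht : (‖ξ‖ₑ ^ 2)⁻¹ ≠ ∞ := by simpa using hξ
  calc ‖ξ‖ₑ ^ 2 * timeSq (duhamelMajorant κ f h) ξ
      ≤ ‖ξ‖ₑ ^ 2 * ∫⁻ t in Set.Ioi 0, 2 * (‖ξ‖ₑ ^ 2)⁻¹ *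
          ∫⁻ s in Set.Ioo 0 t, heat (t - s) ξ * F s ^ 2 := by
        unfold timeSq; gcongr with t; exact h1 t
    _ ≤ ‖ξ‖ₑ ^ 2 * (2 * (‖ξ‖ₑ ^ 2)⁻¹ * (2 * (‖ξ‖ₑ ^ 2)⁻¹ *
          (κ ^ 2 * ‖ξ‖ₑ ^ 2 * timeSq (fun s => conv (f s) (h s)) ξ))) := by
        rw [lintegral_const_mul' _ _ (by finiteness), ← h3]
        gcongr
    _ = (‖ξ‖ₑ ^ 2 * (‖ξ‖ₑ ^ 2)⁻¹) * (‖ξ‖ₑ ^ 2 * (‖ξ‖ₑ ^ 2)⁻¹) *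
          (4 * κ ^ 2 * timeSq (fun s => conv (f s) (h s)) ξ) := by ring
    _ = _ := by rw [ENNReal.mul_inv_cancel (by simpa using hξ) (by simp)]; simp

theorem timeFourth_le {B : ℝ≥0∞} {ξ : Space} (hf : Measurable (Function.uncurry f))
    (hB : ∀ t, 0 < t → f t ξ ^ 2 ≤ B) : timeFourth f ξ ≤ B * timeSq f ξ := by
  have hf1 : Measurable fun s => f s ξ := hf.comp measurable_prodMk_right
  unfold timeFourth timeSq
  rw [← lintegral_const_mul _ (by fun_prop)]
  refine setLIntegral_mono (by fun_prop) fun t ht => ?_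
  rw [show 4 = 2 + 2 from rfl, pow_add]
  gcongr
  exact hB t ht

/-- The fourth power in time is at most the supremum bound `κ² q` times the square integral. With
the weight `|ξ|²` the latter is at most `4 κ² q`, so the product is the perfect square `(2 κ² q)²`
and its root is again linear in `q`. -/
theorem l4Sq_duhamelMajorant_le (hf : Measurable (Function.uncurry f))
    (hh : Measurable (Function.uncurry h)) :
    l4Sq (duhamelMajorant κ f h) ≤ 2 * κ ^ 2 * prodSq f h := by
  unfold l4Sq prodSq
  have hm := measurable_timeSq (measurable_conv hf hh)
  rw [← lintegral_const_mul _ (by fun_prop)]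
  refine lintegral_mono fun ξ => ?_
  set q := timeSq (fun s => conv (f s) (h s)) ξ
  have h1 : ‖ξ‖ₑ ^ 2 * timeFourth (duhamelMajorant κ f h) ξ ≤ (2 * κ ^ 2 * q) ^ 2 := by
    calc _ ≤ ‖ξ‖ₑ ^ 2 * (κ ^ 2 * q * timeSq (duhamelMajorant κ f h) ξ) := by
          gcongr
          exact timeFourth_le (measurable_duhamelMajorant κ hf hh)
            fun t _ => sq_duhamelMajorant_le hf hh t ξ
      _ = κ ^ 2 * q * (‖ξ‖ₑ ^ 2 * timeSq (duhamelMajorant κ f h) ξ) := by ring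
      _ ≤ κ ^ 2 * q * (4 * κ ^ 2 * q) := mul_le_mul' le_rfl (timeSq_duhamelMajorant_le hf hh ξ)
      _ = _ := by ring
  have hs : ∀ x : ℝ≥0∞, (x ^ 2) ^ (1 / 2 : ℝ) = x := fun x => by
    rw [← ENNReal.rpow_natCast_mul]; norm_num
  calc ‖ξ‖ₑ ^ 2 * timeFourth (duhamelMajorant κ f h) ξ ^ (1 / 2 : ℝ)
      = ‖ξ‖ₑ * (‖ξ‖ₑ ^ 2 * timeFourth (duhamelMajorant κ f h) ξ) ^ (1 / 2 : ℝ) := by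
        rw [ENNReal.mul_rpow_of_nonneg _ _ (by norm_num), hs, ← mul_assoc, sq]
    _ ≤ ‖ξ‖ₑ * ((2 * κ ^ 2 * q) ^ 2) ^ (1 / 2 : ℝ) := by gcongr
    _ = _ := by rw [hs]; ring

end Duhamel

/-! ### The majorant series -/

section MajorantSeries

variable {κ : ℝ≥0∞}

theorem l4Sq_mono_ae {f h : ℝ → Space → ℝ≥0∞}
    (hfh : ∀ᵐ ξ : Space, ∀ᵐ t ∂volume.restrict (Set.Ioi (0 : ℝ)), f t ξ ≤ h t ξ) :
    l4Sq f ≤ l4Sq h := by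
  refine lintegral_mono_ae ?_
  filter_upwards [hfh] with ξ hξ
  have : timeFourth f ξ ≤ timeFourth h ξ := by
    refine lintegral_mono_ae ?_
    filter_upwards [hξ] with t ht
    gcongr
  gcongr

theorem l4Sq_mono {f h : ℝ → Space → ℝ≥0∞} (hfh : ∀ t ξ, f t ξ ≤ h t ξ) : l4Sq f ≤ l4Sq h :=
  l4Sq_mono_ae (ae_of_all _ fun ξ => ae_of_all _ fun t => hfh t ξ)

theorem add_pow_four_le (a b : ℝ≥0∞) : (a + b) ^ 4 ≤ 16 * (a ^ 4 + b ^ 4) := by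
  wlog hab : a ≤ b generalizing a b
  · rw [add_comm a, add_comm (a ^ 4)]
    exact this b a (le_of_not_ge hab)
  calc (a + b) ^ 4 ≤ (b + b) ^ 4 := by gcongr
    _ = 16 * b ^ 4 := by ring
    _ ≤ _ := by gcongr; exact le_add_self

/-- A crude substitute for Minkowski's inequality; the constant is `√16`, from `add_pow_four_le`. -/
theorem l4Sq_add_le {f h : ℝ → Space → ℝ≥0∞} (hf : Measurable (Function.uncurry f)) :
    l4Sq (fun t ξ => f t ξ + h t ξ) ≤ 4 * (l4Sq f + l4Sq h) := by
  have hf4 := measurable_timeFourth hf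
  unfold l4Sq
  rw [← lintegral_add_left (by fun_prop), ← lintegral_const_mul' _ _ (by simp)]
  refine lintegral_mono fun ξ => ?_
  have h1 : timeFourth (fun t ξ => f t ξ + h t ξ) ξ ≤ 16 * (timeFourth f ξ + timeFourth h ξ) := by
    have hf1 : Measurable fun s => f s ξ := hf.comp measurable_prodMk_right
    unfold timeFourth
    rw [← lintegral_add_left (by fun_prop), ← lintegral_const_mul' _ _ (by simp)]
    exact lintegral_mono fun t => add_pow_four_le _ _
  have h16 : (16 : ℝ≥0∞) ^ (1 / 2 : ℝ) = 4 := by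
    rw [show (16 : ℝ≥0∞) = 4 ^ (2 : ℕ) by norm_num, ← ENNReal.rpow_natCast_mul]
    norm_num
  calc ‖ξ‖ₑ ^ 2 * timeFourth (fun t ξ => f t ξ + h t ξ) ξ ^ (1 / 2 : ℝ)
      ≤ ‖ξ‖ₑ ^ 2 * (16 * (timeFourth f ξ + timeFourth h ξ)) ^ (1 / 2 : ℝ) := by gcongr
    _ ≤ ‖ξ‖ₑ ^ 2 * (4 * (timeFourth f ξ ^ (1 / 2 : ℝ) + timeFourth h ξ ^ (1 / 2 : ℝ))) := by
        rw [ENNReal.mul_rpow_of_nonneg _ _ (by norm_num), h16]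
        gcongr
        exact ENNReal.rpow_add_le_add_rpow _ _ (by norm_num) (by norm_num)
    _ = _ := by ring

/-- Monotone convergence, in time and then in frequency, carries a uniform bound on partial sums
over to the whole series. -/
theorem l4Sq_iSup_le {f : ℕ → ℝ → Space → ℝ≥0∞} (hf : ∀ n, Measurable (Function.uncurry (f n)))
    (hmono : ∀ t ξ, Monotone fun n => f n t ξ) {B : ℝ≥0∞} (hB : ∀ n, l4Sq (f n) ≤ B) :
    l4Sq (fun t ξ => ⨆ n, f n t ξ) ≤ B := by
  have h4 : ∀ ξ, timeFourth (fun t ξ => ⨆ n, f n t ξ) ξ = ⨆ n, timeFourth (f n) ξ := by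
    intro ξ
    have hf1 : ∀ n, Measurable fun s => f n s ξ := fun n => (hf n).comp measurable_prodMk_right
    unfold timeFourth
    rw [← lintegral_iSup (fun n => (hf1 n).pow_const 4) fun i j hij t => by
      have := hmono t ξ hij
      dsimp only at this ⊢
      gcongr]
    refine lintegral_congr fun t => ?_
    exact (Monotone.map_iSup_of_continuousAt (f := fun x : ℝ≥0∞ => x ^ 4)
      (ENNReal.continuous_pow 4).continuousAt (fun _ _ h => pow_le_pow_left' h 4) (by simp))
  have h4m : ∀ ξ, Monotone fun n => timeFourth (f n) ξ := fun ξ i j hij =>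
    lintegral_mono fun t => pow_le_pow_left' (hmono t ξ hij) 4
  unfold l4Sq
  have : ∀ ξ : Space, ‖ξ‖ₑ ^ 2 * timeFourth (fun t ξ => ⨆ n, f n t ξ) ξ ^ (1 / 2 : ℝ) =
      ⨆ n, ‖ξ‖ₑ ^ 2 * timeFourth (f n) ξ ^ (1 / 2 : ℝ) := by
    intro ξ
    rw [h4, ← ENNReal.mul_iSup]
    congr 1
    exact Monotone.map_iSup_of_continuousAt (f := fun x : ℝ≥0∞ => x ^ (1 / 2 : ℝ))
      ENNReal.continuous_rpow_const.continuousAt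
      (fun _ _ h => ENNReal.rpow_le_rpow h (by norm_num)) (by simp)
  simp_rw [this]
  rw [lintegral_iSup]
  · exact iSup_le hB
  · intro n
    have := measurable_timeFourth (hf n)
    fun_prop
  · intro i j hij ξ
    have := h4m ξ hij
    dsimp only at this ⊢
    gcongr

/-- The terms of the majorant series. -/
def majorantTerm (κ : ℝ≥0∞) (U : ℝ → Space → ℝ≥0∞) : ℕ → ℝ → Space → ℝ≥0∞
  | 0 => U
  | n + 1 => fun t ξ => ∑ i : Fin (n + 1),
      duhamelMajorant κ (majorantTerm κ U i) (majorantTerm κ U (n - i)) t ξ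
  decreasing_by all_goals omega

/-- The majorant of the solution. -/
def majorant (κ : ℝ≥0∞) (U : ℝ → Space → ℝ≥0∞) (t : ℝ) (ξ : Space) : ℝ≥0∞ :=
  ∑' n, majorantTerm κ U n t ξ

variable {U : ℝ → Space → ℝ≥0∞}

theorem majorantTerm_succ (n : ℕ) (t : ℝ) (ξ : Space) :
    majorantTerm κ U (n + 1) t ξ = ∑ p ∈ Finset.HasAntidiagonal.antidiagonal n,
      duhamelMajorant κ (majorantTerm κ U p.1) (majorantTerm κ U p.2) t ξ := by
  rw [Finset.Nat.sum_antidiagonal_eq_sum_range_succ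
    (fun i j => duhamelMajorant κ (majorantTerm κ U i) (majorantTerm κ U j) t ξ),
    Finset.sum_range, majorantTerm]

theorem measurable_majorantTerm (hU : Measurable (Function.uncurry U)) (n : ℕ) :
    Measurable (Function.uncurry (majorantTerm κ U n)) := by
  induction n using Nat.strong_induction_on with
  | _ n ih =>
    cases n with
    | zero => rwa [majorantTerm]
    | succ n =>
      have : Function.uncurry (majorantTerm κ U (n + 1)) = fun q => ∑ p ∈ Finset.HasAntidiagonal.antidiagonal n,
          Function.uncurry
            (duhamelMajorant κ (majorantTerm κ U p.1) (majorantTerm κ U p.2)) q := by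
        ext ⟨t, ξ⟩
        exact majorantTerm_succ n t ξ
      rw [this]
      refine Finset.measurable_sum _ fun p hp => ?_
      have hp := Finset.HasAntidiagonal.mem_antidiagonal.1 hp
      exact measurable_duhamelMajorant κ (ih _ (by omega)) (ih _ (by omega))

theorem measurable_majorant (hU : Measurable (Function.uncurry U)) :
    Measurable (Function.uncurry (majorant κ U)) :=
  Measurable.tsum fun n => measurable_majorantTerm hU n

/-! ### Bilinearity over infinite sums and the fixed-point equation of the majorant. -/

theorem conv_tsum {f h : ℕ → Space → ℝ≥0∞} (hf : ∀ n, Measurable (f n))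
    (hh : ∀ n, Measurable (h n)) (ξ : Space) :
    conv (fun η => ∑' n, f n η) (fun η => ∑' n, h n η) ξ =
      ∑' p : ℕ × ℕ, conv (f p.1) (h p.2) ξ := by
  unfold conv
  rw [← lintegral_tsum fun p => ?_]
  · refine lintegral_congr fun η => ?_
    rw [ENNReal.tsum_prod', ← ENNReal.tsum_mul_right]
    simp_rw [ENNReal.tsum_mul_left]
  · have := hf p.1
    have := hh p.2
    fun_prop

theorem duhamelMajorant_tsum {f h : ℕ → ℝ → Space → ℝ≥0∞}
    (hf : ∀ n, Measurable (Function.uncurry (f n))) (hh : ∀ n, Measurable (Function.uncurry (h n)))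
    (t : ℝ) (ξ : Space) :
    duhamelMajorant κ (fun t ξ => ∑' n, f n t ξ) (fun t ξ => ∑' n, h n t ξ) t ξ =
      ∑' p : ℕ × ℕ, duhamelMajorant κ (f p.1) (h p.2) t ξ := by
  have hheat : Measurable fun s => heat (t - s) ξ :=
    measurable_heat.comp (f := fun s : ℝ => (t - s, ξ)) (by fun_prop)
  unfold duhamelMajorant
  rw [← lintegral_tsum fun p => ?_]
  · refine lintegral_congr fun s => ?_
    have hfs : ∀ n, Measurable (f n s) := fun n => (hf n).comp measurable_prodMk_left
    have hhs : ∀ n, Measurable (h n s) := fun n => (hh n).comp measurable_prodMk_left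
    rw [conv_tsum hfs hhs, ← ENNReal.tsum_mul_left,
      ← ENNReal.tsum_mul_left]
  · have : Measurable fun s => conv (f p.1 s) (h p.2 s) ξ :=
      (measurable_conv (hf p.1) (hh p.2)).comp measurable_prodMk_right
    fun_prop

/-- The recursion grades the terms by the number of applications of the bilinear operator, so
summing it over antidiagonals rebuilds the full double series. The identity holds in `[0, ∞]`, with
no convergence assumption. -/
theorem majorant_eq (hU : Measurable (Function.uncurry U)) (t : ℝ) (ξ : Space) :
    majorant κ U t ξ = U t ξ + duhamelMajorant κ (majorant κ U) (majorant κ U) t ξ := by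
  have h1 : duhamelMajorant κ (majorant κ U) (majorant κ U) t ξ = ∑' p : ℕ × ℕ,
      duhamelMajorant κ (majorantTerm κ U p.1) (majorantTerm κ U p.2) t ξ :=
    duhamelMajorant_tsum (measurable_majorantTerm hU) (measurable_majorantTerm hU) t ξ
  rw [h1, ← Finset.HasAntidiagonal.sigmaAntidiagonalEquivProd.tsum_eq, ENNReal.tsum_sigma', majorant,
    tsum_eq_zero_add' ENNReal.summable]
  congr 1
  · rw [majorantTerm]
  · refine tsum_congr fun n => ?_
    rw [majorantTerm_succ, tsum_fintype, ← Finset.sum_coe_sort]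
    rfl

/-- Pairs with `i + j = n < N` have both indices below `N`, so the new terms form part of the
product of the previous partial sum with itself. This is the inductive step for a bound uniform in
`N`. -/
theorem sum_range_majorantTerm_succ_le (hU : Measurable (Function.uncurry U)) (N : ℕ) (t : ℝ)
    (ξ : Space) :
    ∑ n ∈ Finset.range (N + 1), majorantTerm κ U n t ξ ≤ U t ξ +
      duhamelMajorant κ (fun t ξ => ∑ n ∈ Finset.range N, majorantTerm κ U n t ξ)
        (fun t ξ => ∑ n ∈ Finset.range N, majorantTerm κ U n t ξ) t ξ := by
  classical
  -- Extension by zero turns the finite sums into series, to which `duhamelMajorant_tsum` applies.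
  set f : ℕ → ℝ → Space → ℝ≥0∞ := fun n t ξ => if n < N then majorantTerm κ U n t ξ else 0 with hf
  have hfm : ∀ n, Measurable (Function.uncurry (f n)) := by
    intro n
    by_cases h : n < N
    · have : f n = majorantTerm κ U n := by ext; simp [hf, h]
      rw [this]; exact measurable_majorantTerm hU n
    · have : f n = fun _ _ => 0 := by ext; simp [hf, h]
      rw [this]; exact measurable_const
  have hsum : (fun t ξ => ∑ n ∈ Finset.range N, majorantTerm κ U n t ξ) =
      fun t ξ => ∑' n, f n t ξ := by
    ext t ξ
    rw [tsum_eq_sum (s := Finset.range N) fun n hn => by simp_all [f]]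
    exact Finset.sum_congr rfl fun n hn => by simp_all [f]
  rw [hsum, duhamelMajorant_tsum hfm hfm, ← Finset.HasAntidiagonal.sigmaAntidiagonalEquivProd.tsum_eq,
    ENNReal.tsum_sigma', Finset.sum_range_succ', add_comm, majorantTerm]
  gcongr
  refine le_trans (Finset.sum_le_sum fun n hn => ?_) (ENNReal.sum_le_tsum (Finset.range N))
  rw [majorantTerm_succ, tsum_fintype, ← Finset.sum_coe_sort]
  refine Finset.sum_le_sum fun p _ => le_of_eq ?_
  have hp := Finset.HasAntidiagonal.mem_antidiagonal.1 p.2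
  have hn := Finset.mem_range.1 hn
  have e : ∀ m, m < N → f m = majorantTerm κ U m := fun m hm => by ext; simp [hf, hm]
  change _ = duhamelMajorant κ (f p.1.1) (f p.1.2) t ξ
  rw [e _ (by omega), e _ (by omega)]

/-- With `X` the size of the free term, the ball of radius `8X` is stable: `4 (X + K (8X)²) = 4 (X +
64 K X · X) ≤ 8X`. -/
theorem l4Sq_majorant_le (hU : Measurable (Function.uncurry U)) {K : ℝ≥0∞}
    (hK : ∀ f h : ℝ → Space → ℝ≥0∞, Measurable (Function.uncurry f) →
      Measurable (Function.uncurry h) → l4Sq (duhamelMajorant κ f h) ≤ K * (l4Sq f * l4Sq h))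
    (hsmall : 64 * K * l4Sq U ≤ 1) : l4Sq (majorant κ U) ≤ 8 * l4Sq U := by
  have hm : ∀ N, Measurable (Function.uncurry fun t ξ =>
      ∑ n ∈ Finset.range N, majorantTerm κ U n t ξ) := fun N =>
    Finset.measurable_fun_sum _ fun n _ => measurable_majorantTerm hU n
  have hN : ∀ N, l4Sq (fun t ξ => ∑ n ∈ Finset.range N, majorantTerm κ U n t ξ) ≤ 8 * l4Sq U := by
    intro N
    induction N with
    | zero => simp [l4Sq, timeFourth]
    | succ N ih =>
      calc _ ≤ _ := l4Sq_mono (sum_range_majorantTerm_succ_le hU N)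
        _ ≤ 4 * (l4Sq U + K * ((8 * l4Sq U) * (8 * l4Sq U))) := by
          refine (l4Sq_add_le hU).trans ?_
          gcongr
          refine (hK _ _ (hm N) (hm N)).trans ?_
          gcongr
        _ = 4 * (l4Sq U + (64 * K * l4Sq U) * l4Sq U) := by ring
        _ ≤ 4 * (l4Sq U + 1 * l4Sq U) := by gcongr
        _ = _ := by ring
  have : majorant κ U = fun t ξ => ⨆ N, ∑ n ∈ Finset.range N, majorantTerm κ U n t ξ := by
    ext t ξ
    exact ENNReal.tsum_eq_iSup_nat
  rw [this]
  refine l4Sq_iSup_le hm (fun t ξ i j hij => ?_) hN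
  exact Finset.sum_le_sum_of_subset (Finset.range_mono hij)

end MajorantSeries

/-! ### Bounds for the majorant of the heat flow -/

section HeatMajorant

variable {κ : ℝ≥0∞} {f h : ℝ → Space → ℝ≥0∞}

/-- Interpolation at each frequency: `L⁴` in time lies between `L^∞` and `L²`, and `|ξ|² = √(|ξ| ·
|ξ|³)` distributes the weights. -/
theorem l4Sq_le {B : Space → ℝ≥0∞} (hf : Measurable (Function.uncurry f))
    (hB : ∀ t ξ, 0 < t → f t ξ ^ 2 ≤ B ξ) :
    l4Sq f ≤ (∫⁻ ξ, ‖ξ‖ₑ * B ξ) + ∫⁻ ξ, ‖ξ‖ₑ ^ 3 * timeSq f ξ := by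
  have hm := measurable_timeSq hf
  rw [← lintegral_add_right _ (by fun_prop)]
  refine lintegral_mono fun ξ => ?_
  have hs : ∀ x : ℝ≥0∞, (x ^ 2) ^ (1 / 2 : ℝ) = x := fun x => by
    rw [← ENNReal.rpow_natCast_mul]; norm_num
  have h4 := timeFourth_le hf (fun t => hB t ξ)
  calc ‖ξ‖ₑ ^ 2 * timeFourth f ξ ^ (1 / 2 : ℝ)
      ≤ ((‖ξ‖ₑ ^ 2) ^ 2) ^ (1 / 2 : ℝ) * (B ξ * timeSq f ξ) ^ (1 / 2 : ℝ) := by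
        rw [hs]; gcongr
    _ = ((‖ξ‖ₑ * B ξ) * (‖ξ‖ₑ ^ 3 * timeSq f ξ)) ^ (1 / 2 : ℝ) := by
        rw [← ENNReal.mul_rpow_of_nonneg _ _ (by norm_num)]
        congr 1
        ring
    _ ≤ ((‖ξ‖ₑ * B ξ + ‖ξ‖ₑ ^ 3 * timeSq f ξ) ^ 2) ^ (1 / 2 : ℝ) := by
        gcongr
        rw [sq]
        gcongr
        · exact le_self_add
        · exact le_add_self
    _ = _ := hs _

/-- Majorant of the weighted heat flow. -/
def heatMajorant (a : Space → ℝ≥0∞) (t : ℝ) (ξ : Space) : ℝ≥0∞ := 2 * heat t ξ * a ξ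

theorem measurable_heatMajorant {a : Space → ℝ≥0∞} (ha : Measurable a) :
    Measurable (Function.uncurry (heatMajorant a)) :=
  (measurable_heat.const_mul 2).mul (ha.comp measurable_snd)

theorem heat_le_one {t : ℝ} (ht : 0 ≤ t) (ξ : Space) : heat t ξ ≤ 1 := by
  rw [heat, ← ENNReal.ofReal_one]
  refine ENNReal.ofReal_le_ofReal (Real.exp_le_one_iff.2 ?_)
  have : 0 ≤ t * (‖ξ‖ ^ 2 / 2) := by positivity
  linarith

theorem sq_heatMajorant_le {t : ℝ} (ht : 0 ≤ t) (a : Space → ℝ≥0∞) (ξ : Space) :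
    heatMajorant a t ξ ^ 2 ≤ 4 * a ξ ^ 2 := by
  calc _ ≤ (2 * 1 * a ξ) ^ 2 := by
        unfold heatMajorant
        gcongr
        exact heat_le_one ht ξ
    _ = _ := by ring

theorem timeSq_heatMajorant_le (a : Space → ℝ≥0∞) (ξ : Space) :
    ‖ξ‖ₑ ^ 2 * timeSq (heatMajorant a) ξ ≤ 4 * a ξ ^ 2 := by
  by_cases hξ : ‖ξ‖ₑ = 0
  · simp [hξ]
  have hm : Measurable fun s => heat s ξ := measurable_heat.comp measurable_prodMk_right
  have e : ∀ t, heatMajorant a t ξ ^ 2 = 4 * heat t ξ ^ 2 * a ξ ^ 2 := fun t => by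
    unfold heatMajorant; ring
  unfold timeSq
  simp_rw [e]
  rw [lintegral_mul_const _ (by fun_prop), lintegral_const_mul _ (by fun_prop),
    lintegral_heat_sq hξ]
  refine le_of_eq ?_
  calc _ = (‖ξ‖ₑ ^ 2 * (‖ξ‖ₑ ^ 2)⁻¹) * (4 * a ξ ^ 2) := by ring
    _ = _ := by rw [ENNReal.mul_inv_cancel (by simpa using hξ) (by simp), one_mul]

theorem add_sq_le (a b : ℝ≥0∞) : (a + b) ^ 2 ≤ 4 * (a ^ 2 + b ^ 2) := by
  wlog hab : a ≤ b generalizing a b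
  · rw [add_comm a, add_comm (a ^ 2)]
    exact this b a (le_of_not_ge hab)
  calc (a + b) ^ 2 ≤ (b + b) ^ 2 := by gcongr
    _ = 4 * b ^ 2 := by ring
    _ ≤ _ := by gcongr; exact le_add_self

theorem l4Sq_heatMajorant_le {a : Space → ℝ≥0∞} (ha : Measurable a) :
    l4Sq (heatMajorant a) ≤ 8 * ∫⁻ ξ, ‖ξ‖ₑ * a ξ ^ 2 := by
  refine (l4Sq_le (B := fun ξ => 4 * a ξ ^ 2) (measurable_heatMajorant ha)
    fun t ξ ht => sq_heatMajorant_le ht.le a ξ).trans ?_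
  have h1 : ∫⁻ ξ, ‖ξ‖ₑ ^ 3 * timeSq (heatMajorant a) ξ ≤ ∫⁻ ξ, ‖ξ‖ₑ * (4 * a ξ ^ 2) := by
    refine lintegral_mono fun ξ => ?_
    calc _ = ‖ξ‖ₑ * (‖ξ‖ₑ ^ 2 * timeSq (heatMajorant a) ξ) := by ring
      _ ≤ _ := mul_le_mul' le_rfl (timeSq_heatMajorant_le a ξ)
  have h2 : ∫⁻ ξ, ‖ξ‖ₑ * (4 * a ξ ^ 2) = 4 * ∫⁻ ξ, ‖ξ‖ₑ * a ξ ^ 2 := by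
    rw [← lintegral_const_mul' _ _ (by simp)]
    exact lintegral_congr fun ξ => by ring
  calc _ ≤ (∫⁻ ξ, ‖ξ‖ₑ * (4 * a ξ ^ 2)) + ∫⁻ ξ, ‖ξ‖ₑ * (4 * a ξ ^ 2) := by gcongr
    _ = _ := by rw [h2]; ring

/-- Pointwise bound, uniform in time, for the majorant. -/
def supMajorant (κ : ℝ≥0∞) (a : Space → ℝ≥0∞) (ξ : Space) : ℝ≥0∞ :=
  4 * (4 * a ξ ^ 2 + 4 * κ ^ 2 * timeSq
    (fun s => conv (majorant κ (heatMajorant a) s) (majorant κ (heatMajorant a) s)) ξ)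

theorem sq_majorant_le {a : Space → ℝ≥0∞} (ha : Measurable a) {t : ℝ} (ht : 0 ≤ t) (ξ : Space) :
    majorant κ (heatMajorant a) t ξ ^ 2 ≤ supMajorant κ a ξ := by
  have hU := measurable_heatMajorant ha
  rw [majorant_eq hU]
  refine (add_sq_le _ _).trans ?_
  unfold supMajorant
  gcongr
  · exact sq_heatMajorant_le ht a ξ
  · refine (sq_duhamelMajorant_le (measurable_majorant hU) (measurable_majorant hU) t ξ).trans ?_
    gcongr
    exact le_mul_of_one_le_left' (by norm_num)

/-- The dissipation is controlled by the function that controls the supremum in time. The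
coefficient `4 κ²` in `supMajorant` is dictated by this bound; the supremum alone would need only
`κ²`. -/
theorem timeSq_majorant_le {a : Space → ℝ≥0∞} (ha : Measurable a) (ξ : Space) :
    ‖ξ‖ₑ ^ 2 * timeSq (majorant κ (heatMajorant a)) ξ ≤ supMajorant κ a ξ := by
  have hU := measurable_heatMajorant ha
  have hM := measurable_majorant (κ := κ) hU
  have hU1 : Measurable fun t => heatMajorant a t ξ := hU.comp measurable_prodMk_right
  have h1 : timeSq (majorant κ (heatMajorant a)) ξ ≤ 4 * (timeSq (heatMajorant a) ξ +
      timeSq (duhamelMajorant κ (majorant κ (heatMajorant a)) (majorant κ (heatMajorant a))) ξ) := by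
    unfold timeSq
    rw [← lintegral_add_left (by fun_prop), ← lintegral_const_mul' _ _ (by simp)]
    refine lintegral_mono fun t => ?_
    dsimp only
    rw [majorant_eq hU]
    exact add_sq_le _ _
  calc _ ≤ ‖ξ‖ₑ ^ 2 * (4 * (timeSq (heatMajorant a) ξ +
      timeSq (duhamelMajorant κ (majorant κ (heatMajorant a))
        (majorant κ (heatMajorant a))) ξ)) := by gcongr
    _ = 4 * (‖ξ‖ₑ ^ 2 * timeSq (heatMajorant a) ξ + ‖ξ‖ₑ ^ 2 * timeSq (duhamelMajorant κ
      (majorant κ (heatMajorant a)) (majorant κ (heatMajorant a))) ξ) := by ring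
    _ ≤ _ := by
      unfold supMajorant
      exact mul_le_mul' le_rfl (add_le_add (timeSq_heatMajorant_le a ξ)
        (timeSq_duhamelMajorant_le hM hM ξ))

theorem lintegral_supMajorant {a : Space → ℝ≥0∞} (ha : Measurable a) :
    ∫⁻ ξ, ‖ξ‖ₑ * supMajorant κ a ξ = 16 * (∫⁻ ξ, ‖ξ‖ₑ * a ξ ^ 2) +
      16 * κ ^ 2 * prodSq (majorant κ (heatMajorant a)) (majorant κ (heatMajorant a)) := by
  have hM := measurable_majorant (κ := κ) (measurable_heatMajorant ha)
  have hm := measurable_timeSq (measurable_conv hM hM)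
  unfold prodSq
  rw [← lintegral_const_mul _ (by fun_prop), ← lintegral_const_mul _ (by fun_prop),
    ← lintegral_add_left (by fun_prop)]
  refine lintegral_congr fun ξ => ?_
  unfold supMajorant
  ring

/-- For small data the majorant is controlled by the data. -/
theorem exists_majorant_bound {κ θ : ℝ≥0∞} (hκ : κ ≠ ∞) (hθ : θ ≠ 0) :
    ∃ ε : ℝ≥0∞, ε ≠ 0 ∧ ∀ a : Space → ℝ≥0∞, Measurable a → ∫⁻ ξ, ‖ξ‖ₑ * a ξ ^ 2 ≤ ε →
      l4Sq (majorant κ (heatMajorant a)) ≤ θ ∧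
      ∫⁻ ξ, ‖ξ‖ₑ * supMajorant κ a ξ ≤ 32 * ∫⁻ ξ, ‖ξ‖ₑ * a ξ ^ 2 := by
  obtain ⟨C, hCt, hC⟩ := exists_prodSq_le
  -- Here `4096 = 64²`, so that `κ² C (64 H)² = L H²` in the final estimate; `L` also exceeds the
  -- `1024 κ² C` needed for the ball to be stable.
  set L : ℝ≥0∞ := 4096 * κ ^ 2 * C with hL
  have hLt : L ≠ ∞ := by finiteness
  -- The first bound makes the bilinear estimate close, the second makes the resulting size `64 H`
  -- at most `θ`.
  refine ⟨min L⁻¹ (θ / 64), ?_, fun a ha hsmall => ?_⟩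
  · rw [← pos_iff_ne_zero, lt_min_iff]
    exact ⟨ENNReal.inv_pos.2 hLt, ENNReal.div_pos hθ (by simp)⟩
  set H := ∫⁻ ξ, ‖ξ‖ₑ * a ξ ^ 2
  have hU := measurable_heatMajorant ha
  have hM := measurable_majorant (κ := κ) hU
  have hLH : L * H ≤ 1 := (mul_le_mul' le_rfl (hsmall.trans (min_le_left _ _))).trans
    (ENNReal.mul_inv_le_one L)
  have hX := l4Sq_heatMajorant_le ha
  have hK : ∀ f h : ℝ → Space → ℝ≥0∞, Measurable (Function.uncurry f) →
      Measurable (Function.uncurry h) →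
      l4Sq (duhamelMajorant κ f h) ≤ 2 * κ ^ 2 * C * (l4Sq f * l4Sq h) := by
    intro f h hf hh
    refine (l4Sq_duhamelMajorant_le hf hh).trans ?_
    rw [mul_assoc _ C]
    gcongr
    exact hC f h hf hh
  have hXM : l4Sq (majorant κ (heatMajorant a)) ≤ 64 * H := by
    refine (l4Sq_majorant_le hU hK ?_).trans ?_
    · calc _ ≤ 64 * (2 * κ ^ 2 * C) * (8 * H) := by gcongr
        _ = 1024 * κ ^ 2 * C * H := by ring
        _ ≤ L * H := by rw [hL]; gcongr; norm_num
        _ ≤ 1 := hLH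
    · calc _ ≤ 8 * (8 * H) := by gcongr
        _ = _ := by ring
  constructor
  · calc _ ≤ 64 * H := hXM
      _ ≤ 64 * (θ / 64) := by gcongr; exact hsmall.trans (min_le_right _ _)
      _ ≤ θ := ENNReal.mul_div_le
  · rw [lintegral_supMajorant ha]
    calc _ ≤ 16 * H + 16 * κ ^ 2 * (C * ((64 * H) * (64 * H))) := by
          gcongr
          refine (hC _ _ hM hM).trans ?_
          gcongr
      _ = 16 * H + 16 * (L * H) * H := by rw [hL]; ring
      _ ≤ 16 * H + 16 * 1 * H := by gcongr
      _ = _ := by ring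

end HeatMajorant

/-! ### The bilinear Duhamel operator -/

/-- The Fourier transform of the product of two different fields. -/
def tensorHat₂ (f h : Space → Vec) (j k : Fin 3) (ξ : Space) : ℂ :=
  ((2 * Real.pi) ^ 3 : ℝ)⁻¹ * ∫ η : Space, f (ξ - η) j * h η k

/-- The symbol of `ℙ div`. -/
def projDiv (ξ : Space) : (Fin 3 → Fin 3 → ℂ) →ₗ[ℂ] Vec where
  toFun T := leraySymbol ξ (WithLp.toLp 2 fun j => ∑ k : Fin 3, Complex.I * (ξ k : ℂ) * T k j)
  map_add' S T := by
    ext j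
    simp only [leraySymbol, PiLp.add_apply, Pi.add_apply, Fin.sum_univ_three]
    ring
  map_smul' c T := by
    ext j
    simp only [leraySymbol, PiLp.smul_apply, Pi.smul_apply, Fin.sum_univ_three, smul_eq_mul,
      RingHom.id_apply]
    ring

/-- The integrand of the bilinear Duhamel operator. -/
def duhamelIntegrand₂ (f h : ℝ → Space → Vec) (t : ℝ) (ξ : Space) (s : ℝ) : Vec :=
  (Real.exp (-(t - s) * ‖ξ‖ ^ 2) : ℂ) •
    projDiv ξ (fun k j => tensorHat₂ (f s) (h s) k j ξ)

theorem duhamelIntegrand_eq (g : ℝ → Space → Vec) (t : ℝ) (ξ : Space) (s : ℝ) :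
    duhamelIntegrand g t ξ s = duhamelIntegrand₂ g g t ξ s := rfl

theorem enorm_ofReal_complex {x : ℝ} (hx : 0 ≤ x) : ‖(x : ℂ)‖ₑ = ENNReal.ofReal x := by
  rw [← ofReal_norm, Complex.norm_real, Real.norm_of_nonneg hx]

theorem enorm_apply_le (a : Vec) (j : Fin 3) : ‖a j‖ₑ ≤ ‖a‖ₑ := by
  rw [← ofReal_norm, ← ofReal_norm]
  exact ENNReal.ofReal_le_ofReal (PiLp.norm_apply_le a j)

theorem norm_le_of_forall_apply {a : Vec} {b : ℝ} (hb : 0 ≤ b) (h : ∀ j, ‖a j‖ ≤ b) :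
    ‖a‖ ≤ 2 * b := by
  rw [EuclideanSpace.norm_eq]
  refine Real.sqrt_le_iff.2 ⟨by positivity, ?_⟩
  rw [Fin.sum_univ_three]
  have := fun j => pow_le_pow_left₀ (norm_nonneg _) (h j) 2
  nlinarith [this 0, this 1, this 2]

theorem norm_leraySymbol_le (ξ : Space) (a : Vec) : ‖leraySymbol ξ a‖ ≤ 8 * ‖a‖ := by
  have h : ∀ j, ‖leraySymbol ξ a j‖ ≤ 4 * ‖a‖ := by
    intro j
    by_cases hξ : ξ = 0
    · subst hξ
      simp only [leraySymbol]
      simp only [PiLp.zero_apply, Complex.ofReal_zero, zero_mul, zero_div, sub_zero]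
      linarith [PiLp.norm_apply_le a j, norm_nonneg a]
    have hξ' : 0 < ‖ξ‖ := norm_pos_iff.2 hξ
    have hx : ∀ i, ‖(ξ i : ℂ)‖ ≤ ‖ξ‖ := fun i => by
      rw [Complex.norm_real]; exact PiLp.norm_apply_le ξ i
    have hs : ‖∑ k : Fin 3, (ξ k : ℂ) * a k‖ ≤ 3 * (‖ξ‖ * ‖a‖) := by
      refine (norm_sum_le _ _).trans ?_
      calc _ ≤ ∑ k : Fin 3, ‖ξ‖ * ‖a‖ := Finset.sum_le_sum fun k _ => by
            rw [norm_mul]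
            gcongr
            · exact hx k
            · exact PiLp.norm_apply_le a k
        _ = _ := by simp
    calc ‖leraySymbol ξ a j‖ ≤ ‖a j‖ +
          ‖(ξ j : ℂ) * (∑ k : Fin 3, (ξ k : ℂ) * a k) / ((‖ξ‖ ^ 2 : ℝ) : ℂ)‖ := norm_sub_le _ _
      _ ≤ ‖a‖ + ‖ξ‖ * (3 * (‖ξ‖ * ‖a‖)) / ‖ξ‖ ^ 2 := by
          have hn : ‖((‖ξ‖ ^ 2 : ℝ) : ℂ)‖ = ‖ξ‖ ^ 2 := by
            rw [Complex.norm_real, Real.norm_of_nonneg (by positivity)]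
          rw [norm_div, norm_mul, hn]
          gcongr
          · exact PiLp.norm_apply_le a j
          · exact hx j
      _ = _ := by field_simp; ring
  linarith [norm_le_of_forall_apply (by positivity) h]

theorem norm_projDiv_le {ξ : Space} {T : Fin 3 → Fin 3 → ℂ} {b : ℝ} (hb : 0 ≤ b)
    (hT : ∀ k j, ‖T k j‖ ≤ b) : ‖projDiv ξ T‖ ≤ 48 * (‖ξ‖ * b) := by
  have h : ‖(WithLp.toLp 2 fun j => ∑ k : Fin 3, Complex.I * (ξ k : ℂ) * T k j : Vec)‖ ≤
      2 * (3 * (‖ξ‖ * b)) := by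
    refine norm_le_of_forall_apply (by positivity) fun j => ?_
    change ‖∑ k : Fin 3, Complex.I * (ξ k : ℂ) * T k j‖ ≤ _
    refine (norm_sum_le _ _).trans ?_
    calc _ ≤ ∑ k : Fin 3, ‖ξ‖ * b := Finset.sum_le_sum fun k _ => by
          rw [norm_mul, norm_mul, Complex.norm_I, one_mul, Complex.norm_real]
          gcongr
          · exact PiLp.norm_apply_le ξ k
          · exact hT k j
      _ = _ := by simp
  exact (norm_leraySymbol_le _ _).trans (by linarith)

theorem enorm_projDiv_le {ξ : Space} {T : Fin 3 → Fin 3 → ℂ} {b : ℝ≥0∞}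
    (hT : ∀ k j, ‖T k j‖ₑ ≤ b) : ‖projDiv ξ T‖ₑ ≤ 48 * (‖ξ‖ₑ * b) := by
  by_cases hb : b = ∞
  -- An infinite `b` is a constraint only at the origin, where the right-hand side is `0 * ∞ = 0`
  -- and the symbol must be seen to vanish.
  · by_cases hξ : ξ = 0
    · have : ‖projDiv ξ T‖ ≤ 48 * (‖ξ‖ * ‖T‖) :=
        norm_projDiv_le (norm_nonneg _) fun k j => (norm_le_pi_norm (T k) j).trans
          (norm_le_pi_norm T k)
      subst hξ
      have : projDiv 0 T = 0 := by simpa using this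
      simp [this]
    · have : ‖ξ‖ₑ ≠ 0 := by simpa using hξ
      rw [hb, ENNReal.mul_top this, ENNReal.mul_top (by norm_num)]
      exact le_top
  lift b to NNReal using hb
  have := norm_projDiv_le (ξ := ξ) (T := T) b.2 fun k j => by
    have := hT k j
    rw [enorm_le_coe] at this
    exact_mod_cast this
  rw [← ofReal_norm, ← ofReal_norm, ← ENNReal.ofReal_coe_nnreal,
    ← ENNReal.ofReal_mul (norm_nonneg _)]
  refine (ENNReal.ofReal_le_ofReal this).trans ?_
  rw [ENNReal.ofReal_mul (by norm_num)]
  simp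

theorem enorm_two_pi_pow_inv_le : ‖((((2 * Real.pi) ^ 3 : ℝ)⁻¹ : ℝ) : ℂ)‖ₑ ≤ 1 := by
  rw [← ofReal_norm, Complex.norm_real, Real.norm_of_nonneg (by positivity)]
  rw [← ENNReal.ofReal_one]
  refine ENNReal.ofReal_le_ofReal (inv_le_one_of_one_le₀ (one_le_pow₀ ?_))
  linarith [Real.pi_gt_three]

theorem enorm_tensorHat₂_le (f h : Space → Vec) (j k : Fin 3) (ξ : Space) :
    ‖tensorHat₂ f h j k ξ‖ₑ ≤ conv (fun η => ‖f η‖ₑ) (fun η => ‖h η‖ₑ) ξ := by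
  rw [tensorHat₂, enorm_mul]
  calc _ ≤ 1 * ∫⁻ η : Space, ‖f (ξ - η) j * h η k‖ₑ :=
        mul_le_mul' (by simpa using enorm_two_pi_pow_inv_le) (enorm_integral_le_lintegral_enorm _)
    _ ≤ _ := by
      rw [one_mul]
      refine lintegral_mono fun η => ?_
      rw [enorm_mul]
      exact mul_le_mul' (enorm_apply_le _ _) (enorm_apply_le _ _)

/-- The constant of the bilinear estimates. -/
abbrev bilinearConst : ℝ≥0∞ := 96

/-- The symbol of `e^{√t |D|}`. -/
def weight (t : ℝ) (ξ : Space) : ℝ≥0∞ := ENNReal.ofReal (Real.exp (Real.sqrt t * ‖ξ‖))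

theorem one_le_weight (t : ℝ) (ξ : Space) : 1 ≤ weight t ξ := by
  rw [weight, ← ENNReal.ofReal_one]
  exact ENNReal.ofReal_le_ofReal (Real.one_le_exp (by positivity))

/-- The triangle inequality `|ξ| ≤ |ξ - η| + |η|` lets the analytic weight be distributed over the
factors of a convolution. -/
theorem weight_le_mul (s : ℝ) (ξ η : Space) : weight s ξ ≤ weight s (ξ - η) * weight s η := by
  unfold weight
  rw [← ENNReal.ofReal_mul (Real.exp_pos _).le, ← Real.exp_add, ← mul_add]
  gcongr
  simpa using norm_add_le (ξ - η) η

/-- Combine `√t ≤ √s + √(t - s)` with `√(t - s) |ξ| ≤ 1/2 + (t - s) |ξ|² / 2`. Half of the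
dissipation is spent on the weight, which is why `heat` has viscosity `1/2`; the constant is
`e^{1/2} ≤ 2`. -/
theorem weight_mul_heat_le {s t : ℝ} (hst : s ≤ t) (ξ : Space) :
    weight t ξ * ENNReal.ofReal (Real.exp (-(t - s) * ‖ξ‖ ^ 2)) ≤
      2 * heat (t - s) ξ * weight s ξ := by
  have h2 : ∀ x y : ℝ≥0∞, 2 * x * y = ENNReal.ofReal 2 * x * y := by simp
  unfold weight heat
  rw [← ENNReal.ofReal_mul (Real.exp_pos _).le, ← Real.exp_add, h2,
    ← ENNReal.ofReal_mul (by norm_num), ← ENNReal.ofReal_mul (by positivity)]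
  refine ENNReal.ofReal_le_ofReal ?_
  have he : Real.exp (1 / 2) ≤ 2 := by
    have h1 := Real.exp_one_lt_d9
    have h3 : Real.exp (1 / 2) ^ 2 = Real.exp 1 := by rw [← Real.exp_nat_mul]; norm_num
    nlinarith [Real.exp_pos (1 / 2)]
  have hsq : Real.sqrt t ≤ Real.sqrt s + Real.sqrt (t - s) := by
    rcases le_total s 0 with hs | hs
    · rw [Real.sqrt_eq_zero_of_nonpos hs, zero_add]
      exact Real.sqrt_le_sqrt (by linarith)
    · have := Real.sqrt_le_sqrt (show t ≤ (Real.sqrt s + Real.sqrt (t - s)) ^ 2 by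
        nlinarith [Real.sq_sqrt hs, Real.sq_sqrt (sub_nonneg.2 hst), Real.sqrt_nonneg s,
          Real.sqrt_nonneg (t - s), mul_nonneg (Real.sqrt_nonneg s) (Real.sqrt_nonneg (t - s))])
      rwa [Real.sqrt_sq (by positivity)] at this
  have hx : Real.sqrt (t - s) * ‖ξ‖ ≤ 1 / 2 + (t - s) * (‖ξ‖ ^ 2 / 2) := by
    have h := Real.sq_sqrt (sub_nonneg.2 hst)
    nlinarith [sq_nonneg (Real.sqrt (t - s) * ‖ξ‖ - 1)]
  calc Real.exp (Real.sqrt t * ‖ξ‖ + -(t - s) * ‖ξ‖ ^ 2)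
      ≤ Real.exp (1 / 2 + -(t - s) * (‖ξ‖ ^ 2 / 2) + Real.sqrt s * ‖ξ‖) := by
        rw [Real.exp_le_exp]
        have := mul_le_mul_of_nonneg_right hsq (norm_nonneg ξ)
        linarith
    _ = Real.exp (1 / 2) * Real.exp (-(t - s) * (‖ξ‖ ^ 2 / 2)) * Real.exp (Real.sqrt s * ‖ξ‖) := by
        rw [Real.exp_add, Real.exp_add]
    _ ≤ _ := by gcongr

theorem exp_le_heat {t : ℝ} (ht : 0 ≤ t) (ξ : Space) :
    ENNReal.ofReal (Real.exp (-t * ‖ξ‖ ^ 2)) ≤ heat t ξ := by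
  unfold heat
  refine ENNReal.ofReal_le_ofReal (Real.exp_le_exp.2 ?_)
  have : 0 ≤ t * ‖ξ‖ ^ 2 := by positivity
  linarith

theorem enorm_duhamelIntegrand₂_le (f h : ℝ → Space → Vec) (t : ℝ) (ξ : Space) (s : ℝ) :
    ‖duhamelIntegrand₂ f h t ξ s‖ₑ ≤ ENNReal.ofReal (Real.exp (-(t - s) * ‖ξ‖ ^ 2)) *
      (48 * (‖ξ‖ₑ * conv (fun η => ‖f s η‖ₑ) (fun η => ‖h s η‖ₑ) ξ)) := by
  rw [duhamelIntegrand₂, enorm_smul, enorm_ofReal_complex (Real.exp_pos _).le]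
  gcongr
  exact enorm_projDiv_le fun k j => enorm_tensorHat₂_le _ _ k j ξ

/-- The weight at time `t` is traded for the weight at time `s`, which is then distributed over the
convolution. The constant is `96 = 2 · 48`: `2` from the exchange, `48` from the symbol. -/
theorem weight_mul_enorm_duhamelIntegrand₂_le (f h : ℝ → Space → Vec) {s t : ℝ} (hst : s ≤ t)
    (ξ : Space) :
    weight t ξ * ‖duhamelIntegrand₂ f h t ξ s‖ₑ ≤ heat (t - s) ξ * (bilinearConst * ‖ξ‖ₑ *
      conv (fun η => weight s η * ‖f s η‖ₑ) (fun η => weight s η * ‖h s η‖ₑ) ξ) := by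
  have hconv : weight s ξ * conv (fun η => ‖f s η‖ₑ) (fun η => ‖h s η‖ₑ) ξ ≤
      conv (fun η => weight s η * ‖f s η‖ₑ) (fun η => weight s η * ‖h s η‖ₑ) ξ := by
    unfold conv
    rw [← lintegral_const_mul' _ _ (by unfold weight; simp)]
    refine lintegral_mono fun η => ?_
    calc weight s ξ * (‖f s (ξ - η)‖ₑ * ‖h s η‖ₑ)
        ≤ weight s (ξ - η) * weight s η * (‖f s (ξ - η)‖ₑ * ‖h s η‖ₑ) := by
          gcongr; exact weight_le_mul s ξ η
      _ = _ := by ring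
  calc _ ≤ (weight t ξ * ENNReal.ofReal (Real.exp (-(t - s) * ‖ξ‖ ^ 2))) *
        (48 * (‖ξ‖ₑ * conv (fun η => ‖f s η‖ₑ) (fun η => ‖h s η‖ₑ) ξ)) := by
        rw [mul_assoc]
        exact mul_le_mul' le_rfl (enorm_duhamelIntegrand₂_le f h t ξ s)
    _ ≤ (2 * heat (t - s) ξ * weight s ξ) *
        (48 * (‖ξ‖ₑ * conv (fun η => ‖f s η‖ₑ) (fun η => ‖h s η‖ₑ) ξ)) := mul_le_mul' (weight_mul_heat_le hst ξ) le_rfl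
    _ = heat (t - s) ξ * (96 * ‖ξ‖ₑ *
        (weight s ξ * conv (fun η => ‖f s η‖ₑ) (fun η => ‖h s η‖ₑ) ξ)) := by ring
    _ ≤ _ := by gcongr

theorem enorm_duhamelIntegrand₂_le_heat (f h : ℝ → Space → Vec) {s t : ℝ} (hst : s ≤ t)
    (ξ : Space) :
    ‖duhamelIntegrand₂ f h t ξ s‖ₑ ≤ heat (t - s) ξ * (bilinearConst * ‖ξ‖ₑ *
      conv (fun η => ‖f s η‖ₑ) (fun η => ‖h s η‖ₑ) ξ) := by
  refine (enorm_duhamelIntegrand₂_le f h t ξ s).trans ?_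
  rw [← mul_assoc 48]
  gcongr
  · exact exp_le_heat (sub_nonneg.2 hst) ξ
  · norm_num

/-! ### Measurability -/

theorem measurable_apply {α : Type*} [MeasurableSpace α] {f : α → Vec} (hf : Measurable f)
    (j : Fin 3) : Measurable fun x => f x j :=
  (EuclideanSpace.proj (𝕜 := ℂ) j).continuous.measurable.comp hf

theorem measurable_tensorHat₂ {f h : ℝ → Space → Vec} (hf : Measurable (Function.uncurry f))
    (hh : Measurable (Function.uncurry h)) (j k : Fin 3) :
    Measurable fun q : ℝ × Space => tensorHat₂ (f q.1) (h q.1) j k q.2 := by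
  have h1 : Measurable fun q : (ℝ × Space) × Space => f q.1.1 (q.1.2 - q.2) j * h q.1.1 q.2 k :=
    (measurable_apply (hf.comp (f := fun q : (ℝ × Space) × Space => (q.1.1, q.1.2 - q.2))
      (by fun_prop)) j).mul (measurable_apply
      (hh.comp (f := fun q : (ℝ × Space) × Space => (q.1.1, q.2)) (by fun_prop)) k)
  exact (h1.stronglyMeasurable.integral_prod_right').measurable.const_mul _

theorem measurable_duhamelIntegrand₂ {f h : ℝ → Space → Vec}
    (hf : Measurable (Function.uncurry f)) (hh : Measurable (Function.uncurry h)) :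
    Measurable fun q : (ℝ × Space) × ℝ => duhamelIntegrand₂ f h q.1.1 q.1.2 q.2 := by
  unfold duhamelIntegrand₂
  refine Measurable.smul
    (f := fun q : (ℝ × Space) × ℝ => (Real.exp (-(q.1.1 - q.2) * ‖q.1.2‖ ^ 2) : ℂ))
    (g := fun q => projDiv q.1.2 (fun k j => tensorHat₂ (f q.2) (h q.2) k j q.1.2)) ?_ ?_
  · fun_prop
  have hT : ∀ k j, Measurable fun q : (ℝ × Space) × ℝ =>
      tensorHat₂ (f q.2) (h q.2) k j q.1.2 := fun k j =>
    (measurable_tensorHat₂ hf hh k j).comp (f := fun q : (ℝ × Space) × ℝ => (q.2, q.1.2))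
      (by fun_prop)
  have hξ : ∀ k : Fin 3, Measurable fun q : (ℝ × Space) × ℝ => ((q.1.2 k : ℝ) : ℂ) := fun k =>
    Complex.measurable_ofReal.comp ((EuclideanSpace.proj (𝕜 := ℝ) k).continuous.measurable.comp
      (f := fun q : (ℝ × Space) × ℝ => q.1.2) (by fun_prop))
  have hn : Measurable fun q : (ℝ × Space) × ℝ => ((‖q.1.2‖ ^ 2 : ℝ) : ℂ) := by fun_prop
  change Measurable fun q : (ℝ × Space) × ℝ => leraySymbol q.1.2 (WithLp.toLp 2 fun j =>
    ∑ k : Fin 3, Complex.I * (q.1.2 k : ℂ) * tensorHat₂ (f q.2) (h q.2) k j q.1.2)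
  unfold leraySymbol
  refine (WithLp.measurable_toLp 2 (Fin 3 → ℂ)).comp (measurable_pi_lambda _ fun j => ?_)
  dsimp only
  fun_prop

/-- The bilinear Duhamel operator. -/
def duhamel (f h : ℝ → Space → Vec) (t : ℝ) (ξ : Space) : Vec :=
  ∫ s in (0 : ℝ)..t, duhamelIntegrand₂ f h t ξ s

theorem measurable_duhamel {f h : ℝ → Space → Vec} (hf : Measurable (Function.uncurry f))
    (hh : Measurable (Function.uncurry h)) : Measurable (Function.uncurry (duhamel f h)) := by
  have hm := measurable_duhamelIntegrand₂ hf hh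
  -- The interval integral is oriented, so for negative `t` the second term carries the value.
  -- Writing both as full integrals of indicators makes the dependence on `(t, ξ)` jointly
  -- measurable.
  have e : Function.uncurry (duhamel f h) = fun q : ℝ × Space =>
      (∫ s, {p : (ℝ × Space) × ℝ | 0 < p.2 ∧ p.2 ≤ p.1.1}.indicator
        (fun p => duhamelIntegrand₂ f h p.1.1 p.1.2 p.2) (q, s)) -
      ∫ s, {p : (ℝ × Space) × ℝ | p.1.1 < p.2 ∧ p.2 ≤ 0}.indicator
        (fun p => duhamelIntegrand₂ f h p.1.1 p.1.2 p.2) (q, s) := by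
    ext1 ⟨t, ξ⟩
    rw [Function.uncurry_apply_pair, duhamel, intervalIntegral,
      ← integral_indicator measurableSet_Ioc, ← integral_indicator measurableSet_Ioc]
    rfl
  have h1 : MeasurableSet {p : (ℝ × Space) × ℝ | 0 < p.2 ∧ p.2 ≤ p.1.1} :=
    (measurableSet_lt measurable_const measurable_snd).inter
      (measurableSet_le measurable_snd (measurable_fst.comp measurable_fst))
  have h2 : MeasurableSet {p : (ℝ × Space) × ℝ | p.1.1 < p.2 ∧ p.2 ≤ 0} :=
    (measurableSet_lt (measurable_fst.comp measurable_fst) measurable_snd).inter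
      (measurableSet_le measurable_snd measurable_const)
  rw [e]
  exact (hm.indicator h1).stronglyMeasurable.integral_prod_right'.measurable.sub
    (hm.indicator h2).stronglyMeasurable.integral_prod_right'.measurable

theorem duhamelMajorant_mono {κ : ℝ≥0∞} {f h f' h' : ℝ → Space → ℝ≥0∞} {t : ℝ}
    (hf : ∀ s ξ, s ∈ Set.Ioo 0 t → f s ξ ≤ f' s ξ) (hh : ∀ s ξ, s ∈ Set.Ioo 0 t → h s ξ ≤ h' s ξ)
    (ξ : Space) : duhamelMajorant κ f h t ξ ≤ duhamelMajorant κ f' h' t ξ := by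
  refine setLIntegral_mono' measurableSet_Ioo fun s hs => ?_
  unfold conv
  gcongr
  · exact hf _ _ hs
  · exact hh _ _ hs

theorem weight_mul_enorm_duhamel_le {f h : ℝ → Space → Vec} {F H : ℝ → Space → ℝ≥0∞} {t : ℝ}
    (ht : 0 ≤ t) (hf : ∀ s ξ, 0 ≤ s → weight s ξ * ‖f s ξ‖ₑ ≤ F s ξ)
    (hh : ∀ s ξ, 0 ≤ s → weight s ξ * ‖h s ξ‖ₑ ≤ H s ξ) (ξ : Space) :
    weight t ξ * ‖duhamel f h t ξ‖ₑ ≤ duhamelMajorant bilinearConst F H t ξ := by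
  calc _ ≤ weight t ξ * ∫⁻ s in Set.Ioc 0 t, ‖duhamelIntegrand₂ f h t ξ s‖ₑ := by
        gcongr
        rw [duhamel, intervalIntegral.integral_of_le ht]
        exact enorm_integral_le_lintegral_enorm _
    _ = ∫⁻ s in Set.Ioo 0 t, weight t ξ * ‖duhamelIntegrand₂ f h t ξ s‖ₑ := by
        rw [← lintegral_const_mul' _ _ (by unfold weight; simp),
          setLIntegral_congr Ioo_ae_eq_Ioc]
    _ ≤ duhamelMajorant bilinearConst (fun s ξ => weight s ξ * ‖f s ξ‖ₑ)
          (fun s ξ => weight s ξ * ‖h s ξ‖ₑ) t ξ :=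
        setLIntegral_mono' measurableSet_Ioo fun s hs =>
          weight_mul_enorm_duhamelIntegrand₂_le f h hs.2.le ξ
    _ ≤ _ := duhamelMajorant_mono (fun s ξ hs => hf s ξ hs.1.le) (fun s ξ hs => hh s ξ hs.1.le) ξ

/-! ### The series of the mild solution -/

/-- The terms of the series of the mild solution, on the Fourier side. -/
def mildTerm (g₀ : Space → Vec) : ℕ → ℝ → Space → Vec
  | 0 => fun t ξ => (Real.exp (-t * ‖ξ‖ ^ 2) : ℂ) • g₀ ξ
  | n + 1 => fun t ξ => -∑ i : Fin (n + 1), duhamel (mildTerm g₀ i) (mildTerm g₀ (n - i)) t ξ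
  decreasing_by all_goals omega

section MildSeries

variable {g₀ : Space → Vec}

theorem mildTerm_zero (t : ℝ) (ξ : Space) :
    mildTerm g₀ 0 t ξ = (Real.exp (-t * ‖ξ‖ ^ 2) : ℂ) • g₀ ξ := by
  rw [mildTerm]

theorem mildTerm_succ (n : ℕ) (t : ℝ) (ξ : Space) :
    mildTerm g₀ (n + 1) t ξ = -∑ p ∈ Finset.HasAntidiagonal.antidiagonal n,
      duhamel (mildTerm g₀ p.1) (mildTerm g₀ p.2) t ξ := by
  rw [Finset.Nat.sum_antidiagonal_eq_sum_range_succ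
    (fun i j => duhamel (mildTerm g₀ i) (mildTerm g₀ j) t ξ), Finset.sum_range, mildTerm]

/-- Induction principle along the recursion for the terms of the series. -/
theorem mildTerm_induction {P : (ℝ → Space → Vec) → Prop}
    (zero : P fun t ξ => (Real.exp (-t * ‖ξ‖ ^ 2) : ℂ) • g₀ ξ)
    (duh : ∀ f h, P f → P h → P (duhamel f h)) (neg : ∀ f, P f → P fun t ξ => -f t ξ)
    (zero' : P fun _ _ => 0) (add : ∀ f h, P f → P h → P fun t ξ => f t ξ + h t ξ) (n : ℕ) :
    P (mildTerm g₀ n) := by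
  induction n using Nat.strong_induction_on with
  | _ n ih =>
    cases n with
    | zero => rwa [mildTerm]
    | succ n =>
      have hsum : ∀ s : Finset (ℕ × ℕ), s ⊆ Finset.HasAntidiagonal.antidiagonal n →
          P fun t ξ => ∑ p ∈ s, duhamel (mildTerm g₀ p.1) (mildTerm g₀ p.2) t ξ := by
        classical
        intro s
        induction s using Finset.induction_on with
        | empty => intro _; simpa using zero'
        | insert p s hp ihs =>
          intro hs
          have h1 := Finset.HasAntidiagonal.mem_antidiagonal.1 (hs (Finset.mem_insert_self p s))
          simp only [Finset.sum_insert hp]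
          exact add _ _ (duh _ _ (ih _ (by omega)) (ih _ (by omega)))
            (ihs ((Finset.subset_insert p s).trans hs))
      have e : mildTerm g₀ (n + 1) = fun t ξ => -∑ p ∈ Finset.HasAntidiagonal.antidiagonal n,
          duhamel (mildTerm g₀ p.1) (mildTerm g₀ p.2) t ξ := by
        ext1 t; ext1 ξ; exact mildTerm_succ n t ξ
      rw [e]
      exact neg _ (hsum _ subset_rfl)

theorem measurable_mildTerm (hg : Measurable g₀) (n : ℕ) :
    Measurable (Function.uncurry (mildTerm g₀ n)) := by
  refine mildTerm_induction (P := fun f => Measurable (Function.uncurry f)) ?_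
    (fun f h hf hh => measurable_duhamel hf hh) (fun f hf => hf.neg) measurable_const
    (fun f h hf hh => hf.add hh) n
  refine Measurable.smul (f := fun q : ℝ × Space => (Real.exp (-q.1 * ‖q.2‖ ^ 2) : ℂ))
    (g := fun q : ℝ × Space => g₀ q.2) ?_ (hg.comp measurable_snd)
  fun_prop

/-- The majorant of the solution with initial datum `g₀`. -/
def solMajorant (g₀ : Space → Vec) : ℝ → Space → ℝ≥0∞ :=
  majorant bilinearConst (heatMajorant fun ξ => ‖g₀ ξ‖ₑ)

/-- The scalar and vector series obey the same recursion, so the bilinear bound propagates by strong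
induction; the start is `weight_mul_heat_le` from time `0`. -/
theorem weight_mul_enorm_mildTerm_le (n : ℕ) {t : ℝ} (ht : 0 ≤ t) (ξ : Space) :
    weight t ξ * ‖mildTerm g₀ n t ξ‖ₑ ≤
      majorantTerm bilinearConst (heatMajorant fun ξ => ‖g₀ ξ‖ₑ) n t ξ := by
  induction n using Nat.strong_induction_on generalizing t ξ with
  | _ n ih =>
    cases n with
    | zero =>
      rw [mildTerm_zero, majorantTerm, enorm_smul, enorm_ofReal_complex (Real.exp_pos _).le,
        ← mul_assoc]
      have := weight_mul_heat_le ht ξ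
      have h0 : weight 0 ξ = 1 := by simp [weight]
      rw [h0, sub_zero, mul_one] at this
      unfold heatMajorant
      gcongr
    | succ n =>
      rw [mildTerm_succ, majorantTerm_succ, enorm_neg]
      calc _ ≤ weight t ξ * ∑ p ∈ Finset.HasAntidiagonal.antidiagonal n,
            ‖duhamel (mildTerm g₀ p.1) (mildTerm g₀ p.2) t ξ‖ₑ := by
            gcongr; exact enorm_sum_le _ _
        _ ≤ _ := by
          rw [Finset.mul_sum]
          refine Finset.sum_le_sum fun p hp => ?_
          have hp := Finset.HasAntidiagonal.mem_antidiagonal.1 hp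
          exact weight_mul_enorm_duhamel_le ht (fun s ξ hs => ih _ (by omega) hs ξ)
            (fun s ξ hs => ih _ (by omega) hs ξ) ξ

theorem enorm_mildTerm_le (n : ℕ) {t : ℝ} (ht : 0 ≤ t) (ξ : Space) : ‖mildTerm g₀ n t ξ‖ₑ ≤
    majorantTerm bilinearConst (heatMajorant fun ξ => ‖g₀ ξ‖ₑ) n t ξ :=
  (le_mul_of_one_le_left' (one_le_weight t ξ)).trans (weight_mul_enorm_mildTerm_le n ht ξ)

open scoped Classical in
/-- The Fourier transform of the mild solution with initial datum `g₀`. -/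
def mildSeries (g₀ : Space → Vec) (t : ℝ) (ξ : Space) : Vec :=
  if solMajorant g₀ t ξ < ∞ then ∑' n, mildTerm g₀ n t ξ else 0

theorem measurable_solMajorant (hg : Measurable g₀) :
    Measurable (Function.uncurry (solMajorant g₀)) :=
  measurable_majorant (measurable_heatMajorant hg.enorm)

theorem measurable_mildSeries (hg : Measurable g₀) :
    Measurable (Function.uncurry (mildSeries g₀)) := by
  classical
  have h1 : Measurable fun q : ℝ × Space => ∑' n, mildTerm g₀ n q.1 q.2 :=
    Measurable.tsum fun n => measurable_mildTerm hg n
  exact Measurable.ite (measurableSet_lt (measurable_solMajorant hg) measurable_const) h1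
    measurable_const

theorem summable_norm_mildTerm {t : ℝ} (ht : 0 ≤ t) {ξ : Space} (h : solMajorant g₀ t ξ < ∞) :
    Summable fun n => ‖mildTerm g₀ n t ξ‖ := by
  have h1 : ∑' n, ‖mildTerm g₀ n t ξ‖ₑ ≠ ∞ :=
    ((ENNReal.tsum_le_tsum fun n => enorm_mildTerm_le n ht ξ).trans_lt h).ne
  have := ENNReal.summable_toReal h1
  simpa using this

theorem hasSum_mildSeries {t : ℝ} (ht : 0 ≤ t) {ξ : Space} (h : solMajorant g₀ t ξ < ∞) :
    HasSum (fun n => mildTerm g₀ n t ξ) (mildSeries g₀ t ξ) := by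
  rw [mildSeries, if_pos h]
  exact (summable_norm_mildTerm ht h).of_norm.hasSum

theorem weight_mul_enorm_mildSeries_le {t : ℝ} (ht : 0 ≤ t) (ξ : Space) :
    weight t ξ * ‖mildSeries g₀ t ξ‖ₑ ≤ solMajorant g₀ t ξ := by
  by_cases h : solMajorant g₀ t ξ < ∞
  · rw [mildSeries, if_pos h]
    calc _ ≤ weight t ξ * ∑' n, ‖mildTerm g₀ n t ξ‖ₑ := by gcongr; exact enorm_tsum_le_tsum_enorm
      _ ≤ _ := by
        rw [← ENNReal.tsum_mul_left]
        exact ENNReal.tsum_le_tsum fun n => weight_mul_enorm_mildTerm_le n ht ξ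
  · rw [mildSeries, if_neg h]
    simp

theorem enorm_mildSeries_le {t : ℝ} (ht : 0 ≤ t) (ξ : Space) :
    ‖mildSeries g₀ t ξ‖ₑ ≤ solMajorant g₀ t ξ :=
  (le_mul_of_one_le_left' (one_le_weight t ξ)).trans (weight_mul_enorm_mildSeries_le ht ξ)

/-! ### Termwise integration of the series. -/

theorem hasSum_integral_of_tsum_lintegral_enorm {α ι E : Type*} [MeasurableSpace α] [Countable ι]
    [NormedAddCommGroup E] [NormedSpace ℝ E] [CompleteSpace E] {μ : Measure α} {F : ι → α → E}
    {f : α → E} (hF : ∀ i, AEStronglyMeasurable (F i) μ) (hsum : ∑' i, ∫⁻ a, ‖F i a‖ₑ ∂μ ≠ ∞)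
    (hf : ∀ᵐ a ∂μ, HasSum (fun i => F i a) (f a)) :
    HasSum (fun i => ∫ a, F i a ∂μ) (∫ a, f a ∂μ) := by
  have hint : ∀ i, Integrable (F i) μ := fun i =>
    ⟨hF i, ((ENNReal.le_tsum i).trans_lt hsum.lt_top)⟩
  have h1 : Summable fun i => ∫ a, ‖F i a‖ ∂μ := by
    have := ENNReal.summable_toReal hsum
    refine this.congr fun i => ?_
    rw [integral_norm_eq_lintegral_enorm (hF i)]
  have h2 := hasSum_integral_of_summable_integral_norm hint h1
  rwa [integral_congr_ae (hf.mono fun a ha => ha.tsum_eq)] at h2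

theorem hasSum_mul_of_summable_norm {f g : ℕ → ℂ} {a b : ℂ} (hf : HasSum f a) (hg : HasSum g b)
    (hf' : Summable fun n => ‖f n‖) (hg' : Summable fun n => ‖g n‖) :
    HasSum (fun p : ℕ × ℕ => f p.1 * g p.2) (a * b) :=
  hf.mul hg (summable_mul_of_summable_norm hf' hg')

theorem hasSum_tensorHat₂ (hg : Measurable g₀) {s : ℝ} (hs : 0 ≤ s)
    (hfin : ∀ᵐ ξ, solMajorant g₀ s ξ < ∞) {ξ : Space}
    (hconv : conv (solMajorant g₀ s) (solMajorant g₀ s) ξ < ∞) (j k : Fin 3) :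
    HasSum (fun p : ℕ × ℕ => tensorHat₂ (mildTerm g₀ p.1 s) (mildTerm g₀ p.2 s) j k ξ)
      (tensorHat₂ (mildSeries g₀ s) (mildSeries g₀ s) j k ξ) := by
  have hfin' : ∀ᵐ η : Space, solMajorant g₀ s (ξ - η) < ∞ :=
    (Measure.measurePreserving_sub_left volume ξ).quasiMeasurePreserving.ae hfin
  have hm : ∀ n, Measurable (mildTerm g₀ n s) := fun n =>
    (measurable_mildTerm hg n).comp measurable_prodMk_left
  have hU := measurable_heatMajorant hg.enorm
  unfold tensorHat₂
  refine HasSum.mul_left _ (hasSum_integral_of_tsum_lintegral_enorm (fun p => ?_) ?_ ?_)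
  · exact ((measurable_apply ((hm p.1).comp (measurable_const.sub measurable_id)) j).mul
      (measurable_apply (hm p.2) k)).aestronglyMeasurable
  · refine (lt_of_le_of_lt ?_ hconv).ne
    unfold solMajorant majorant
    have hUs : ∀ n, Measurable (majorantTerm bilinearConst (heatMajorant fun ξ => ‖g₀ ξ‖ₑ) n s) :=
      fun n => (measurable_majorantTerm hU n).comp measurable_prodMk_left
    rw [conv_tsum hUs hUs]
    refine ENNReal.tsum_le_tsum fun p => lintegral_mono fun η => ?_
    rw [enorm_mul]
    exact mul_le_mul' ((enorm_apply_le _ _).trans (enorm_mildTerm_le _ hs _))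
      ((enorm_apply_le _ _).trans (enorm_mildTerm_le _ hs _))
  · filter_upwards [hfin, hfin'] with η h1 h2
    have proj : ∀ ζ (i : Fin 3), solMajorant g₀ s ζ < ∞ →
        HasSum (fun n => mildTerm g₀ n s ζ i) (mildSeries g₀ s ζ i) ∧
        Summable fun n => ‖mildTerm g₀ n s ζ i‖ := by
      intro ζ i h
      refine ⟨(hasSum_mildSeries hs h).mapL (EuclideanSpace.proj (𝕜 := ℂ) i), ?_⟩
      exact (summable_norm_mildTerm hs h).of_nonneg_of_le (fun _ => norm_nonneg _)
        fun n => PiLp.norm_apply_le _ i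
    obtain ⟨a1, b1⟩ := proj _ j h2
    obtain ⟨a2, b2⟩ := proj _ k h1
    have h3 := hasSum_mul_of_summable_norm a1 a2 b1 b2
    exact h3

theorem duhamelMajorant_solMajorant_lt_top (hg : Measurable g₀) {t : ℝ} {ξ : Space}
    (h : solMajorant g₀ t ξ < ∞) :
    duhamelMajorant bilinearConst (solMajorant g₀) (solMajorant g₀) t ξ < ∞ := by
  refine lt_of_le_of_lt ?_ h
  nth_rw 3 [solMajorant]
  rw [majorant_eq (measurable_heatMajorant hg.enorm)]
  exact le_add_self

/-- A finite Duhamel integral has an integrand finite for almost every `s`, and the factors in front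
of the convolution are nonzero. -/
theorem conv_solMajorant_lt_top (hg : Measurable g₀) {t : ℝ} {ξ : Space} (hξ : ‖ξ‖ₑ ≠ 0)
    (h : solMajorant g₀ t ξ < ∞) :
    ∀ᵐ s ∂volume.restrict (Set.Ioc 0 t), conv (solMajorant g₀ s) (solMajorant g₀ s) ξ < ∞ := by
  have hM := measurable_solMajorant hg
  have hlt := duhamelMajorant_solMajorant_lt_top hg h
  have hm : Measurable fun s => heat (t - s) ξ * (bilinearConst * ‖ξ‖ₑ *
      conv (solMajorant g₀ s) (solMajorant g₀ s) ξ) := by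
    have h1 : Measurable fun s => heat (t - s) ξ :=
      measurable_heat.comp (f := fun s : ℝ => (t - s, ξ)) (by fun_prop)
    have h2 : Measurable fun s => conv (solMajorant g₀ s) (solMajorant g₀ s) ξ :=
      (measurable_conv hM hM).comp measurable_prodMk_right
    fun_prop
  rw [← restrict_Ioo_eq_restrict_Ioc]
  filter_upwards [ae_lt_top hm hlt.ne] with s hs
  by_contra hc
  have hc : conv (solMajorant g₀ s) (solMajorant g₀ s) ξ = ∞ := by simpa using hc
  have h1 : heat (t - s) ξ ≠ 0 := by simp [heat, Real.exp_pos]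
  rw [hc, ENNReal.mul_top (by simpa using hξ), ENNReal.mul_top h1] at hs
  exact hs.ne rfl

theorem lintegral_enorm_duhamelIntegrand₂_le {f h : ℝ → Space → Vec} {F H : ℝ → Space → ℝ≥0∞}
    (hf : ∀ s ξ, 0 ≤ s → ‖f s ξ‖ₑ ≤ F s ξ) (hh : ∀ s ξ, 0 ≤ s → ‖h s ξ‖ₑ ≤ H s ξ) (t : ℝ)
    (ξ : Space) :
    ∫⁻ s in Set.Ioc 0 t, ‖duhamelIntegrand₂ f h t ξ s‖ₑ ≤
      duhamelMajorant bilinearConst F H t ξ := by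
  rw [← restrict_Ioo_eq_restrict_Ioc]
  calc _ ≤ duhamelMajorant bilinearConst (fun s ξ => ‖f s ξ‖ₑ) (fun s ξ => ‖h s ξ‖ₑ) t ξ :=
        setLIntegral_mono' measurableSet_Ioo fun s hs =>
          enorm_duhamelIntegrand₂_le_heat f h hs.2.le ξ
    _ ≤ _ := duhamelMajorant_mono (fun s ξ hs => hf s ξ hs.1.le) (fun s ξ hs => hh s ξ hs.1.le) ξ

/-- Two exchanges of sum and integral, in `η` inside `hasSum_tensorHat₂` and in `s` here. The
Duhamel term of the majorant, expanded as a double series, dominates the latter. -/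
theorem hasSum_duhamel (hg : Measurable g₀) (hfin : ∀ s, 0 ≤ s → ∀ᵐ ξ, solMajorant g₀ s ξ < ∞)
    {t : ℝ} (ht : 0 ≤ t) {ξ : Space} (hξ : ‖ξ‖ₑ ≠ 0) (h : solMajorant g₀ t ξ < ∞) :
    HasSum (fun p : ℕ × ℕ => duhamel (mildTerm g₀ p.1) (mildTerm g₀ p.2) t ξ)
      (duhamel (mildSeries g₀) (mildSeries g₀) t ξ) := by
  have hU := measurable_heatMajorant hg.enorm
  unfold duhamel
  simp_rw [intervalIntegral.integral_of_le ht]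
  refine hasSum_integral_of_tsum_lintegral_enorm (fun p => ?_) ?_ ?_
  · exact ((measurable_duhamelIntegrand₂ (measurable_mildTerm hg p.1)
      (measurable_mildTerm hg p.2)).comp
      (measurable_prodMk_left (x := (t, ξ)))).aestronglyMeasurable
  · refine (lt_of_le_of_lt ?_ (duhamelMajorant_solMajorant_lt_top hg h)).ne
    unfold solMajorant majorant
    rw [duhamelMajorant_tsum (measurable_majorantTerm hU) (measurable_majorantTerm hU)]
    exact ENNReal.tsum_le_tsum fun p => lintegral_enorm_duhamelIntegrand₂_le
      (fun s ξ hs => enorm_mildTerm_le _ hs ξ) (fun s ξ hs => enorm_mildTerm_le _ hs ξ) t ξ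
  · filter_upwards [conv_solMajorant_lt_top hg hξ h, ae_restrict_mem measurableSet_Ioc]
      with s hs hst
    unfold duhamelIntegrand₂
    refine HasSum.const_smul _ ?_
    have hT : HasSum (fun p : ℕ × ℕ => fun k j : Fin 3 =>
        tensorHat₂ (mildTerm g₀ p.1 s) (mildTerm g₀ p.2 s) k j ξ)
        (fun k j => tensorHat₂ (mildSeries g₀ s) (mildSeries g₀ s) k j ξ) :=
      Pi.hasSum.2 fun k => Pi.hasSum.2 fun j =>
        hasSum_tensorHat₂ hg hst.1.le (hfin s hst.1.le) hs k j
    exact hT.mapL (LinearMap.toContinuousLinearMap (projDiv ξ))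

/-- Absolute convergence allows the double series of Duhamel terms to be grouped by antidiagonals,
and each group is minus the next term of the series by the recursion. -/
theorem mildSeries_eq (hg : Measurable g₀) (hfin : ∀ s, 0 ≤ s → ∀ᵐ ξ, solMajorant g₀ s ξ < ∞)
    {t : ℝ} (ht : 0 ≤ t) {ξ : Space} (hξ : ‖ξ‖ₑ ≠ 0) (h : solMajorant g₀ t ξ < ∞) :
    mildSeries g₀ t ξ = (Real.exp (-t * ‖ξ‖ ^ 2) : ℂ) • g₀ ξ -
      duhamel (mildSeries g₀) (mildSeries g₀) t ξ := by
  have h1 := (hasSum_nat_add_iff' 1).2 (hasSum_mildSeries ht h)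
  have h2 := ((Finset.HasAntidiagonal.sigmaAntidiagonalEquivProd (A := ℕ)).hasSum_iff).2
    (hasSum_duhamel hg hfin ht hξ h)
  have h3 : HasSum (fun n => mildTerm g₀ (n + 1) t ξ)
      (-duhamel (mildSeries g₀) (mildSeries g₀) t ξ) := by
    refine (h2.sigma (g := fun n => -mildTerm g₀ (n + 1) t ξ) fun n => ?_).neg.congr ?_
    · rw [mildTerm_succ, neg_neg, ← Finset.sum_coe_sort]
      exact hasSum_fintype _
    · simp
  have h4 := h1.unique h3
  rw [Finset.sum_range_one, mildTerm_zero, sub_eq_iff_eq_add] at h4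
  rw [h4]
  abel

theorem intervalIntegrable_mildSeries (hg : Measurable g₀) {t : ℝ} (ht : 0 ≤ t) {ξ : Space}
    (h : solMajorant g₀ t ξ < ∞) :
    IntervalIntegrable (duhamelIntegrand (mildSeries g₀) t ξ) volume 0 t := by
  rw [intervalIntegrable_iff_integrableOn_Ioc_of_le ht]
  refine ⟨((measurable_duhamelIntegrand₂ (measurable_mildSeries hg)
      (measurable_mildSeries hg)).comp
      (measurable_prodMk_left (x := (t, ξ)))).aestronglyMeasurable, ?_⟩
  exact (lintegral_enorm_duhamelIntegrand₂_le (fun s ξ hs => enorm_mildSeries_le hs ξ)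
    (fun s ξ hs => enorm_mildSeries_le hs ξ) t ξ).trans_lt
    (duhamelMajorant_solMajorant_lt_top hg h)

theorem integrable_mildSeries_mul (hg : Measurable g₀) {s : ℝ} (hs : 0 ≤ s) {ξ : Space}
    (h : conv (solMajorant g₀ s) (solMajorant g₀ s) ξ < ∞) (j k : Fin 3) :
    Integrable fun η : Space => mildSeries g₀ s (ξ - η) j * mildSeries g₀ s η k := by
  have hm : Measurable (mildSeries g₀ s) := (measurable_mildSeries hg).comp measurable_prodMk_left
  refine ⟨((measurable_apply (hm.comp (measurable_const.sub measurable_id)) j).mul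
      (measurable_apply hm k)).aestronglyMeasurable, lt_of_le_of_lt ?_ h⟩
  refine lintegral_mono fun η => ?_
  rw [enorm_mul]
  exact mul_le_mul' ((enorm_apply_le _ _).trans (enorm_mildSeries_le hs _))
    ((enorm_apply_le _ _).trans (enorm_mildSeries_le hs _))

/-! ### Symmetries of the solution -/

/-- Complex conjugation of the components. -/
def conjVec : Vec ≃ₗᵢ[ℝ] Vec := LinearIsometryEquiv.piLpCongrRight 2 fun _ => Complex.conjLIE

@[simp]
theorem conjVec_apply (a : Vec) (j : Fin 3) : conjVec a j = (starRingEnd ℂ) (a j) := rfl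

theorem conjVec_smul (c : ℂ) (a : Vec) : conjVec (c • a) = (starRingEnd ℂ) c • conjVec a := by
  ext j; simp

theorem tensorHat₂_neg {f h : Space → Vec} (hf : ∀ ξ, f (-ξ) = conjVec (f ξ))
    (hh : ∀ ξ, h (-ξ) = conjVec (h ξ)) (j k : Fin 3) (ξ : Space) :
    tensorHat₂ f h j k (-ξ) = (starRingEnd ℂ) (tensorHat₂ f h j k ξ) := by
  unfold tensorHat₂
  rw [map_mul, ← integral_conj, ← integral_neg_eq_self]
  congr 1
  · rw [Complex.conj_ofReal]
  · refine integral_congr_ae (ae_of_all _ fun η => ?_)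
    dsimp only
    rw [show -ξ - -η = -(ξ - η) by abel, hf, hh, map_mul]
    rfl

theorem projDiv_neg (ξ : Space) (T : Fin 3 → Fin 3 → ℂ) :
    projDiv (-ξ) (fun k j => (starRingEnd ℂ) (T k j)) = conjVec (projDiv ξ T) := by
  ext j
  rw [conjVec_apply]
  simp [projDiv, leraySymbol, Fin.sum_univ_three]
  ring

theorem duhamel_neg {f h : ℝ → Space → Vec} (hf : ∀ t ξ, f t (-ξ) = conjVec (f t ξ))
    (hh : ∀ t ξ, h t (-ξ) = conjVec (h t ξ)) (t : ℝ) (ξ : Space) :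
    duhamel f h t (-ξ) = conjVec (duhamel f h t ξ) := by
  have e : ∀ s, duhamelIntegrand₂ f h t (-ξ) s = conjVec (duhamelIntegrand₂ f h t ξ s) := by
    intro s
    unfold duhamelIntegrand₂
    rw [conjVec_smul, ← projDiv_neg, norm_neg, Complex.conj_ofReal]
    simp_rw [tensorHat₂_neg (hf s) (hh s)]
  unfold duhamel
  simp_rw [e]
  rw [intervalIntegral, intervalIntegral, map_sub]
  -- No integrability is needed: a continuous linear equivalence commutes with the Bochner integral
  -- even when both sides have the default value.
  congr 1 <;> exact conjVec.toContinuousLinearEquiv.integral_comp_comm _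

theorem mildTerm_neg (h₀ : ∀ ξ, g₀ (-ξ) = conjVec (g₀ ξ)) (n : ℕ) (t : ℝ) (ξ : Space) :
    mildTerm g₀ n t (-ξ) = conjVec (mildTerm g₀ n t ξ) := by
  refine mildTerm_induction (P := fun f => ∀ t ξ, f t (-ξ) = conjVec (f t ξ)) ?_
    (fun f h hf hh => duhamel_neg hf hh) (fun f hf t ξ => by simp [hf])
    (fun _ _ => by simp) (fun f h hf hh t ξ => by simp [hf, hh]) n t ξ
  intro t ξ
  simp only [conjVec_smul, Complex.conj_ofReal, norm_neg, h₀]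

/-- The linear form `a ↦ ξ · a`. -/
def dotForm (ξ : Space) : Vec →L[ℂ] ℂ := ∑ k : Fin 3, (ξ k : ℂ) • EuclideanSpace.proj k

theorem dotForm_apply (ξ : Space) (a : Vec) : dotForm ξ a = ∑ k : Fin 3, (ξ k : ℂ) * a k := by
  simp [dotForm]

theorem dotForm_leraySymbol (ξ : Space) (a : Vec) : dotForm ξ (leraySymbol ξ a) = 0 := by
  rw [dotForm_apply]
  by_cases hξ : ξ = 0
  · simp [hξ]
  have hn : ((‖ξ‖ ^ 2 : ℝ) : ℂ) ≠ 0 := by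
    exact_mod_cast (pow_pos (norm_pos_iff.2 hξ) 2).ne'
  have hs : ((‖ξ‖ ^ 2 : ℝ) : ℂ) = (ξ 0 : ℂ) ^ 2 + (ξ 1 : ℂ) ^ 2 + (ξ 2 : ℂ) ^ 2 := by
    rw [EuclideanSpace.norm_sq_eq, Fin.sum_univ_three]
    simp only [Real.norm_eq_abs, sq_abs]
    push_cast
    ring
  simp only [leraySymbol, Fin.sum_univ_three]
  rw [hs] at hn ⊢
  field_simp
  ring

theorem dotForm_duhamel (f h : ℝ → Space → Vec) (t : ℝ) (ξ : Space) :
    dotForm ξ (duhamel f h t ξ) = 0 := by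
  have e : ∀ s, dotForm ξ (duhamelIntegrand₂ f h t ξ s) = 0 := fun s => by
    rw [duhamelIntegrand₂, map_smul]
    exact smul_eq_zero_of_right _ (dotForm_leraySymbol _ _)
  by_cases hi : IntervalIntegrable (duhamelIntegrand₂ f h t ξ) volume 0 t
  · rw [duhamel, ← ContinuousLinearMap.intervalIntegral_comp_comm _ hi]
    simp [e]
  -- Without integrability the integral is `0` by convention, which is orthogonal to `ξ` as well.
  · rw [duhamel, intervalIntegral.integral_undef hi, map_zero]

theorem dotForm_mildTerm (h₀ : ∀ ξ, dotForm ξ (g₀ ξ) = 0) (n : ℕ) (t : ℝ) (ξ : Space) :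
    dotForm ξ (mildTerm g₀ n t ξ) = 0 := by
  refine mildTerm_induction (P := fun f => ∀ t ξ, dotForm ξ (f t ξ) = 0) ?_
    (fun f h _ _ => dotForm_duhamel f h) (fun f hf t ξ => by simp [hf])
    (fun _ _ => by simp) (fun f h hf hh t ξ => by simp [hf, hh]) n t ξ
  intro t ξ
  simp [h₀]

theorem dotForm_mildSeries (h₀ : ∀ ξ, dotForm ξ (g₀ ξ) = 0) {t : ℝ} (ht : 0 ≤ t) (ξ : Space) :
    dotForm ξ (mildSeries g₀ t ξ) = 0 := by
  by_cases h : solMajorant g₀ t ξ < ∞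
  · have h1 := (hasSum_mildSeries ht h).mapL (dotForm ξ)
    simp only [dotForm_mildTerm h₀] at h1
    exact h1.unique hasSum_zero
  · rw [mildSeries, if_neg h, map_zero]

/-- Finiteness is asked at both `ξ` and `-ξ`, because the default value of the series is decided at
each frequency separately. -/
theorem mildSeries_neg (h₀ : ∀ ξ, g₀ (-ξ) = conjVec (g₀ ξ)) {t : ℝ} (ht : 0 ≤ t) {ξ : Space}
    (h : solMajorant g₀ t ξ < ∞) (h' : solMajorant g₀ t (-ξ) < ∞) :
    mildSeries g₀ t (-ξ) = conjVec (mildSeries g₀ t ξ) := by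
  have h1 := hasSum_mildSeries ht h'
  simp only [mildTerm_neg h₀] at h1
  exact h1.unique ((hasSum_mildSeries ht h).mapL
    (conjVec.toContinuousLinearEquiv : Vec →L[ℝ] Vec))

end MildSeries

/-! ### Distributions whose Fourier transform is a function -/

theorem two_pi_pos : (0 : ℝ) < 2 * Real.pi := by positivity

theorem ae_two_pi_smul {p : Space → Prop} (h : ∀ᵐ ξ, p ξ) : ∀ᵐ ξ : Space, p ((2 * Real.pi) • ξ) :=
  (Measure.quasiMeasurePreserving_smul volume two_pi_pos.ne').ae h

theorem ae_of_ae_two_pi_smul {p : Space → Prop} (h : ∀ᵐ ξ : Space, p ((2 * Real.pi) • ξ)) :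
    ∀ᵐ ξ, p ξ := by
  have := (Measure.quasiMeasurePreserving_smul (volume : Measure Space)
    (inv_ne_zero two_pi_pos.ne')).ae h
  filter_upwards [this] with ξ hξ
  rwa [smul_inv_smul₀ two_pi_pos.ne'] at hξ

theorem ae_neg {p : Space → Prop} (h : ∀ᵐ ξ, p ξ) : ∀ᵐ ξ : Space, p (-ξ) :=
  (Measure.measurePreserving_neg (volume : Measure Space)).quasiMeasurePreserving.ae h

theorem locallyIntegrable_two_pi_smul {g : Space → Vec} (hg : LocallyIntegrable g) :
    LocallyIntegrable fun ξ : Space => g ((2 * Real.pi) • ξ) := by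
  have h := locallyIntegrable_map_homeomorph
    (Homeomorph.smulOfNeZero (2 * Real.pi) two_pi_pos.ne' : Space ≃ₜ Space) (f := g)
    (μ := (volume : Measure Space))
  refine h.1 ?_
  have h2 : Measure.map (Homeomorph.smulOfNeZero (2 * Real.pi) two_pi_pos.ne' : Space ≃ₜ Space)
      (volume : Measure Space) = ENNReal.ofReal |((2 * Real.pi) ^ 3)⁻¹| • volume := by
    have := Measure.map_addHaar_smul (volume : Measure Space) two_pi_pos.ne'
    rw [finrank_euclideanSpace_fin] at this
    exact this
  rw [h2]
  intro x
  obtain ⟨s, hs, hi⟩ := hg x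
  refine ⟨s, hs, ?_⟩
  rw [IntegrableOn, Measure.restrict_smul]
  exact Integrable.smul_measure hi ENNReal.ofReal_ne_top

section Fourier

variable {f f' : Field} {g g' : Space → Vec}

theorem ae_eq_zero_of_forall_schwartz {F : Type*} [NormedAddCommGroup F] [NormedSpace ℂ F]
    [CompleteSpace F] {d : Space → F} (hd : LocallyIntegrable d)
    (h : ∀ ψ : 𝓢(Space, ℂ), HasCompactSupport ψ → ∫ ξ, ψ ξ • d ξ = 0) : ∀ᵐ ξ, d ξ = 0 := by
  refine ae_eq_zero_of_integral_contDiff_smul_eq_zero hd fun χ hχ hc => ?_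
  have h1 : HasCompactSupport (Complex.ofRealCLM ∘ χ) := hc.comp_left rfl
  have h2 : ContDiff ℝ ((⊤ : ℕ∞) : WithTop ℕ∞) (Complex.ofRealCLM ∘ χ) := by fun_prop
  have h3 := h (h1.toSchwartzMap h2) h1
  simpa using h3

theorem HasFourier.congr (h : HasFourier f g) (hgg' : g =ᵐ[volume] g') : HasFourier f g' := by
  refine ⟨h.1.congr hgg', fun φ => ?_⟩
  have e : (fun ξ : Space => φ ξ • g ((2 * Real.pi) • ξ)) =ᵐ[volume]
      fun ξ : Space => φ ξ • g' ((2 * Real.pi) • ξ) := by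
    filter_upwards [ae_two_pi_smul hgg'] with ξ hξ
    rw [hξ]
  exact ⟨(h.2 φ).1.congr e, (h.2 φ).2.trans (integral_congr_ae e)⟩

theorem HasFourier.ae_eq (h : HasFourier f g) (h' : HasFourier f g') : g =ᵐ[volume] g' := by
  refine ae_of_ae_two_pi_smul ?_
  have h1 := ae_eq_zero_of_forall_schwartz
    ((locallyIntegrable_two_pi_smul h.1).sub (locallyIntegrable_two_pi_smul h'.1)) fun ψ _ => by
      simp only [Pi.sub_apply, smul_sub]
      rw [integral_sub (h.2 ψ).1 (h'.2 ψ).1, ← (h.2 ψ).2, ← (h'.2 ψ).2, sub_self]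
  filter_upwards [h1] with ξ hξ
  exact sub_eq_zero.1 hξ

theorem HasFourier.field_eq (h : HasFourier f g) (h' : HasFourier f' g) : f = f' := by
  have : 𝓕 f = 𝓕 f' := by
    ext1 φ
    rw [(h.2 φ).2, (h'.2 φ).2]
  have h1 : 𝓕⁻ (𝓕 f) = f := FourierTransform.fourierInv_fourier_eq f
  have h2 : 𝓕⁻ (𝓕 f') = f' := FourierTransform.fourierInv_fourier_eq f'
  rw [← h1, this, h2]

/-! ### Functions in `Ḣ^{1/2}` as Fourier transforms of tempered distributions. -/

theorem lintegral_enorm_inv_ball_lt_top (R : ℝ) :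
    ∫⁻ ξ in Metric.ball (0 : Space) R, ‖ξ‖ₑ⁻¹ < ∞ := by
  have h : IntegrableOn (fun ξ : Space => ‖ξ‖⁻¹) (Metric.ball 0 R) := by
    rw [integrableOn_fun_norm_addHaar volume (f := fun y : ℝ => y⁻¹)]
    have h1 : IntegrableOn (fun y : ℝ => y) (Set.Ioo 0 R) :=
      (continuous_id.integrableOn_Icc (a := 0) (b := R)).mono_set Set.Ioo_subset_Icc_self
    refine h1.congr_fun (fun y hy => ?_) measurableSet_Ioo
    have : 0 < y := hy.1
    simp only [finrank_euclideanSpace_fin, smul_eq_mul]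
    field_simp
  have h2 := h.hasFiniteIntegral
  rw [hasFiniteIntegral_iff_enorm] at h2
  refine lt_of_eq_of_lt (lintegral_congr_ae ?_) h2
  filter_upwards [ae_restrict_of_ae enorm_ne_zero_ae] with η hη
  have hη' : 0 < ‖η‖ := by simpa using hη
  rw [Real.enorm_eq_ofReal (by positivity), ENNReal.ofReal_inv_of_pos hη', ofReal_norm]

/-- A form of Young's inequality: according to whether `a b ≥ 1`, one of the two terms suffices.
With `a = |ξ|` it reduces local integrability of an `Ḣ^{1/2}` spectrum to that of `|ξ|⁻¹`. -/
theorem le_inv_add_mul_sq (a b : ℝ≥0∞) :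
    b ≤ a⁻¹ + a * b ^ 2 := by
  rcases le_total 1 (a * b) with h | h
  · calc b = 1 * b := (one_mul b).symm
      _ ≤ a * b * b := by gcongr
      _ = a * b ^ 2 := by ring
      _ ≤ _ := le_add_self
  · refine le_trans ?_ le_self_add
    rwa [ENNReal.le_inv_iff_mul_le, mul_comm]

theorem integrableOn_ball_of_hdot (hg : Measurable g) (hH : ∫⁻ ξ, ‖ξ‖ₑ * ‖g ξ‖ₑ ^ 2 < ∞) (R : ℝ) :
    IntegrableOn g (Metric.ball 0 R) := by
  refine ⟨hg.aestronglyMeasurable, ?_⟩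
  calc ∫⁻ ξ in Metric.ball 0 R, ‖g ξ‖ₑ
      ≤ ∫⁻ ξ in Metric.ball 0 R, (‖ξ‖ₑ⁻¹ + ‖ξ‖ₑ * ‖g ξ‖ₑ ^ 2) := by
        exact lintegral_mono fun ξ => le_inv_add_mul_sq _ _
    _ = (∫⁻ ξ in Metric.ball (0 : Space) R, ‖ξ‖ₑ⁻¹) +
          ∫⁻ ξ in Metric.ball 0 R, ‖ξ‖ₑ * ‖g ξ‖ₑ ^ 2 := lintegral_add_left (by fun_prop) _
    _ < ∞ := ENNReal.add_lt_top.2 ⟨lintegral_enorm_inv_ball_lt_top R,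
        (setLIntegral_le_lintegral _ _).trans_lt hH⟩

theorem locallyIntegrable_of_hdot (hg : Measurable g) (hH : ∫⁻ ξ, ‖ξ‖ₑ * ‖g ξ‖ₑ ^ 2 < ∞) :
    LocallyIntegrable g := by
  intro x
  refine ⟨Metric.ball 0 (‖x‖ + 1), Metric.isOpen_ball.mem_nhds (by simp),
    integrableOn_ball_of_hdot hg hH _⟩

/-- A function in the homogeneous Sobolev space of order `1 / 2` is a Fourier transform. -/
theorem exists_hasFourier (hg : Measurable g) (hH : ∫⁻ ξ, ‖ξ‖ₑ * ‖g ξ‖ₑ ^ 2 < ∞) :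
    ∃ f : Field, HasFourier f g := by
  set G : Space → Vec := fun ξ => g ((2 * Real.pi) • ξ) with hG
  have hGm : Measurable G := hg.comp (by fun_prop)
  have hGH : ∫⁻ ξ, ‖ξ‖ₑ * ‖G ξ‖ₑ ^ 2 < ∞ := by
    have h := lintegral_comp_smul (fun ξ => ‖ξ‖ₑ * ‖g ξ‖ₑ ^ 2) two_pi_pos
    have h2 : ∫⁻ ξ, ‖ξ‖ₑ * ‖G ξ‖ₑ ^ 2 ≤
        ∫⁻ ξ : Space, ‖(2 * Real.pi) • ξ‖ₑ * ‖g ((2 * Real.pi) • ξ)‖ₑ ^ 2 := by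
      refine lintegral_mono fun ξ => ?_
      rw [enorm_smul]
      gcongr
      refine le_mul_of_one_le_left' ?_
      rw [Real.enorm_eq_ofReal two_pi_pos.le, ENNReal.one_le_ofReal]
      linarith [Real.pi_gt_three]
    refine h2.trans_lt ?_
    rw [h]
    exact ENNReal.mul_lt_top (by simp) hH
  -- Low frequencies form an `L¹` function, and high frequencies an `L²` function because `|ξ| ≥ 1`
  -- there; both define tempered distributions.
  set B : Set Space := Metric.ball 0 1
  have hB : MeasurableSet B := measurableSet_ball
  have h1 : MemLp (B.indicator G) 1 := by
    rw [memLp_one_iff_integrable, integrable_indicator_iff hB]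
    exact integrableOn_ball_of_hdot hGm hGH 1
  have h2 : MemLp (Bᶜ.indicator G) 2 := by
    refine ⟨(hGm.indicator hB.compl).aestronglyMeasurable, ?_⟩
    rw [eLpNorm_lt_top_iff_lintegral_rpow_enorm_lt_top (by simp) (by simp)]
    refine lt_of_le_of_lt (lintegral_mono fun ξ => ?_) hGH
    by_cases hξ : ξ ∈ B
    · simp [hξ]
    · have h1 : (1 : ℝ≥0∞) ≤ ‖ξ‖ₑ := by
        rw [← ofReal_norm, ENNReal.one_le_ofReal]
        simpa [B] using hξ
      have : ξ ∈ Bᶜ := hξ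
      rw [Set.indicator_of_mem this]
      simp only [ENNReal.toReal_ofNat, ENNReal.rpow_ofNat]
      exact le_mul_of_one_le_left' h1
  refine ⟨𝓕⁻ (Lp.toTemperedDistribution (h1.toLp _) + Lp.toTemperedDistribution (h2.toLp _)),
    locallyIntegrable_of_hdot hg hH, fun φ => ?_⟩
  have i1 : Integrable fun ξ => φ ξ • B.indicator G ξ :=
    memLp_one_iff_integrable.1 (MemLp.smul (p := ∞) (q := 1) h1 (φ.memLp ∞ volume))
  have i2 : Integrable fun ξ => φ ξ • Bᶜ.indicator G ξ :=
    memLp_one_iff_integrable.1 (MemLp.smul (p := 2) (q := 2) h2 (φ.memLp 2 volume))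
  have e : (fun ξ => φ ξ • G ξ) =
      fun ξ => φ ξ • B.indicator G ξ + φ ξ • Bᶜ.indicator G ξ := by
    ext1 ξ
    rw [← smul_add, ← Pi.add_apply (B.indicator G), Set.indicator_self_add_compl]
  refine ⟨by change Integrable (fun ξ => φ ξ • G ξ); rw [e]; exact i1.add i2, ?_⟩
  rw [FourierTransform.fourier_fourierInv_eq]
  change Lp.toTemperedDistribution (h1.toLp _) φ + Lp.toTemperedDistribution (h2.toLp _) φ =
    ∫ ξ, φ ξ • G ξ
  rw [e, integral_add i1 i2, Lp.toTemperedDistribution_apply, Lp.toTemperedDistribution_apply]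
  congr 1
  · refine integral_congr_ae ?_
    filter_upwards [h1.coeFn_toLp] with ξ hξ
    rw [hξ]
  · refine integral_congr_ae ?_
    filter_upwards [h2.coeFn_toLp] with ξ hξ
    rw [hξ]

/-! ### Real and divergence-free fields on the Fourier side -/

theorem fourier_conj_of_neg {ψ : Space → ℂ} (hψ : ∀ ξ, ψ (-ξ) = (starRingEnd ℂ) (ψ ξ))
    (x : Space) : (starRingEnd ℂ) (𝓕 ψ x) = 𝓕 ψ x := by
  rw [Real.fourier_eq', ← integral_conj, ← integral_neg_eq_self]
  refine integral_congr_ae (ae_of_all _ fun ξ => ?_)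
  simp only [smul_eq_mul, map_mul, hψ, ← Complex.exp_conj, Complex.conj_I, Complex.conj_ofReal,
    inner_neg_left, RingHomCompTriple.comp_apply, RingHom.id_apply]
  congr 2
  push_cast
  ring

theorem im_eq_zero_of_conj_eq {z : ℂ} (h : (starRingEnd ℂ) z = z) : z.im = 0 :=
  Complex.conj_eq_iff_im.1 h

theorem fourierInv_neg_of_real {φ : 𝓢(Space, ℂ)} (hφ : ∀ x, (φ x).im = 0) (ξ : Space) :
    (𝓕⁻ φ) (-ξ) = (starRingEnd ℂ) ((𝓕⁻ φ) ξ) := by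
  rw [SchwartzMap.fourierInv_coe, Real.fourierInv_eq', Real.fourierInv_eq', ← integral_conj]
  refine integral_congr_ae (ae_of_all _ fun x => ?_)
  have hx : (starRingEnd ℂ) (φ x) = φ x := Complex.conj_eq_iff_im.2 (hφ x)
  simp only [smul_eq_mul, map_mul, hx, ← Complex.exp_conj, Complex.conj_I, Complex.conj_ofReal,
    inner_neg_right]
  congr 2
  push_cast
  ring

theorem conj_integral_smul {ψ : Space → ℂ} (hψ : ∀ ξ, ψ (-ξ) = (starRingEnd ℂ) (ψ ξ))
    (G : Space → Vec) :
    conjVec (∫ ξ, ψ ξ • G ξ) = ∫ ξ, ψ ξ • conjVec (G (-ξ)) := by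
  have h1 : conjVec (∫ ξ, ψ ξ • G ξ) = ∫ ξ, conjVec (ψ ξ • G ξ) :=
    (conjVec.toContinuousLinearEquiv.integral_comp_comm _).symm
  rw [h1, ← integral_neg_eq_self]
  refine integral_congr_ae (ae_of_all _ fun ξ => ?_)
  simp only [conjVec_smul, hψ, RingHomCompTriple.comp_apply, RingHom.id_apply]

theorem HasFourier.isReal (h : HasFourier f g) (hg : ∀ᵐ ξ, g (-ξ) = conjVec (g ξ)) : IsReal f := by
  intro φ hφ j
  have h1 : f φ = ∫ ξ : Space, (𝓕⁻ φ) ξ • g ((2 * Real.pi) • ξ) := by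
    rw [← (h.2 _).2, TemperedDistribution.fourier_apply, FourierTransform.fourier_fourierInv_eq]
  have h2 : conjVec (f φ) = f φ := by
    rw [h1, conj_integral_smul (fourierInv_neg_of_real hφ)]
    refine integral_congr_ae ?_
    filter_upwards [ae_two_pi_smul hg] with ξ hξ
    rw [smul_neg, hξ]
    congr 1
    ext j
    simp
  refine im_eq_zero_of_conj_eq ?_
  rw [← conjVec_apply, h2]

theorem locallyIntegrable_conj_neg {G : Space → Vec} (hG : LocallyIntegrable G) :
    LocallyIntegrable fun ξ => conjVec (G (-ξ)) := by
  have h := locallyIntegrable_map_homeomorph (Homeomorph.neg Space) (f := G)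
    (μ := (volume : Measure Space))
  have h1 : LocallyIntegrable (G ∘ Homeomorph.neg Space) := by
    refine h.1 ?_
    have : Measure.map (Homeomorph.neg Space) (volume : Measure Space) = volume :=
      (Measure.measurePreserving_neg (volume : Measure Space)).map_eq
    rwa [this]
  refine h1.mono ?_ (ae_of_all _ fun ξ => ?_)
  · exact conjVec.continuous.comp_aestronglyMeasurable h1.aestronglyMeasurable
  · simp

/-- A Hermitian test function has a real Fourier transform, so reality of `f` makes the pairing of
`f̂` with it real. This tests the defect of Hermitian symmetry against all Hermitian functions,
which turn out to be enough. -/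
theorem HasFourier.ae_neg_eq_conj (h : HasFourier f g) (hf : IsReal f) :
    ∀ᵐ ξ, g (-ξ) = conjVec (g ξ) := by
  set G : Space → Vec := fun ξ => g ((2 * Real.pi) • ξ) with hG
  have hGl : LocallyIntegrable G := locallyIntegrable_two_pi_smul h.1
  have hGl' := locallyIntegrable_conj_neg hGl
  have hdl : LocallyIntegrable fun ξ => G ξ - conjVec (G (-ξ)) := hGl.sub hGl'
  have key : ∀ ψ : 𝓢(Space, ℂ), HasCompactSupport ψ →
      (∀ ξ, ψ (-ξ) = (starRingEnd ℂ) (ψ ξ)) → ∫ ξ, ψ ξ • (G ξ - conjVec (G (-ξ))) = 0 := by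
    intro ψ hc hψ
    have e1 : conjVec (∫ ξ, ψ ξ • G ξ) = ∫ ξ, ψ ξ • G ξ := by
      rw [← (h.2 ψ).2, TemperedDistribution.fourier_apply]
      ext j
      rw [conjVec_apply, Complex.conj_eq_iff_im]
      refine hf (𝓕 ψ) (fun x => im_eq_zero_of_conj_eq ?_) j
      rw [SchwartzMap.fourier_coe]
      exact fourier_conj_of_neg hψ x
    have e2 := conj_integral_smul hψ G
    simp only [smul_sub]
    rw [integral_sub (hGl.integrable_smul_left_of_hasCompactSupport ψ.continuous hc)
      (hGl'.integrable_smul_left_of_hasCompactSupport ψ.continuous hc), ← e2, e1, sub_self]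
  have h0 : ∀ᵐ ξ, G ξ - conjVec (G (-ξ)) = 0 := by
    refine ae_eq_zero_of_integral_contDiff_smul_eq_zero hdl fun χ hχ hc => ?_
    have hcn : HasCompactSupport fun ξ => χ (-ξ) := hc.comp_homeomorph (Homeomorph.neg Space)
    -- A real `χ` is a complex combination of two Hermitian functions: twice its even part, and `i`
    -- times twice its odd part.
    have c1 : HasCompactSupport fun ξ => ((χ ξ + χ (-ξ) : ℝ) : ℂ) :=
      (hc.add hcn).comp_left (g := fun x : ℝ => (x : ℂ)) rfl
    have c2 : HasCompactSupport fun ξ => Complex.I * ((χ ξ - χ (-ξ) : ℝ) : ℂ) :=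
      (hc.sub hcn).comp_left (g := fun x : ℝ => Complex.I * (x : ℂ)) (by simp)
    have d1 : ContDiff ℝ ((⊤ : ℕ∞) : WithTop ℕ∞) fun ξ => ((χ ξ + χ (-ξ) : ℝ) : ℂ) :=
      Complex.ofRealCLM.contDiff.comp (hχ.add (hχ.comp contDiff_neg))
    have d2 : ContDiff ℝ ((⊤ : ℕ∞) : WithTop ℕ∞)
        fun ξ => Complex.I * ((χ ξ - χ (-ξ) : ℝ) : ℂ) :=
      contDiff_const.mul (Complex.ofRealCLM.contDiff.comp (hχ.sub (hχ.comp contDiff_neg)))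
    have k1 := key (c1.toSchwartzMap d1) c1 fun ξ => by
      simp [add_comm]
    have k2 := key (c2.toSchwartzMap d2) c2 fun ξ => by
      simp
      ring
    simp only [HasCompactSupport.toSchwartzMap_toFun] at k1 k2
    have i1 := hdl.integrable_smul_left_of_hasCompactSupport d1.continuous c1
    have i2 := hdl.integrable_smul_left_of_hasCompactSupport d2.continuous c2
    have i3 : Integrable fun ξ => Complex.I •
      ((Complex.I * ((χ ξ - χ (-ξ) : ℝ) : ℂ)) • (G ξ - conjVec (G (-ξ)))) := i2.smul Complex.I
    have e : ∀ ξ, χ ξ • (G ξ - conjVec (G (-ξ))) = (1 / 2 : ℂ) •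
        ((((χ ξ + χ (-ξ) : ℝ) : ℂ) • (G ξ - conjVec (G (-ξ)))) -
        Complex.I • ((Complex.I * ((χ ξ - χ (-ξ) : ℝ) : ℂ)) • (G ξ - conjVec (G (-ξ))))) := by
      intro ξ
      rw [smul_smul Complex.I, ← sub_smul, smul_smul, ← Complex.coe_smul]
      congr 1
      push_cast
      linear_combination (1 / 2 : ℂ) * (χ ξ - χ (-ξ)) * Complex.I_sq
    simp_rw [e]
    rw [integral_smul, integral_sub i1 i3, integral_smul, k1, k2]
    simp
  have h1 : ∀ᵐ ξ, G (-ξ) = conjVec (G ξ) := by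
    filter_upwards [h0] with ξ hξ
    rw [sub_eq_zero.1 hξ]
    ext j
    simp
  have h2 : ∀ᵐ ξ : Space, g (-((2 * Real.pi) • ξ)) = conjVec (g ((2 * Real.pi) • ξ)) := by
    filter_upwards [h1] with ξ hξ
    rw [← smul_neg]
    exact hξ
  exact ae_of_ae_two_pi_smul h2

/-- Pairing the divergence with `𝓕 ψ` moves the transform onto the distribution, where each
derivative becomes multiplication by `2πi ξⱼ`. Both directions of the Fourier characterization of
divergence-free fields follow. -/
theorem HasFourier.sum_lineDeriv (h : HasFourier f g) (ψ : 𝓢(Space, ℂ)) :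
    ∑ j : Fin 3, (∂_{(EuclideanSpace.single j (1 : ℝ) : Space)} f : Field) (𝓕 ψ) j =
      2 * Real.pi * Complex.I *
        ∫ ξ : Space, ψ ξ * dotForm ξ (g ((2 * Real.pi) • ξ)) := by
  have h1 : ∀ j : Fin 3, (fun ξ : Space => inner ℝ ξ (EuclideanSpace.single j (1 : ℝ) : Space)) =
      fun ξ : Space => ξ j := fun j => by
    ext ξ
    simp [EuclideanSpace.inner_single_right]
  have htg : ∀ j : Fin 3, (fun ξ : Space => ((ξ j : ℝ) : ℂ)).HasTemperateGrowth := fun j =>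
    (Complex.ofRealCLM.comp (EuclideanSpace.proj (𝕜 := ℝ) j)).hasTemperateGrowth
  have h2 : ∀ j : Fin 3,
      (∂_{(EuclideanSpace.single j (1 : ℝ) : Space)} f : Field) (𝓕 ψ) j =
      2 * Real.pi * Complex.I * ∫ ξ : Space, ψ ξ * ((ξ j : ℂ) * g ((2 * Real.pi) • ξ) j) ∧
      Integrable fun ξ : Space => ψ ξ * ((ξ j : ℂ) * g ((2 * Real.pi) • ξ) j) := by
    intro j
    obtain ⟨hi, he⟩ := h.2 (SchwartzMap.smulLeftCLM ℂ (fun ξ : Space => ((ξ j : ℝ) : ℂ)) ψ)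
    simp only [SchwartzMap.smulLeftCLM_apply_apply (htg j)] at hi he
    have ei : ∀ ξ : Space, ((((ξ j : ℝ) : ℂ) • ψ ξ) • g ((2 * Real.pi) • ξ)) j =
        ψ ξ * ((ξ j : ℂ) * g ((2 * Real.pi) • ξ) j) := fun ξ => by
      simp only [PiLp.smul_apply, smul_eq_mul]; ring
    have hij : Integrable fun ξ : Space => ψ ξ * ((ξ j : ℂ) * g ((2 * Real.pi) • ξ) j) :=
      ((EuclideanSpace.proj (𝕜 := ℂ) j : Vec →L[ℂ] ℂ).integrable_comp hi).congr (ae_of_all _ ei)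
    have hj := ((EuclideanSpace.proj (𝕜 := ℂ) j : Vec →L[ℂ] ℂ).integral_comp_comm hi).symm.trans
      (integral_congr_ae (ae_of_all _ ei))
    refine ⟨?_, hij⟩
    have h3 := congrArg (fun F : Field => F ψ j)
      (TemperedDistribution.fourier_lineDerivOp_eq f (EuclideanSpace.single j (1 : ℝ) : Space))
    rw [← hj, ← he]
    simpa [EuclideanSpace.inner_single_right] using h3
  simp_rw [dotForm_apply, Finset.mul_sum]
  rw [integral_finsetSum _ fun j _ => (h2 j).2, Finset.mul_sum]
  exact Finset.sum_congr rfl fun j _ => (h2 j).1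

theorem dotForm_smul (c : ℝ) (ξ : Space) (a : Vec) : dotForm (c • ξ) a = c * dotForm ξ a := by
  simp only [dotForm_apply, PiLp.smul_apply, smul_eq_mul, Complex.ofReal_mul, mul_assoc,
    Finset.mul_sum]

theorem HasFourier.isDivFree (h : HasFourier f g) (hg : ∀ᵐ ξ, dotForm ξ (g ξ) = 0) :
    IsDivFree f := by
  intro φ
  have h1 := h.sum_lineDeriv (𝓕⁻ φ)
  rw [FourierTransform.fourier_fourierInv_eq] at h1
  rw [h1, integral_eq_zero_of_ae, mul_zero]
  filter_upwards [ae_two_pi_smul hg] with ξ hξ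
  rw [dotForm_smul] at hξ
  have h2 : ((2 * Real.pi : ℝ) : ℂ) ≠ 0 := by exact_mod_cast two_pi_pos.ne'
  rw [(mul_eq_zero.1 hξ).resolve_left h2, mul_zero, Pi.zero_apply]

theorem HasFourier.ae_dotForm_eq_zero (h : HasFourier f g) (hf : IsDivFree f) :
    ∀ᵐ ξ, dotForm ξ (g ξ) = 0 := by
  refine ae_of_ae_two_pi_smul ?_
  have hG := locallyIntegrable_two_pi_smul h.1
  have hd : LocallyIntegrable fun ξ : Space => dotForm ξ (g ((2 * Real.pi) • ξ)) := by
    simp only [dotForm_apply]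
    refine locallyIntegrable_finsetSum _ fun j _ => ?_
    have hj : LocallyIntegrable fun ξ : Space => g ((2 * Real.pi) • ξ) j := by
      refine hG.mono ?_ (ae_of_all _ fun ξ => PiLp.norm_apply_le _ j)
      exact (EuclideanSpace.proj (𝕜 := ℂ) j).continuous.comp_aestronglyMeasurable
        hG.aestronglyMeasurable
    have hc : Continuous fun ξ : Space => ((ξ j : ℝ) : ℂ) :=
      Complex.continuous_ofReal.comp (EuclideanSpace.proj (𝕜 := ℝ) j).continuous
    rw [← locallyIntegrableOn_univ] at hj ⊢
    exact hj.continuousOn_mul hc.continuousOn isOpen_univ.isLocallyClosed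
  have h1 := ae_eq_zero_of_forall_schwartz hd fun ψ _ => by
    have h2 := h.sum_lineDeriv ψ
    rw [hf] at h2
    have h3 : (2 * Real.pi * Complex.I : ℂ) ≠ 0 := by
      simp [Real.pi_ne_zero]
    exact (mul_eq_zero.1 h2.symm).resolve_left h3
  filter_upwards [h1] with ξ hξ
  rw [dotForm_smul, hξ, mul_zero]

end Fourier

/-! ### Uniqueness -/

/-- With `w = g - p`, use `g ⊗ g - p ⊗ p = w ⊗ w + w ⊗ p + p ⊗ w`. No factor `g` remains, so
smallness will be needed for `p` only. -/
theorem tensorHat_sub_le {g p : Space → Vec} (hg : Measurable g) (hp : Measurable p) {ξ : Space}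
    {j k : Fin 3} (hgi : Integrable fun η : Space => g (ξ - η) j * g η k)
    (hpi : Integrable fun η : Space => p (ξ - η) j * p η k) :
    ‖tensorHat₂ g g j k ξ - tensorHat₂ p p j k ξ‖ₑ ≤
      conv (fun η => ‖g η - p η‖ₑ) (fun η => ‖g η - p η‖ₑ) ξ +
        (conv (fun η => ‖g η - p η‖ₑ) (fun η => ‖p η‖ₑ) ξ +
          conv (fun η => ‖p η‖ₑ) (fun η => ‖g η - p η‖ₑ) ξ) := by
  unfold tensorHat₂
  rw [← mul_sub, ← integral_sub hgi hpi, enorm_mul]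
  calc _ ≤ 1 * ∫⁻ η : Space, ‖g (ξ - η) j * g η k - p (ξ - η) j * p η k‖ₑ :=
        mul_le_mul' (by simpa using enorm_two_pi_pow_inv_le) (enorm_integral_le_lintegral_enorm _)
    _ ≤ ∫⁻ η : Space, (‖g (ξ - η) - p (ξ - η)‖ₑ * ‖g η - p η‖ₑ +
          (‖g (ξ - η) - p (ξ - η)‖ₑ * ‖p η‖ₑ + ‖p (ξ - η)‖ₑ * ‖g η - p η‖ₑ)) := by
      rw [one_mul]
      refine lintegral_mono fun η => ?_
      have e : g (ξ - η) j * g η k - p (ξ - η) j * p η k =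
          (g (ξ - η) - p (ξ - η)) j * (g η - p η) k +
          ((g (ξ - η) - p (ξ - η)) j * p η k + p (ξ - η) j * (g η - p η) k) := by
        simp only [PiLp.sub_apply]; ring
      rw [e]
      refine (enorm_add_le _ _).trans (add_le_add ?_ ((enorm_add_le _ _).trans
        (add_le_add ?_ ?_))) <;>
      · rw [enorm_mul]
        exact mul_le_mul' (enorm_apply_le _ _) (enorm_apply_le _ _)
    _ = _ := by
      unfold conv
      rw [lintegral_add_left (by fun_prop), lintegral_add_left (by fun_prop)]

/-- The equation of mild solutions on the Fourier side. -/
def MildEquation (g₀ : Space → Vec) (g : ℝ → Space → Vec) : Prop :=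
  ∀ t, 0 ≤ t → ∀ᵐ ξ : Space,
    (∀ᵐ s : ℝ, s ∈ Set.Icc 0 t →
      ∀ j k, Integrable (fun η : Space => g s (ξ - η) j * g s η k)) ∧
    IntervalIntegrable (duhamelIntegrand g t ξ) volume 0 t ∧
    g t ξ = (Real.exp (-t * ‖ξ‖ ^ 2) : ℂ) • g₀ ξ - ∫ s in (0 : ℝ)..t, duhamelIntegrand g t ξ s

/-- The majorant of the difference of two bilinear terms. -/
def differenceMajorant (f b : ℝ → Space → ℝ≥0∞) (t : ℝ) (ξ : Space) : ℝ≥0∞ :=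
  duhamelMajorant bilinearConst f f t ξ +
    (duhamelMajorant bilinearConst f b t ξ + duhamelMajorant bilinearConst b f t ξ)

theorem duhamelIntegrand_sub_le {g p : ℝ → Space → Vec} (hg : Measurable (Function.uncurry g))
    (hp : Measurable (Function.uncurry p)) {s t : ℝ} (hst : s ≤ t) {ξ : Space}
    (hgi : ∀ j k, Integrable fun η : Space => g s (ξ - η) j * g s η k)
    (hpi : ∀ j k, Integrable fun η : Space => p s (ξ - η) j * p s η k) :
    ‖duhamelIntegrand g t ξ s - duhamelIntegrand p t ξ s‖ₑ ≤
      heat (t - s) ξ * (bilinearConst * ‖ξ‖ₑ *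
        (conv (fun η => ‖g s η - p s η‖ₑ) (fun η => ‖g s η - p s η‖ₑ) ξ +
        (conv (fun η => ‖g s η - p s η‖ₑ) (fun η => ‖p s η‖ₑ) ξ +
          conv (fun η => ‖p s η‖ₑ) (fun η => ‖g s η - p s η‖ₑ) ξ))) := by
  rw [duhamelIntegrand_eq, duhamelIntegrand_eq, duhamelIntegrand₂, duhamelIntegrand₂, ← smul_sub,
    ← map_sub, enorm_smul, enorm_ofReal_complex (Real.exp_pos _).le]
  refine mul_le_mul' (exp_le_heat (sub_nonneg.2 hst) ξ) ?_
  have hgs : Measurable (g s) := hg.comp measurable_prodMk_left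
  have hps : Measurable (p s) := hp.comp measurable_prodMk_left
  refine (enorm_projDiv_le fun k j => tensorHat_sub_le hgs hps (hgi k j) (hpi k j)).trans ?_
  rw [← mul_assoc]
  gcongr
  norm_num

theorem differenceMajorant_eq {f b : ℝ → Space → ℝ≥0∞} (hf : Measurable (Function.uncurry f))
    (hb : Measurable (Function.uncurry b)) (t : ℝ) (ξ : Space) :
    differenceMajorant f b t ξ = ∫⁻ s in Set.Ioo 0 t, heat (t - s) ξ * (bilinearConst * ‖ξ‖ₑ *
      (conv (f s) (f s) ξ + (conv (f s) (b s) ξ + conv (b s) (f s) ξ))) := by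
  have hheat : Measurable fun s => heat (t - s) ξ :=
    measurable_heat.comp (f := fun s : ℝ => (t - s, ξ)) (by fun_prop)
  have m1 : Measurable fun s => heat (t - s) ξ * (bilinearConst * ‖ξ‖ₑ * conv (f s) (f s) ξ) :=
    hheat.mul (((measurable_conv hf hf).comp measurable_prodMk_right).const_mul _)
  have m2 : Measurable fun s => heat (t - s) ξ * (bilinearConst * ‖ξ‖ₑ * conv (f s) (b s) ξ) :=
    hheat.mul (((measurable_conv hf hb).comp measurable_prodMk_right).const_mul _)
  simp only [mul_add]
  rw [lintegral_add_left m1, lintegral_add_left m2]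
  unfold differenceMajorant duhamelMajorant
  rfl

theorem enorm_sub_le_differenceMajorant {g₀ p₀ : Space → Vec} {g p : ℝ → Space → Vec}
    (hg : Measurable (Function.uncurry g)) (hp : Measurable (Function.uncurry p))
    (h₀ : g₀ =ᵐ[volume] p₀) (hge : MildEquation g₀ g) (hpe : MildEquation p₀ p) {t : ℝ}
    (ht : 0 ≤ t) :
    ∀ᵐ ξ, ‖g t ξ - p t ξ‖ₑ ≤
      differenceMajorant (fun s η => ‖g s η - p s η‖ₑ) (fun s η => ‖p s η‖ₑ) t ξ := by
  filter_upwards [h₀, hge t ht, hpe t ht] with ξ h0 ⟨g1, g2, g3⟩ ⟨p1, p2, p3⟩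
  have hf : Measurable (Function.uncurry fun s η => ‖g s η - p s η‖ₑ) := (hg.sub hp).enorm
  have hb : Measurable (Function.uncurry fun s η => ‖p s η‖ₑ) := hp.enorm
  rw [g3, p3, h0, sub_sub_sub_cancel_left, ← intervalIntegral.integral_sub p2 g2,
    intervalIntegral.integral_of_le ht]
  refine (enorm_integral_le_lintegral_enorm _).trans ?_
  rw [← restrict_Ioo_eq_restrict_Ioc]
  rw [differenceMajorant_eq hf hb]
  refine lintegral_mono_ae ?_
  filter_upwards [ae_restrict_of_ae g1, ae_restrict_of_ae p1,
    ae_restrict_mem measurableSet_Ioo] with s g1 p1 hs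
  have hs' : s ∈ Set.Icc 0 t := Set.Ioo_subset_Icc_self hs
  rw [enorm_sub_rev]
  exact duhamelIntegrand_sub_le hg hp hs.2.le (g1 hs') (p1 hs')

/-- Restriction to the times before `T`. -/
def truncate (T : ℝ) (f : ℝ → Space → ℝ≥0∞) (t : ℝ) (ξ : Space) : ℝ≥0∞ :=
  (Set.Iio T).indicator (fun t => f t ξ) t

theorem measurable_truncate (T : ℝ) {f : ℝ → Space → ℝ≥0∞} (hf : Measurable (Function.uncurry f)) :
    Measurable (Function.uncurry (truncate T f)) := by
  have : Function.uncurry (truncate T f) =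
      {q : ℝ × Space | q.1 < T}.indicator (Function.uncurry f) := by
    ext ⟨t, ξ⟩
    simp only [Function.uncurry, truncate, Set.indicator, Set.mem_Iio]
    rfl
  rw [this]
  exact hf.indicator (measurableSet_lt measurable_fst measurable_const)

theorem truncate_le (T : ℝ) (f : ℝ → Space → ℝ≥0∞) (t : ℝ) (ξ : Space) :
    truncate T f t ξ ≤ f t ξ := Set.indicator_le_self _ _ _

theorem truncate_of_lt {T t : ℝ} (h : t < T) (f : ℝ → Space → ℝ≥0∞) (ξ : Space) :
    truncate T f t ξ = f t ξ := Set.indicator_of_mem (s := Set.Iio T) h _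

theorem truncate_of_le {T t : ℝ} (h : T ≤ t) (f : ℝ → Space → ℝ≥0∞) (ξ : Space) :
    truncate T f t ξ = 0 :=
  Set.indicator_of_notMem (s := Set.Iio T) (fun h' => absurd h (not_le.2 h')) _

/-- Causality: the Duhamel terms at time `t ≤ T` see only times before `T`. -/
theorem differenceMajorant_truncate_le {T t : ℝ} (h : t ≤ T) (f b : ℝ → Space → ℝ≥0∞) (ξ : Space) :
    differenceMajorant f b t ξ ≤ differenceMajorant (truncate T f) b t ξ := by
  have e : ∀ s ξ, s ∈ Set.Ioo 0 t → f s ξ ≤ truncate T f s ξ := fun s ξ hs =>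
    (truncate_of_lt (hs.2.trans_le h) f ξ).ge
  unfold differenceMajorant
  gcongr
  · exact duhamelMajorant_mono e e ξ
  · exact duhamelMajorant_mono e (fun _ _ _ => le_rfl) ξ
  · exact duhamelMajorant_mono (fun _ _ _ => le_rfl) e ξ

theorem timeFourth_truncate (T : ℝ) (f : ℝ → Space → ℝ≥0∞) (ξ : Space) :
    timeFourth (truncate T f) ξ =
      ∫⁻ t in Set.Ioi 0, (Set.Iio T).indicator (fun t => f t ξ ^ 4) t := by
  refine lintegral_congr fun t => ?_
  by_cases h : t < T <;> simp [truncate, h]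

/-- Dominated convergence: as the cutoff moves to `T`, the truncated integrand converges at every
time other than `T`. -/
theorem continuous_timeFourth_truncate {f : ℝ → Space → ℝ≥0∞}
    (hf : Measurable (Function.uncurry f)) {ξ : Space} (hfin : timeFourth f ξ ≠ ∞) :
    Continuous fun T => timeFourth (truncate T f) ξ := by
  have hf1 : Measurable fun s => f s ξ := hf.comp measurable_prodMk_right
  simp_rw [timeFourth_truncate]
  refine continuous_iff_continuousAt.2 fun T => ?_
  refine tendsto_lintegral_filter_of_dominated_convergence (fun t => f t ξ ^ 4)
    (Filter.Eventually.of_forall fun T' => (hf1.pow_const 4).indicator measurableSet_Iio)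
    (Filter.Eventually.of_forall fun T' => ae_of_all _ fun t => Set.indicator_le_self _ _ _)
    hfin ?_
  have hne : ∀ᵐ t ∂volume.restrict (Set.Ioi (0 : ℝ)), t ≠ T :=
    ae_restrict_of_ae (by simp [ae_iff])
  filter_upwards [hne] with t ht
  rcases lt_or_gt_of_ne ht with h | h
  · refine tendsto_const_nhds.congr' ?_
    filter_upwards [lt_mem_nhds h] with T' hT'
    simp [h, hT']
  · refine tendsto_const_nhds.congr' ?_
    filter_upwards [gt_mem_nhds h] with T' hT'
    simp [h.le, (show T' ≤ t from le_of_lt hT')]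

theorem timeFourth_lt_top_ae {f : ℝ → Space → ℝ≥0∞} (hf : Measurable (Function.uncurry f))
    (hfin : l4Sq f ≠ ∞) : ∀ᵐ ξ, timeFourth f ξ ≠ ∞ := by
  have hm := measurable_timeFourth hf
  filter_upwards [ae_lt_top (by fun_prop) hfin, enorm_ne_zero_ae] with ξ h1 h2 h3
  rw [h3, ENNReal.top_rpow_of_pos (by norm_num), ENNReal.mul_top (by simpa using h2)] at h1
  exact h1.ne rfl

theorem continuous_l4Sq_truncate {f : ℝ → Space → ℝ≥0∞} (hf : Measurable (Function.uncurry f))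
    (hfin : l4Sq f ≠ ∞) : Continuous fun T => l4Sq (truncate T f) := by
  refine continuous_iff_continuousAt.2 fun T => ?_
  refine tendsto_lintegral_filter_of_dominated_convergence
    (fun ξ => ‖ξ‖ₑ ^ 2 * timeFourth f ξ ^ (1 / 2 : ℝ))
    (Filter.Eventually.of_forall fun T' => ?_)
    (Filter.Eventually.of_forall fun T' => ae_of_all _ fun ξ => ?_) hfin ?_
  · have := measurable_timeFourth (measurable_truncate T' hf)
    fun_prop
  · have : timeFourth (truncate T' f) ξ ≤ timeFourth f ξ :=
      lintegral_mono fun t => pow_le_pow_left' (truncate_le T' f t ξ) 4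
    gcongr
  · filter_upwards [timeFourth_lt_top_ae hf hfin] with ξ hξ
    have h1 : Continuous fun T => timeFourth (truncate T f) ξ ^ (1 / 2 : ℝ) :=
      ENNReal.continuous_rpow_const.comp (continuous_timeFourth_truncate hf hξ)
    exact ((ENNReal.continuous_const_mul (by simp)).comp h1).continuousAt

/-- Small mild solutions are unique among all mild solutions in `L̃⁴(Ḣ¹)`. -/
theorem exists_uniqueness_threshold : ∃ θ : ℝ≥0∞, θ ≠ 0 ∧ ∀ (g₀ p₀ : Space → Vec)
    (g p : ℝ → Space → Vec), Measurable (Function.uncurry g) → Measurable (Function.uncurry p) →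
    g₀ =ᵐ[volume] p₀ → MildEquation g₀ g → MildEquation p₀ p →
    l4Sq (fun t ξ => ‖g t ξ‖ₑ) ≠ ∞ → l4Sq (fun t ξ => ‖p t ξ‖ₑ) ≠ ∞ →
    l4Sq (fun t ξ => ‖p t ξ‖ₑ) ≤ θ → ∀ t, 0 ≤ t → g t =ᵐ[volume] p t := by
  obtain ⟨C, hCt, hC⟩ := exists_prodSq_le
  set K : ℝ≥0∞ := 2 * bilinearConst ^ 2 * C with hK
  have hKt : K ≠ ∞ := by finiteness
  have hS : ∀ f h : ℝ → Space → ℝ≥0∞, Measurable (Function.uncurry f) →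
      Measurable (Function.uncurry h) →
      l4Sq (duhamelMajorant bilinearConst f h) ≤ K * (l4Sq f * l4Sq h) := by
    intro f h hf hh
    refine (l4Sq_duhamelMajorant_le hf hh).trans ?_
    rw [hK, mul_assoc _ C]
    gcongr
    exact hC f h hf hh
  -- The terms linear in the difference carry the coefficient `32 K` times the size of `p`; this
  -- threshold makes the coefficient at most `1/2`.
  refine ⟨(64 * K)⁻¹, ENNReal.inv_ne_zero.2 (by finiteness), ?_⟩
  intro g₀ p₀ g p hg hp h₀ hge hpe hgfin hpfin hsmall
  set f : ℝ → Space → ℝ≥0∞ := fun s η => ‖g s η - p s η‖ₑ with hf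
  set b : ℝ → Space → ℝ≥0∞ := fun s η => ‖p s η‖ₑ with hb
  have hfm : Measurable (Function.uncurry f) := (hg.sub hp).enorm
  have hbm : Measurable (Function.uncurry b) := hp.enorm
  have hffin : l4Sq f ≠ ∞ := by
    refine ((l4Sq_mono fun t ξ => ?_).trans_lt ((l4Sq_add_le (f := fun t ξ => ‖g t ξ‖ₑ)
      (h := b) hg.enorm).trans_lt ?_)).ne
    · exact enorm_sub_le
    · exact ENNReal.mul_lt_top (by simp) (ENNReal.add_lt_top.2 ⟨hgfin.lt_top, hpfin.lt_top⟩)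
  have hD := fun t (ht : 0 ≤ t) => enorm_sub_le_differenceMajorant hg hp h₀ hge hpe ht
  have hDm : ∀ T, Measurable (Function.uncurry (differenceMajorant (truncate T f) b)) := fun T => by
    have hT := measurable_truncate T hfm
    exact (measurable_duhamelMajorant _ hT hT).add
      ((measurable_duhamelMajorant _ hT hbm).add (measurable_duhamelMajorant _ hbm hT))
  set Φ : ℝ → ℝ≥0∞ := fun T => l4Sq (truncate T f) with hΦ
  have hΦfin : ∀ T, Φ T ≠ ∞ := fun T =>
    ((l4Sq_mono (truncate_le T f)).trans_lt hffin.lt_top).ne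
  have hΦle : ∀ T, Φ T ≤ 32 * K * Φ T * Φ T := by
    intro T
    have hT := measurable_truncate T hfm
    have h1 : Φ T ≤ l4Sq (differenceMajorant (truncate T f) b) := by
      refine l4Sq_mono_ae ?_
      have hset : MeasurableSet {q : ℝ × Space |
          truncate T f q.1 q.2 ≤ differenceMajorant (truncate T f) b q.1 q.2} :=
        measurableSet_le hT (hDm T)
      -- The equations hold at each time for almost every frequency, while the norm compares
      -- functions at each frequency for almost every time.
      refine (Measure.ae_ae_comm (μ := volume.restrict (Set.Ioi (0 : ℝ)))
        (ν := (volume : Measure Space)) hset).1 ?_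
      filter_upwards [ae_restrict_mem measurableSet_Ioi] with t ht
      rcases lt_or_ge t T with h | h
      · filter_upwards [hD t (le_of_lt ht)] with ξ hξ
        exact (truncate_le T f t ξ).trans (hξ.trans (differenceMajorant_truncate_le h.le f b ξ))
      · exact ae_of_all _ fun ξ => by simp [truncate_of_le h]
    have h2 : Φ T ≤ 16 * K * Φ T * Φ T + 32 * K * l4Sq b * Φ T := by
      calc Φ T ≤ _ := h1
        _ ≤ 4 * (K * (Φ T * Φ T) + 4 * (K * (Φ T * l4Sq b) + K * (l4Sq b * Φ T))) := by
          refine (l4Sq_add_le (measurable_duhamelMajorant _ hT hT)).trans ?_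
          gcongr
          · exact hS _ _ hT hT
          · refine (l4Sq_add_le (measurable_duhamelMajorant _ hT hbm)).trans ?_
            gcongr
            · exact hS _ _ hT hbm
            · exact hS _ _ hbm hT
        _ = 4 * K * Φ T * Φ T + 32 * K * l4Sq b * Φ T := by ring
        _ ≤ _ := by gcongr; norm_num
    have h3 : 32 * K * l4Sq b * Φ T + 32 * K * l4Sq b * Φ T ≤ Φ T := by
      calc _ = (64 * K) * l4Sq b * Φ T := by ring
        _ ≤ (64 * K) * (64 * K)⁻¹ * Φ T := by gcongr
        _ ≤ 1 * Φ T := by gcongr; exact ENNReal.mul_inv_le_one _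
        _ = _ := one_mul _
    -- Doubling the estimate brings the linear part to at most one copy of `Φ T`, which cancels
    -- because `Φ T` is finite.
    have h4 : Φ T + Φ T ≤ 32 * K * Φ T * Φ T + Φ T := by
      calc _ ≤ (16 * K * Φ T * Φ T + 32 * K * l4Sq b * Φ T) +
            (16 * K * Φ T * Φ T + 32 * K * l4Sq b * Φ T) := by gcongr
        _ = 32 * K * Φ T * Φ T + (32 * K * l4Sq b * Φ T + 32 * K * l4Sq b * Φ T) := by ring
        _ ≤ _ := by gcongr
    exact (ENNReal.add_le_add_iff_right (hΦfin T)).1 h4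
  have hΦc : Continuous Φ := continuous_l4Sq_truncate hfm hffin
  -- By `hΦle`, `Φ` is either `0` or at least `1 / (32 K)`. Its zero set is therefore also the open
  -- set `32 K Φ < 1`, and the line is connected.
  have hclopen : IsClopen {T | Φ T = 0} := by
    refine ⟨isClosed_singleton.preimage hΦc, ?_⟩
    have : {T | Φ T = 0} = {T | 32 * K * Φ T < 1} := by
      ext T
      refine ⟨fun h => ?_, fun h => ?_⟩
      · have h' : Φ T = 0 := h
        change 32 * K * Φ T < 1
        rw [h', mul_zero]
        exact one_pos
      by_contra hne
      have h1 := ENNReal.mul_lt_mul_left hne (hΦfin T) h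
      rw [one_mul] at h1
      exact absurd (hΦle T) (not_le.2 h1)
    rw [this]
    exact isOpen_Iio.preimage ((ENNReal.continuous_const_mul (by finiteness)).comp hΦc)
  have hΦ0 : ∀ T, Φ T = 0 := by
    have h0 : (0 : ℝ) ∈ {T | Φ T = 0} := by
      have : Φ 0 ≤ l4Sq (fun _ _ => 0) := by
        refine l4Sq_mono_ae (ae_of_all _ fun ξ => ?_)
        filter_upwards [ae_restrict_mem measurableSet_Ioi] with t ht
        rw [truncate_of_le (le_of_lt ht)]
      simpa [l4Sq, timeFourth] using this
    intro T
    have := hclopen.eq_univ ⟨0, h0⟩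
    have hT : T ∈ {T | Φ T = 0} := by rw [this]; trivial
    exact hT
  intro t ht
  have hT := measurable_truncate t hfm
  -- Vanishing of `Φ` concerns almost every time only. The Duhamel bound, uniform in time, upgrades
  -- it to the given `t`.
  have hzero : ∀ u v : ℝ → Space → ℝ≥0∞, Measurable (Function.uncurry u) →
      Measurable (Function.uncurry v) → l4Sq u * l4Sq v = 0 →
      ∀ᵐ ξ, duhamelMajorant bilinearConst u v t ξ = 0 := by
    intro u v hu hv huv
    have h1 : prodSq u v = 0 := by
      have := hC u v hu hv
      rwa [huv, mul_zero, nonpos_iff_eq_zero] at this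
    have hm := measurable_timeSq (measurable_conv hu hv)
    rw [prodSq, lintegral_eq_zero_iff (by fun_prop)] at h1
    filter_upwards [h1, enorm_ne_zero_ae] with ξ h2 h3
    have h4 := (mul_eq_zero.1 h2).resolve_left h3
    have h5 := sq_duhamelMajorant_le (κ := bilinearConst) hu hv t ξ
    rw [h4, mul_zero, nonpos_iff_eq_zero] at h5
    exact pow_eq_zero_iff (by norm_num) |>.1 h5
  have z : l4Sq (truncate t f) = 0 := hΦ0 t
  filter_upwards [hD t ht, hzero _ _ hT hT (by simp [z]), hzero _ _ hT hbm (by simp [z]),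
    hzero _ _ hbm hT (by simp [z])] with ξ h1 h2 h3 h4
  have h5 := h1.trans (differenceMajorant_truncate_le le_rfl f b ξ)
  rw [differenceMajorant, h2, h3, h4, add_zero, add_zero, nonpos_iff_eq_zero, enorm_eq_zero] at h5
  exact sub_eq_zero.1 h5

/-! ### The norms in terms of the Fourier transform -/

theorem ofReal_norm_rpow_half (ξ : Space) : ENNReal.ofReal (‖ξ‖ ^ (2 * (1 / 2) : ℝ)) = ‖ξ‖ₑ := by
  rw [show (2 * (1 / 2) : ℝ) = 1 by norm_num, Real.rpow_one, ofReal_norm]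

theorem ofReal_norm_rpow_three_halves (ξ : Space) :
    ENNReal.ofReal (‖ξ‖ ^ (2 * (3 / 2) : ℝ)) = ‖ξ‖ₑ ^ 3 := by
  rw [show (2 * (3 / 2) : ℝ) = (3 : ℕ) by norm_num, Real.rpow_natCast,
    ENNReal.ofReal_pow (norm_nonneg _), ofReal_norm]

theorem sq_rpow_half (x : ℝ≥0∞) : (x ^ (1 / 2 : ℝ)) ^ 2 = x := by
  rw [← ENNReal.rpow_natCast, ← ENNReal.rpow_mul]
  norm_num

theorem lintegral_time_eq (g : ℝ → Space → Vec) :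
    ∫⁻ ξ : Space, ∫⁻ t in Set.Ici (0 : ℝ),
      ENNReal.ofReal (‖ξ‖ ^ (2 * (3 / 2) : ℝ)) * ‖g t ξ‖ₑ ^ 2 =
    ∫⁻ ξ : Space, ‖ξ‖ₑ ^ 3 * timeSq (fun t ξ => ‖g t ξ‖ₑ) ξ := by
  refine lintegral_congr fun ξ => ?_
  rw [ofReal_norm_rpow_three_halves, lintegral_const_mul' _ _ (by finiteness), timeSq,
    restrict_Ioi_eq_restrict_Ici]

theorem hdotNorm_sq {f : Field} {g : Space → Vec} (h : HasFourier f g) :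
    hdotNorm (1 / 2) f ^ 2 = ∫⁻ ξ, ‖ξ‖ₑ * ‖g ξ‖ₑ ^ 2 := by
  have e : hdotNorm (1 / 2) f = (∫⁻ ξ, ‖ξ‖ₑ * ‖g ξ‖ₑ ^ 2) ^ (1 / 2 : ℝ) := by
    unfold hdotNorm
    simp only [ofReal_norm_rpow_half]
    refine le_antisymm (iInf₂_le g h) (le_iInf₂ fun g' h' => le_of_eq ?_)
    congr 1
    refine lintegral_congr_ae ?_
    filter_upwards [h.ae_eq h'] with ξ hξ
    rw [hξ]
  rw [e, sq_rpow_half]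

theorem exists_hasFourier_of_hdotNorm_lt_top {s : ℝ} {f : Field} (h : hdotNorm s f < ∞) :
    ∃ g, HasFourier f g := by
  obtain ⟨g, hg⟩ := iInf_lt_iff.1 h
  obtain ⟨hg, -⟩ := iInf_lt_iff.1 hg
  exact ⟨g, hg⟩

section Spectrum

variable {u : ℝ → Field} {g g' : ℝ → Space → Vec}

theorem supNorm_sq_le (h : HasSpectrum u g) {B : Space → ℝ≥0∞}
    (hB : ∀ t ξ, 0 ≤ t → ‖g t ξ‖ₑ ^ 2 ≤ B ξ) : supNorm (1 / 2) u ^ 2 ≤ ∫⁻ ξ, ‖ξ‖ₑ * B ξ := by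
  rw [← sq_rpow_half (∫⁻ ξ, ‖ξ‖ₑ * B ξ)]
  refine pow_le_pow_left' ((iInf₂_le g h).trans ?_) 2
  simp only [ofReal_norm_rpow_half]
  refine ENNReal.rpow_le_rpow (lintegral_mono fun ξ => mul_le_mul' le_rfl ?_) (by norm_num)
  rw [← sq_rpow_half (B ξ)]
  refine pow_le_pow_left' (iSup₂_le fun t ht => ?_) 2
  calc ‖g t ξ‖ₑ = (‖g t ξ‖ₑ ^ 2) ^ (1 / 2 : ℝ) := by
        rw [← ENNReal.rpow_natCast, ← ENNReal.rpow_mul]; norm_num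
    _ ≤ _ := ENNReal.rpow_le_rpow (hB t ξ ht) (by norm_num)

theorem l2Norm_sq_le (h : HasSpectrum u g) :
    l2Norm (3 / 2) u ^ 2 ≤ ∫⁻ ξ, ‖ξ‖ₑ ^ 3 * timeSq (fun t ξ => ‖g t ξ‖ₑ) ξ := by
  rw [← sq_rpow_half (∫⁻ ξ, ‖ξ‖ₑ ^ 3 * timeSq (fun t ξ => ‖g t ξ‖ₑ) ξ), ← lintegral_time_eq]
  exact pow_le_pow_left' (iInf₂_le g h) 2

theorem exists_of_supNorm_lt_top (h : supNorm (1 / 2) u < ∞) : ∃ g, HasSpectrum u g ∧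
    ∫⁻ ξ, ‖ξ‖ₑ * (⨆ (t : ℝ) (_ : 0 ≤ t), ‖g t ξ‖ₑ) ^ 2 < ∞ := by
  obtain ⟨g, h⟩ := iInf_lt_iff.1 h
  obtain ⟨hg, h⟩ := iInf_lt_iff.1 h
  simp only [ofReal_norm_rpow_half] at h
  exact ⟨g, hg, (ENNReal.rpow_lt_top_iff_of_pos (by norm_num)).1 h⟩

theorem exists_of_l2Norm_lt_top (h : l2Norm (3 / 2) u < ∞) : ∃ g, HasSpectrum u g ∧
    ∫⁻ ξ, ‖ξ‖ₑ ^ 3 * timeSq (fun t ξ => ‖g t ξ‖ₑ) ξ < ∞ := by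
  obtain ⟨g, h⟩ := iInf_lt_iff.1 h
  obtain ⟨hg, h⟩ := iInf_lt_iff.1 h
  rw [lintegral_time_eq] at h
  exact ⟨g, hg, (ENNReal.rpow_lt_top_iff_of_pos (by norm_num)).1 h⟩

/-- Two versions agree at each time off a null set of frequencies that may depend on the time; joint
measurability and Fubini reverse the order. -/
theorem HasSpectrum.ae_ae_eq (h : HasSpectrum u g) (h' : HasSpectrum u g') :
    ∀ᵐ ξ, ∀ᵐ t ∂volume.restrict (Set.Ioi (0 : ℝ)), g t ξ = g' t ξ := by
  have hset : MeasurableSet {q : ℝ × Space | g q.1 q.2 = g' q.1 q.2} :=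
    measurableSet_eq_fun h.1 h'.1
  refine (Measure.ae_ae_comm (μ := volume.restrict (Set.Ioi (0 : ℝ)))
    (ν := (volume : Measure Space)) hset).1 ?_
  filter_upwards [ae_restrict_mem measurableSet_Ioi] with t ht
  exact (h.2 t (le_of_lt ht)).ae_eq (h'.2 t (le_of_lt ht))

/-- Finiteness of the two norms may be witnessed by different versions of the spectrum. Both time
integrals are insensitive to the version, so everything is compared with the version whose supremum
is controlled. -/
theorem HasSpectrum.l4Sq_ne_top (h : HasSpectrum u g) (hs : supNorm (1 / 2) u < ∞)
    (hl : l2Norm (3 / 2) u < ∞) : l4Sq (fun t ξ => ‖g t ξ‖ₑ) ≠ ∞ := by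
  obtain ⟨g₁, h₁, hs⟩ := exists_of_supNorm_lt_top hs
  obtain ⟨g₂, h₂, hl⟩ := exists_of_l2Norm_lt_top hl
  have e1 : l4Sq (fun t ξ => ‖g t ξ‖ₑ) ≤ l4Sq (fun t ξ => ‖g₁ t ξ‖ₑ) := by
    refine l4Sq_mono_ae ?_
    filter_upwards [h.ae_ae_eq h₁] with ξ hξ
    filter_upwards [hξ] with t ht
    rw [ht]
  have e2 : ∫⁻ ξ, ‖ξ‖ₑ ^ 3 * timeSq (fun t ξ => ‖g₁ t ξ‖ₑ) ξ =
      ∫⁻ ξ, ‖ξ‖ₑ ^ 3 * timeSq (fun t ξ => ‖g₂ t ξ‖ₑ) ξ := by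
    refine lintegral_congr_ae ?_
    filter_upwards [h₁.ae_ae_eq h₂] with ξ hξ
    congr 1
    refine lintegral_congr_ae ?_
    filter_upwards [hξ] with t ht
    rw [ht]
  refine (e1.trans_lt ((l4Sq_le (f := fun t ξ => ‖g₁ t ξ‖ₑ)
    (B := fun ξ => (⨆ (t : ℝ) (_ : 0 ≤ t), ‖g₁ t ξ‖ₑ) ^ 2) h₁.1.enorm fun t ξ ht => ?_).trans_lt
    (ENNReal.add_lt_top.2 ⟨hs, e2 ▸ hl⟩))).ne
  exact pow_le_pow_left' (le_iSup₂_of_le (f := fun (t : ℝ) (_ : 0 ≤ t) => ‖g₁ t ξ‖ₑ)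
    t ht.le le_rfl) 2

theorem exists_hasSpectrum (hg : Measurable (Function.uncurry g))
    (hH : ∀ t, 0 ≤ t → ∫⁻ ξ, ‖ξ‖ₑ * ‖g t ξ‖ₑ ^ 2 < ∞) : ∃ u, HasSpectrum u g := by
  have h : ∀ t, ∃ f : Field, 0 ≤ t → HasFourier f (g t) := fun t => by
    by_cases ht : 0 ≤ t
    · obtain ⟨f, hf⟩ := exists_hasFourier (hg.comp measurable_prodMk_left) (hH t ht)
      exact ⟨f, fun _ => hf⟩
    · exact ⟨0, fun h => absurd h ht⟩
  choose u hu using h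
  exact ⟨u, hg, hu⟩

end Spectrum

theorem measurable_dotForm {g : Space → Vec} (hg : Measurable g) :
    Measurable fun ξ => dotForm ξ (g ξ) := by
  simp only [dotForm_apply]
  refine Finset.measurable_sum _ fun k _ => ?_
  have := measurable_apply hg k
  fun_prop

/-- The Fourier transform of a real divergence-free field has a version for which the symmetries
hold everywhere. -/
theorem HasFourier.exists_symmetric {f : Field} {g : Space → Vec} (h : HasFourier f g)
    (hr : IsReal f) (hd : IsDivFree f) : ∃ g', Measurable g' ∧ HasFourier f g' ∧
      (∀ ξ, g' (-ξ) = conjVec (g' ξ)) ∧ ∀ ξ, dotForm ξ (g' ξ) = 0 := by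
  obtain ⟨g₁, hm, he⟩ : ∃ g₁, Measurable g₁ ∧ g =ᵐ[volume] g₁ :=
    ⟨_, h.1.aestronglyMeasurable.stronglyMeasurable_mk.measurable, h.1.aestronglyMeasurable.ae_eq_mk⟩
  have h1 := h.congr he
  -- The conditions are imposed at `ξ` and at `-ξ`, so that `S` is stable under negation and cutting
  -- off to it preserves the symmetry.
  set S : Set Space := {ξ | (g₁ (-ξ) = conjVec (g₁ ξ) ∧ g₁ ξ = conjVec (g₁ (-ξ))) ∧
    dotForm ξ (g₁ ξ) = 0 ∧ dotForm (-ξ) (g₁ (-ξ)) = 0} with hS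
  have hneg : Measurable fun ξ => g₁ (-ξ) := hm.comp measurable_neg
  have hSm : MeasurableSet S := by
    have hc : Measurable (conjVec : Vec → Vec) := conjVec.continuous.measurable
    refine ((measurableSet_eq_fun hneg (hc.comp hm)).inter
      (measurableSet_eq_fun hm (hc.comp hneg))).inter
      ((measurableSet_eq_fun (measurable_dotForm hm) measurable_const).inter
        (measurableSet_eq_fun ((measurable_dotForm hm).comp measurable_neg) measurable_const))
  have hSn : ∀ ξ, -ξ ∈ S ↔ ξ ∈ S := fun ξ => by
    simp only [hS, Set.mem_ofPred_eq, neg_neg]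
    tauto
  have hSae : ∀ᵐ ξ, ξ ∈ S := by
    have r := h1.ae_neg_eq_conj hr
    have d := h1.ae_dotForm_eq_zero hd
    filter_upwards [r, ae_neg r, d, ae_neg d] with ξ r1 r2 d1 d2
    rw [neg_neg] at r2
    exact ⟨⟨r1, r2⟩, d1, d2⟩
  refine ⟨S.indicator g₁, hm.indicator hSm, h1.congr ?_, fun ξ => ?_, fun ξ => ?_⟩
  · filter_upwards [hSae] with ξ hξ
    rw [Set.indicator_of_mem hξ]
  · by_cases hξ : ξ ∈ S
    · rw [Set.indicator_of_mem hξ, Set.indicator_of_mem ((hSn ξ).2 hξ)]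
      exact hξ.1.1
    · rw [Set.indicator_of_notMem hξ, Set.indicator_of_notMem (mt (hSn ξ).1 hξ), map_zero]
  · by_cases hξ : ξ ∈ S
    · rw [Set.indicator_of_mem hξ]
      exact hξ.2.1
    · rw [Set.indicator_of_notMem hξ, map_zero]

/-! ### Existence -/

section Existence

variable {g₀ : Space → Vec}

theorem measurable_supMajorant {κ : ℝ≥0∞} {a : Space → ℝ≥0∞} (ha : Measurable a) :
    Measurable (supMajorant κ a) := by
  have hM := measurable_majorant (κ := κ) (measurable_heatMajorant ha)
  have := measurable_timeSq (measurable_conv hM hM)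
  unfold supMajorant
  fun_prop

/-- One integrable bound, independent of time, controls the majorant, so finiteness holds for almost
every frequency at every single time. -/
theorem ae_solMajorant_lt_top (hg : Measurable g₀)
    (hB : ∫⁻ ξ, ‖ξ‖ₑ * supMajorant bilinearConst (fun ξ => ‖g₀ ξ‖ₑ) ξ < ∞) (s : ℝ) (hs : 0 ≤ s) :
    ∀ᵐ ξ, solMajorant g₀ s ξ < ∞ := by
  have hm := measurable_supMajorant (κ := bilinearConst) hg.enorm
  filter_upwards [ae_lt_top (by fun_prop) hB.ne, enorm_ne_zero_ae] with ξ h1 h2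
  have h3 : supMajorant bilinearConst (fun ξ => ‖g₀ ξ‖ₑ) ξ < ∞ := by
    refine lt_of_le_of_ne le_top fun h => ?_
    rw [h, ENNReal.mul_top h2] at h1
    exact h1.ne rfl
  have h4 := (sq_majorant_le (κ := bilinearConst) hg.enorm hs ξ).trans_lt h3
  exact (ENNReal.pow_lt_top_iff.1 h4).resolve_right (by norm_num)

theorem mildEquation_mildSeries (hg : Measurable g₀)
    (hfin : ∀ s, 0 ≤ s → ∀ᵐ ξ, solMajorant g₀ s ξ < ∞) : MildEquation g₀ (mildSeries g₀) := by
  intro t ht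
  filter_upwards [hfin t ht, enorm_ne_zero_ae] with ξ h hξ
  refine ⟨?_, intervalIntegrable_mildSeries hg ht h, mildSeries_eq hg hfin ht hξ h⟩
  have h0 : ∀ᵐ s : ℝ, s ≠ 0 := by simp [ae_iff]
  filter_upwards [(ae_restrict_iff' measurableSet_Ioc).1 (conv_solMajorant_lt_top hg hξ h), h0]
    with s h1 h2 hs
  exact integrable_mildSeries_mul hg hs.1 (h1 ⟨lt_of_le_of_ne hs.1 h2.symm, hs.2⟩)

theorem isMildSolution_of_hasSpectrum {u₀ : Field} {u : ℝ → Field} (hg : Measurable g₀)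
    (hu₀ : HasFourier u₀ g₀) (hr : ∀ ξ, g₀ (-ξ) = conjVec (g₀ ξ)) (hd : ∀ ξ, dotForm ξ (g₀ ξ) = 0)
    (hfin : ∀ s, 0 ≤ s → ∀ᵐ ξ, solMajorant g₀ s ξ < ∞) (hu : HasSpectrum u (mildSeries g₀)) :
    IsMildSolution u₀ u := by
  refine ⟨fun t ht => ⟨(hu.2 t ht).isReal ?_, (hu.2 t ht).isDivFree ?_⟩, g₀, _, hu₀, hu,
    mildEquation_mildSeries hg hfin⟩
  · filter_upwards [hfin t ht, ae_neg (hfin t ht)] with ξ h h'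
    exact mildSeries_neg hr ht h h'
  · exact ae_of_all _ fun ξ => dotForm_mildSeries hd ht ξ

/-- The Fourier transform of `e^{√t|D|} u`. -/
def weightedSeries (g₀ : Space → Vec) (t : ℝ) (ξ : Space) : Vec :=
  (Real.exp (Real.sqrt t * ‖ξ‖) : ℂ) • mildSeries g₀ t ξ

theorem measurable_weightedSeries (hg : Measurable g₀) :
    Measurable (Function.uncurry (weightedSeries g₀)) := by
  have h1 : Measurable fun q : ℝ × Space => (Real.exp (Real.sqrt q.1 * ‖q.2‖) : ℂ) := by fun_prop
  exact h1.smul (measurable_mildSeries hg)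

theorem enorm_weightedSeries_le {t : ℝ} (ht : 0 ≤ t) (ξ : Space) :
    ‖weightedSeries g₀ t ξ‖ₑ ≤ solMajorant g₀ t ξ := by
  rw [weightedSeries, enorm_smul, enorm_ofReal_complex (Real.exp_pos _).le]
  exact weight_mul_enorm_mildSeries_le ht ξ

section Bounds

variable {G : ℝ → Space → Vec}

theorem sq_enorm_le_supMajorant (hg : Measurable g₀)
    (hG : ∀ t, 0 ≤ t → ∀ ξ, ‖G t ξ‖ₑ ≤ solMajorant g₀ t ξ)
    (t : ℝ) (ξ : Space) (ht : 0 ≤ t) :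
    ‖G t ξ‖ₑ ^ 2 ≤ supMajorant bilinearConst (fun ξ => ‖g₀ ξ‖ₑ) ξ :=
  (pow_le_pow_left' (hG t ht ξ) 2).trans (sq_majorant_le hg.enorm ht ξ)

theorem exists_hasSpectrum_of_le (hg : Measurable g₀)
    (hG : ∀ t, 0 ≤ t → ∀ ξ, ‖G t ξ‖ₑ ≤ solMajorant g₀ t ξ)
    (hB : ∫⁻ ξ, ‖ξ‖ₑ * supMajorant bilinearConst (fun ξ => ‖g₀ ξ‖ₑ) ξ < ∞)
    (hGm : Measurable (Function.uncurry G)) : ∃ u, HasSpectrum u G :=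
  exists_hasSpectrum hGm fun t ht => (lintegral_mono fun ξ =>
    mul_le_mul' le_rfl (sq_enorm_le_supMajorant hg hG t ξ ht)).trans_lt hB

theorem supNorm_sq_le_of_le {u : ℝ → Field} (hg : Measurable g₀)
    (hG : ∀ t, 0 ≤ t → ∀ ξ, ‖G t ξ‖ₑ ≤ solMajorant g₀ t ξ)
    (hu : HasSpectrum u G) :
    supNorm (1 / 2) u ^ 2 ≤ ∫⁻ ξ, ‖ξ‖ₑ * supMajorant bilinearConst (fun ξ => ‖g₀ ξ‖ₑ) ξ :=
  supNorm_sq_le hu (sq_enorm_le_supMajorant hg hG)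

theorem l2Norm_sq_le_of_le {u : ℝ → Field} (hg : Measurable g₀)
    (hG : ∀ t, 0 ≤ t → ∀ ξ, ‖G t ξ‖ₑ ≤ solMajorant g₀ t ξ)
    (hu : HasSpectrum u G) :
    l2Norm (3 / 2) u ^ 2 ≤ ∫⁻ ξ, ‖ξ‖ₑ * supMajorant bilinearConst (fun ξ => ‖g₀ ξ‖ₑ) ξ := by
  refine (l2Norm_sq_le hu).trans (lintegral_mono fun ξ => ?_)
  calc _ ≤ ‖ξ‖ₑ ^ 3 * timeSq (solMajorant g₀) ξ := by
        refine mul_le_mul' le_rfl (setLIntegral_mono' measurableSet_Ioi fun t ht => ?_)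
        exact pow_le_pow_left' (hG t (le_of_lt ht) ξ) 2
    _ = ‖ξ‖ₑ * (‖ξ‖ₑ ^ 2 * timeSq (solMajorant g₀) ξ) := by ring
    _ ≤ _ := mul_le_mul' le_rfl (timeSq_majorant_le hg.enorm ξ)

end Bounds

end Existence

theorem lt_top_of_sq_le {x y : ℝ≥0∞} (h : x ^ 2 ≤ y) (hy : y < ∞) : x < ∞ :=
  (ENNReal.pow_lt_top_iff.1 (h.trans_lt hy)).resolve_right (by norm_num)

end NavierStokes

end

/-! ### The main theorem. -/

theorem mainTheorem5 :
    ∃ ε₀ : ℝ, 0 < ε₀ ∧ ∃ c₀ : ℝ, 0 < c₀ ∧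
      ∀ u₀ : NavierStokes.Field,
        NavierStokes.IsReal u₀ → NavierStokes.IsDivFree u₀ →
        NavierStokes.hdotNorm (1 / 2) u₀ < ENNReal.ofReal ε₀ →
        ∃ u : ℝ → NavierStokes.Field,
          NavierStokes.IsGlobalSolution u₀ u ∧
          (∀ v : ℝ → NavierStokes.Field,
            NavierStokes.IsGlobalSolution u₀ v → ∀ t, 0 ≤ t → v t = u t) ∧
          ∃ V : ℝ → NavierStokes.Field,
            (∀ t, 0 ≤ t → NavierStokes.IsFourierMultiplier
              (fun ξ => Real.exp (Real.sqrt t * ‖ξ‖)) (u t) (V t)) ∧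
            NavierStokes.supNorm (1 / 2) V ^ 2 + NavierStokes.l2Norm (3 / 2) V ^ 2 ≤
              ENNReal.ofReal c₀ * NavierStokes.hdotNorm (1 / 2) u₀ ^ 2 := by
  open NavierStokes in
  obtain ⟨θ, hθ, huniq⟩ := exists_uniqueness_threshold
  obtain ⟨ε, hε, hmaj⟩ := exists_majorant_bound (κ := bilinearConst) (by simp [bilinearConst]) hθ
  -- The majorant bound is stated for the square of the norm; capping `ε` by `1` makes it finite and
  -- its square at most `ε`.
  obtain ⟨ε₀, hε₀, hle⟩ : ∃ ε₀ : ℝ, 0 < ε₀ ∧ ENNReal.ofReal ε₀ ^ 2 ≤ ε := by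
    have h1 : min ε 1 ≠ ∞ := (min_le_right ε 1).trans_lt ENNReal.one_lt_top |>.ne
    refine ⟨(min ε 1).toReal, ENNReal.toReal_pos (lt_min hε.bot_lt one_pos).ne' h1, ?_⟩
    rw [ENNReal.ofReal_toReal h1, sq]
    calc min ε 1 * min ε 1 ≤ ε * 1 := mul_le_mul' (min_le_left _ _) (min_le_right _ _)
      _ = ε := mul_one ε
  -- The constant is `32 + 32`, one summand for each of the two norms.
  refine ⟨ε₀, hε₀, 64, by norm_num, fun u₀ hr hd hsmall => ?_⟩
  obtain ⟨g, h⟩ := exists_hasFourier_of_hdotNorm_lt_top (hsmall.trans ENNReal.ofReal_lt_top)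
  obtain ⟨g₀, hg, h₀, hr₀, hd₀⟩ := h.exists_symmetric hr hd
  have hH := hdotNorm_sq h₀
  have hH' : ∫⁻ ξ, ‖ξ‖ₑ * ‖g₀ ξ‖ₑ ^ 2 ≤ ENNReal.ofReal ε₀ ^ 2 :=
    hH ▸ pow_le_pow_left' hsmall.le 2
  obtain ⟨hl4, hB⟩ := hmaj (fun ξ => ‖g₀ ξ‖ₑ) hg.enorm (hH'.trans hle)
  have hBt : ∫⁻ ξ, ‖ξ‖ₑ * supMajorant bilinearConst (fun ξ => ‖g₀ ξ‖ₑ) ξ < ∞ :=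
    hB.trans_lt (ENNReal.mul_lt_top (by simp) (hH'.trans_lt (by finiteness)))
  have hfin := ae_solMajorant_lt_top hg hBt
  have hM : ∀ t, 0 ≤ t → ∀ ξ, ‖mildSeries g₀ t ξ‖ₑ ≤ solMajorant g₀ t ξ :=
    fun t ht ξ => enorm_mildSeries_le ht ξ
  have hW : ∀ t, 0 ≤ t → ∀ ξ, ‖weightedSeries g₀ t ξ‖ₑ ≤ solMajorant g₀ t ξ :=
    fun t ht ξ => enorm_weightedSeries_le ht ξ
  obtain ⟨u, hu⟩ := exists_hasSpectrum_of_le hg hM hBt (measurable_mildSeries hg)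
  obtain ⟨V, hV⟩ := exists_hasSpectrum_of_le hg hW hBt (measurable_weightedSeries hg)
  have hus := lt_top_of_sq_le (supNorm_sq_le_of_le hg hM hu) hBt
  have hul := lt_top_of_sq_le (l2Norm_sq_le_of_le hg hM hu) hBt
  refine ⟨u, ⟨isMildSolution_of_hasSpectrum hg h₀ hr₀ hd₀ hfin hu, hus, hul⟩, ?_, V, ?_, ?_⟩
  -- Only the constructed solution is small; the competitor enters through finiteness of its
  -- `L̃⁴(Ḣ¹)` norm. Its datum may be another version of the same Fourier transform, and equal
  -- spectra give equal distributions.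
  · rintro v ⟨⟨-, p₀, p, hp₀, hp, hpe⟩, hvs, hvl⟩ t ht
    have hl4' : l4Sq (fun t ξ => ‖mildSeries g₀ t ξ‖ₑ) ≤ θ := by
      refine (l4Sq_mono_ae (ae_of_all _ fun ξ => ?_)).trans hl4
      filter_upwards [ae_restrict_mem measurableSet_Ioi] with s hs
      exact hM s (le_of_lt hs) ξ
    have e := huniq p₀ g₀ p (mildSeries g₀) hp.1 hu.1 (hp₀.ae_eq h₀) hpe
      (mildEquation_mildSeries hg hfin) (hp.l4Sq_ne_top hvs hvl) (hu.l4Sq_ne_top hus hul) hl4' t ht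
    exact ((hp.2 t ht).congr e).field_eq (hu.2 t ht)
  · exact fun t ht => ⟨_, hu.2 t ht, hV.2 t ht⟩
  · calc _ ≤ 32 * hdotNorm (1 / 2) u₀ ^ 2 + 32 * hdotNorm (1 / 2) u₀ ^ 2 := by
          rw [hH]
          exact add_le_add ((supNorm_sq_le_of_le hg hW hV).trans hB)
            ((l2Norm_sq_le_of_le hg hW hV).trans hB)
      _ = _ := by
          rw [← add_mul, ENNReal.ofReal_ofNat]
          norm_num
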